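/- **Setting.** Consider $\min\{f(x): x\in\mathcal X,\ Ax=b,\ g(x)\in-\mathcal K\}$, where $\mathcal X\subset\mathbb R^n$ is convex and compact, $\mathcal K\subset\mathbb R^m$ is a proper cone, $A\in\mathbb R^{p\times n}$ has rank $p<n$, $f$ is convex on $\mathcal X$ with modulus $\mu\ge0$, $g$ is $\mathcal K$-convex on $\mathcal X$, and $f,g$ are $C^1$ on an open set containing $\mathcal X$ with derivatives that are Lipschitz on $\mathcal X$. Put $\Phi(x,y)=f(x)+\langle v,Ax-b\rangle+\langle\lambda,g(x)\rangle$ for $y=(v,\lambda)$, $\mathcal Y=\mathbb R^p\times\mathcal K^*$ and, for $B\in[0,\infty]$, $\hat{\mathcal Y}=\mathcal Y\cap\{\|y\|\le B\}$, $\hat{\mathcal Z}=\mathcal X\times\hat{\mathcal Y}$, $\hat{\mathcal L}(x,y)=\iota_{\mathcal X}(x)+\Phi(x,y)-\iota_{\hat{\mathcal Y}}(y)$; let $\hat{\mathcal Z}^\star$ be the set of saddle points of $\hat{\mathcal L}$. For $B=\infty$ assume that $\hat{\mathcal Z}^\star\neq\emptyset$. Let $\varphi_p,\varphi_d$ be $1$-strongly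 convex, differentiable on open sets containing $\mathcal X$, $\mathcal Y$, with $L_\varphi$-Lipschitz gradients on $\mathcal X$, $\mathcal Y$, and let $\mathbf D_p,\mathbf D_d$ be their Bregman distances; if $\mu>0$, let $\varphi_p=\frac12\|\cdot\|^2$. For $\xi>0$ set $$\mathcal G_\xi(z)=\sup_{z'=(x',y')}\{\hat{\mathcal L}(x,y')-\hat{\mathcal L}(x',y)-2\xi\mathbf D_p(x',x)-2\xi\mathbf D_d(y',y)\}.$$ Metric subregularity (for $B$) means: for each $z^\star\in\hat{\mathcal Z}^\star$ there are $\varepsilon,\rho>0$ with $\mathrm{dist}(z,\hat{\mathcal Z}^\star)\le\rho\,\mathrm{dist}(0,\mathcal F(z))$ for all $z\in\hat{\mathcal Z}$, $\|z-z^\star\|<\varepsilon$, where $\mathcal F=(\partial_x\hat{\mathcal L},\partial_y(-\hat{\mathcal L}))$. **Base method (APDB).** Parameters: $c_\alpha,c_\beta,\delta$, $\eta\in(0,1)$, $\bar\tau,\gamma_0>0$, $c_{\rm nm}\in\{0,1\}$. Start from $(x^0,y^0)\in\hat{\mathcal Z}$ with $(x^{-1},y^{-1})=(x^0,y^0)$,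 $\tau_{-1}=\bar\tau$, $\sigma_{-1}=\gamma_0\bar\tau$ and initial trial $\tau_0=\bar\tau$. In iteration $k$, put $\sigma_k=\gamma_k\tau_k$, $\theta_k=\sigma_{k-1}/\sigma_k$. *xy order* ($\alpha_{k+1}=c_\alpha/\tau_k$, $\beta_{k+1}=\gamma_0c_\beta/\sigma_k$; $c_\alpha,c_\beta>0$, $\delta\ge0$, $c_\alpha+c_\beta+\delta<1$): $s^k=(1+\theta_k)\nabla_x\Phi(x^k,y^k)-\theta_k\nabla_x\Phi(x^{k-1},y^{k-1})$, $x^{k+1}=\arg\min_{\mathcal X}\langle s^k,x\rangle+\frac1{\tau_k}\mathbf D_p(x,x^k)$, $y^{k+1}=\arg\min_{\hat{\mathcal Y}}-\langle\nabla_y\Phi(x^{k+1},y^k),y\rangle+\frac1{\sigma_k}\mathbf D_d(y,y^k)$, and $$E_k(x,y)=\tfrac1{2\alpha_{k+1}}\|\nabla_x\Phi(x,y)-\nabla_x\Phi(x,y^k)\|^2-\tfrac1{\sigma_k}\mathbf D_d(y,y^k)+\tfrac1{2\beta_{k+1}}\|\nabla_x\Phi(x,y^k)-\nabla_x\Phi(x^k,y^k)\|^2-\big(\tfrac1{\tau_k}-\theta_k(\alpha_k+\beta_k)\big)\mathbf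 D_p(x,x^k).$$ *yx order* ($\alpha_{k+1}=c_\alpha/\sigma_k$; $0<c_\alpha<1$, $c_\beta=0$, $\delta\ge0$, $c_\alpha+\delta\le1$): $s^k=(1+\theta_k)\nabla_y\Phi(x^k,y^k)-\theta_k\nabla_y\Phi(x^{k-1},y^{k-1})$, $y^{k+1}=\arg\min_{\hat{\mathcal Y}}-\langle s^k,y\rangle+\frac1{\sigma_k}\mathbf D_d(y,y^k)$, $x^{k+1}=\arg\min_{\mathcal X}\langle\nabla_x\Phi(x^k,y^{k+1}),x\rangle+\frac1{\tau_k}\mathbf D_p(x,x^k)$, and $$E_k(x,y)=\Phi(x,y)-\Phi(x^k,y)-\langle\nabla_x\Phi(x^k,y),x-x^k\rangle-\tfrac1{\tau_k}\mathbf D_p(x,x^k)+\tfrac1{2\alpha_{k+1}}\|\nabla_y\Phi(x,y)-\nabla_y\Phi(x^k,y)\|^2-\big(\tfrac1{\sigma_k}-\theta_k\alpha_k\big)\mathbf D_d(y,y^k).$$ The trial $\tau_k$ is multiplied by $\eta$ until $E_k(x^{k+1},y^{k+1})\le-\frac\delta{\tau_k}\mathbf D_p(x^{k+1},x^k)-\frac\delta{\sigma_k}\mathbf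 D_d(y^{k+1},y^k)$. Then $\gamma_{k+1}=\gamma_k(1+\mu\tau_k)$ and the next trial is $\tau_{k+1}=\tau_k\sqrt{\frac{\gamma_k}{\gamma_{k+1}}\big(1+c_{\rm nm}\frac{\tau_k}{\tau_{k-1}}\big)}$. The output after $K\ge1$ iterations is $\bar z^K=\sum_{k<K}\sigma_kz^{k+1}/\sum_{k<K}\sigma_k$. **Adaptive restart.** Given $q\in(0,1)$ and $z^{0,0}\in\hat{\mathcal Z}$, run APDB from $z^{t,0}$, with output $\bar z^{t,K}$ after $K$ iterations; $z^{t+1,0}=\bar z^{t,K_t}$, where $K_t\ge1$ is the first $K$ with $\mathcal G_\xi(\bar z^{t,K})\le q\,\mathcal G_\xi(z^{t,0})$. **Theorem (rAPDB-yx-ada).** Suppose that some dual optimal solution $y^\star$ has $\|y^\star\|\le\bar B$, let $\bar B<B<\infty$, and assume metric subregularity for $B$. Then there is $\hat\rho>0$, independent of the algorithm's parameters and of $q$, with $\mathrm{dist}^2(z,\hat{\mathcal Z}^\star)\le\hat\rho\,\mathcal G_\xi(z)$ on $\hat{\mathcal Z}$. For all parameters and all $q\in(0,1)$ there is an integer $\bar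 K\ge1$ such that for all $z^{0,0}\in\hat{\mathcal Z}$: every backtracking loop terminates; for all $t\ge0$ the restart test holds for every $K\ge\bar K$, so that $K_t\le\bar K$; $\mathcal G_\xi(z^{0,0})<\infty$; and for all $t\ge0$, $z^{t,0}\in\hat{\mathcal Z}$, $$\mathcal G_\xi(z^{t,0})\le q^t\,\mathcal G_\xi(z^{0,0}),\qquad \mathrm{dist}^2(z^{t,0},\hat{\mathcal Z}^\star)\le q^t\hat\rho\,\mathcal G_\xi(z^{0,0}).$$ Moreover $z^{t,0}$ converges to some $\tilde z^\star\in\hat{\mathcal Z}^\star$ with $\|z^{t,0}-\tilde z^\star\|\le c\,q^{t/2}$ for some $c$ and all $t$. If $\mu=0$, one may take $\bar K\le\lceil\max\{4c_1(1+\hat c_2^2)\hat\rho/q,\ 2c_1/\xi\}\rceil$, where $c_1=\frac{L_\varphi}2\frac{\bar\tau}{\hat\tau}\frac1{\min\{\bar\tau,\gamma_0\bar\tau\}}$, $\hat c_2^2=\frac{L_\varphi\max\{\gamma_0,1\}}{\min\{\gamma_0,1-c_\alpha\}}$, $\hat\tau=\min\{\bar\tau,\eta\Psi_2\}$, $\Psi_2=\frac{c_\alpha}{2\gamma_0}\frac{L_{xx}}{L_{yx}^2}\Big(-1+\sqrt{1+\frac{4(1-\delta)\gamma_0}{c_\alpha}\frac{L_{yx}^2}{L_{xx}^2}}\Big)$,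 and $L_{xx},L_{yx}>0$ are any Lipschitz constants of $\nabla_x\Phi(\cdot,y)$, $\nabla_y\Phi(\cdot,y)$ on $\mathcal X$, uniform in $y\in\hat{\mathcal Y}$. If $\mu>0$ and $c_{\rm nm}=0$, one may take $\bar K\le\lceil C/\sqrt q\rceil$ with $C$ independent of $q$ and $z^{0,0}$. **Theorem (rAPDB-xy-ada).** Let $B=\infty$, assume metric subregularity for $B=\infty$, and let $M\in\mathbb R$. There is $\rho>0$, independent of the algorithm's parameters and of $q$, with $\mathrm{dist}^2(z,\hat{\mathcal Z}^\star)\le\rho\,\mathcal G_\xi(z)$ for $z\in\hat{\mathcal Z}$, $\|z\|\le M$, and for all parameters and $q$ there is $\bar K\ge1$ such that all conclusions above (with $\rho$ for $\hat\rho$) hold for each $z^{0,0}\in\hat{\mathcal Z}$ whose restart points satisfy $\|z^{t,0}\|\le M$ for all $t$. If $\mu=0$, one may take $\bar K\le\lceil\max\{4c_1(1+c_2^2)\rho/q,\ 2c_1/\xi\}\rceil$ with $c_1$ as above but $\hat\tau=\min\{\bar\tau,\eta\Psi_1\}$, $c_2^2=\frac{L_\varphi\max\{\gamma_0,1\}}{\min\{\gamma_0(1-c_\alpha-c_\beta),1\}}$,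 $\Psi_1=\min\Big\{\frac{\sqrt{c_\alpha(1-\delta)}}{L_{xy}\sqrt{\gamma_0}},\frac{\sqrt{c_\beta(1-(c_\alpha+c_\beta+\delta))}}{L_{xx}}\Big\}$, where $L_{xx},L_{xy}>0$ are uniform Lipschitz constants of $\nabla_x\Phi(\cdot,y)$ on $\mathcal X$ and of $\nabla_x\Phi(x,\cdot)$ for $y\in\mathcal Y$ with $\|y\|\le R$, and $R>0$ is such that for each $z\in\hat{\mathcal Z}$ with $\|z\|\le M$ some $(x^\star,y^\star)\in\hat{\mathcal Z}^\star$ has $\|y^\star\|+\sqrt{2\gamma_0\mathbf D_p(x^\star,x)+2\mathbf D_d(y^\star,y)}\le R$. If $\mu>0$, one may take $\bar K\le\lceil C/\sqrt q\rceil$ with $C$ independent of $q$ and $z^{0,0}$. -/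

import Mathlib

noncomputable section

/-! ### Spaces -/

/-- `ℝⁿ` with the Euclidean norm. -/
abbrev PrimalSpace (n : ℕ) := EuclideanSpace ℝ (Fin n)

/-- `ℝᵖ × ℝᵐ` with the Euclidean norm; a point is `y = (v, lam)`. -/
abbrev DualSpace (p m : ℕ) := WithLp 2 (EuclideanSpace ℝ (Fin p) × EuclideanSpace ℝ (Fin m))

/-- `ℝⁿ × (ℝᵖ × ℝᵐ)` with the Euclidean norm; a point is `z = (x, y)`. -/
abbrev PDSpace (n p m : ℕ) := WithLp 2 (PrimalSpace n × DualSpace p m)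

/-- The point `(x, y)`. -/
def mkPD {n p m : ℕ} (x : PrimalSpace n) (y : DualSpace p m) : PDSpace n p m :=
  WithLp.toLp 2 (x, y)

/-! ### The conic program and its Lagrangian -/

/-- Data of the conic program `min {f x : x ∈ X, A x = b, g x ∈ -K}`, together with the
convexity modulus `mu` of `f`. -/
structure ConicProgram (n p m : ℕ) where
  X : Set (PrimalSpace n)
  K : Set (EuclideanSpace ℝ (Fin m))
  A : Matrix (Fin p) (Fin n) ℝ
  b : EuclideanSpace ℝ (Fin p)
  f : PrimalSpace n → ℝ
  g : PrimalSpace n → EuclideanSpace ℝ (Fin m)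
  mu : ℝ

namespace ConicProgram

variable {n p m : ℕ} (P : ConicProgram n p m)

/-- The dual cone `K* = {lam : ⟨lam, w⟩ ≥ 0 for all w ∈ K}`. -/
def dualCone : Set (EuclideanSpace ℝ (Fin m)) := {lam | ∀ w ∈ P.K, 0 ≤ inner ℝ lam w}

/-- `X` is convex and compact, `K` is a proper cone (closed, convex, pointed, with nonempty
interior), and `rank A = p < n`. -/
def SetsAssumption : Prop :=
  Convex ℝ P.X ∧ IsCompact P.X ∧
  IsClosed P.K ∧ Convex ℝ P.K ∧ (∀ c : ℝ, 0 ≤ c → ∀ w ∈ P.K, c • w ∈ P.K) ∧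
  (∀ w ∈ P.K, -w ∈ P.K → w = 0) ∧ (interior P.K).Nonempty ∧
  P.A.rank = p ∧ p < n

/-- `f` is convex on `X` with modulus `mu ≥ 0`, `g` is `K`-convex on `X`, both are continuously
differentiable on an open set containing `X`, with derivatives that are Lipschitz on `X`. -/
def SmoothnessAssumption : Prop :=
  0 ≤ P.mu ∧ StrongConvexOn P.X P.mu P.f ∧
  (∀ x ∈ P.X, ∀ x' ∈ P.X, ∀ a c : ℝ, 0 ≤ a → 0 ≤ c → a + c = 1 →
    a • P.g x + c • P.g x' - P.g (a • x + c • x') ∈ P.K) ∧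
  (∃ U : Set (PrimalSpace n), IsOpen U ∧ P.X ⊆ U ∧ ContDiffOn ℝ 1 P.f U ∧ ContDiffOn ℝ 1 P.g U) ∧
  (∃ Lf : ℝ, 0 ≤ Lf ∧ ∀ x ∈ P.X, ∀ x' ∈ P.X,
    ‖gradient P.f x' - gradient P.f x‖ ≤ Lf * ‖x' - x‖) ∧
  (∃ Lg : ℝ, 0 ≤ Lg ∧ ∀ x ∈ P.X, ∀ x' ∈ P.X,
    ‖fderiv ℝ P.g x' - fderiv ℝ P.g x‖ ≤ Lg * ‖x' - x‖)

/-- The coupling function `Φ(x, (v, lam)) = f x + ⟨v, A x - b⟩ + ⟨lam, g x⟩`. -/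
def coupling (x : PrimalSpace n) (y : DualSpace p m) : ℝ :=
  P.f x + inner ℝ y.fst (Matrix.toEuclideanLin P.A x - P.b) + inner ℝ y.snd (P.g x)

/-- `∇ₓ Φ(x, y)`. -/
def gradX (x : PrimalSpace n) (y : DualSpace p m) : PrimalSpace n :=
  gradient (fun x' => P.coupling x' y) x

/-- `∇_y Φ(x, y)`. -/
def gradY (x : PrimalSpace n) (y : DualSpace p m) : DualSpace p m :=
  gradient (fun y' => P.coupling x y') y

/-- The dual domain `(ℝᵖ × K*) ∩ {y : ‖y‖ ≤ B}`, for `B ∈ [0, ∞]`. -/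
def dualDomain (B : ENNReal) : Set (DualSpace p m) := {y | y.snd ∈ P.dualCone ∧ ‖y‖ₑ ≤ B}

/-- The primal-dual domain `X × dualDomain B`. -/
def domain (B : ENNReal) : Set (PDSpace n p m) := {z | z.fst ∈ P.X ∧ z.snd ∈ P.dualDomain B}

open Classical in
/-- The extended-valued Lagrangian `ι_X(x) + Φ(x, y) - ι(y)`, where the last term is the
indicator function of `dualDomain B`. -/
def lagrangian (B : ENNReal) (x : PrimalSpace n) (y : DualSpace p m) : EReal :=
  (if x ∈ P.X then 0 else ⊤) + (P.coupling x y : EReal) -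
    (if y ∈ P.dualDomain B then 0 else ⊤)

/-- The saddle points of `min_x max_y lagrangian B x y`. -/
def saddleSet (B : ENNReal) : Set (PDSpace n p m) :=
  {z | z ∈ P.domain B ∧ ∀ (x : PrimalSpace n) (y : DualSpace p m),
    P.lagrangian B z.fst y ≤ P.lagrangian B z.fst z.snd ∧
    P.lagrangian B z.fst z.snd ≤ P.lagrangian B x z.snd}

/-- The dual function `y ↦ inf_x L(x, y)` of the conic program. -/
def dualFunction (y : DualSpace p m) : EReal := ⨅ x : PrimalSpace n, P.lagrangian ⊤ x y

/-- The set of dual optimal solutions of the conic program. -/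
def dualSolutions : Set (DualSpace p m) :=
  {y | y ∈ P.dualDomain ⊤ ∧ ∀ y', P.dualFunction y' ≤ P.dualFunction y}

end ConicProgram

/-- The convex subdifferential of an extended-valued function. -/
def subdiff {E : Type*} [NormedAddCommGroup E] [InnerProductSpace ℝ E] (h : E → EReal) (x : E) :
    Set E :=
  {u | ∀ x', h x + ((inner ℝ u (x' - x) : ℝ) : EReal) ≤ h x'}

namespace ConicProgram

variable {n p m : ℕ} (P : ConicProgram n p m)

/-- The KKT map `z ↦ ∂ₓ L(z) × ∂_y (-L)(z)`. -/
def kktMap (B : ENNReal) (z : PDSpace n p m) : Set (PDSpace n p m) :=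
  {w | w.fst ∈ subdiff (fun x => P.lagrangian B x z.snd) z.fst ∧
       w.snd ∈ subdiff (fun y => -P.lagrangian B z.fst y) z.snd}

/-- Local metric subregularity of the KKT map at every saddle point. -/
def MetricSubregularity (B : ENNReal) : Prop :=
  ∀ zs ∈ P.saddleSet B, ∃ ε > 0, ∃ ρ > 0, ∀ z ∈ P.domain B ∩ Metric.ball zs ε,
    Metric.infDist z (P.saddleSet B) ≤ ρ * Metric.infDist 0 (P.kktMap B z)

end ConicProgram

/-! ### Bregman distances and the smoothed duality gap -/

/-- The Bregman distance of `φ`. -/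
def bregman {E : Type*} [NormedAddCommGroup E] [InnerProductSpace ℝ E] [CompleteSpace E]
    (φ : E → ℝ) (u w : E) : ℝ :=
  φ u - φ w - inner ℝ (gradient φ w) (u - w)

/-- `φ` is a `1`-strongly convex distance generating function, differentiable on an open set
containing `S`, whose gradient is `L`-Lipschitz on `S`. -/
def IsDistanceGenerating {E : Type*} [NormedAddCommGroup E] [InnerProductSpace ℝ E]
    [CompleteSpace E] (φ : E → ℝ) (S : Set E) (L : ℝ) : Prop :=
  StrongConvexOn Set.univ 1 φ ∧ (∃ U : Set E, IsOpen U ∧ S ⊆ U ∧ DifferentiableOn ℝ φ U) ∧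
  ∀ u ∈ S, ∀ w ∈ S, ‖gradient φ u - gradient φ w‖ ≤ L * ‖u - w‖

/-- A pair of distance generating functions. -/
structure BregmanPair (n p m : ℕ) where
  phiP : PrimalSpace n → ℝ
  phiD : DualSpace p m → ℝ

/-- The self-centered smoothed duality gap
`G_ξ(z) = sup_{z'} {L(x, y') - L(x', y) - 2 ξ (D_p(x', x) + D_d(y', y))}`. -/
def smoothedGap {n p m : ℕ} (P : ConicProgram n p m) (φ : BregmanPair n p m) (B : ENNReal)
    (ξ : ℝ) (z : PDSpace n p m) : EReal :=
  ⨆ z' : PDSpace n p m, P.lagrangian B z.fst z'.snd - P.lagrangian B z'.fst z.snd -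
    ((2 * ξ * (bregman φ.phiP z'.fst z.fst + bregman φ.phiD z'.snd z.snd) : ℝ) : EReal)

/-! ### APDB and its adaptively restarted version -/

/-- Order of the updates: primal first (`xy`) or dual first (`yx`). -/
inductive UpdateOrder
  | xy
  | yx

/-- Algorithmic parameters: `cα`, `cβ`, `δ`, the backtracking factor `η`, the initial step size
`τbar`, the initial ratio `γ0`, and the monotonicity switch `cnm`. -/
structure StepParams where
  cα : ℝ
  cβ : ℝ
  δ : ℝ
  η : ℝ
  τbar : ℝ
  γ0 : ℝ
  cnm : ℝ

/-- The admissible parameters. -/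
def StepParams.Admissible (a : StepParams) : UpdateOrder → Prop
  | .xy => 0 < a.cα ∧ 0 < a.cβ ∧ 0 ≤ a.δ ∧ a.cα + a.cβ + a.δ < 1 ∧
      0 < a.η ∧ a.η < 1 ∧ 0 < a.τbar ∧ 0 < a.γ0 ∧ (a.cnm = 0 ∨ a.cnm = 1)
  | .yx => 0 < a.cα ∧ a.cα < 1 ∧ a.cβ = 0 ∧ 0 ≤ a.δ ∧ a.cα + a.δ ≤ 1 ∧
      0 < a.η ∧ a.η < 1 ∧ 0 < a.τbar ∧ 0 < a.γ0 ∧ (a.cnm = 0 ∨ a.cnm = 1)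

/-- A minimizer of `F` over `S`. -/
def argminOn {E : Type*} [Nonempty E] (S : Set E) (F : E → ℝ) : E :=
  Classical.epsilon fun u => u ∈ S ∧ IsMinOn F S u

/-- State at the beginning of inner iteration `k`: the iterates `k - 1` and `k`, the accepted
step sizes `τ_{k-1}`, `σ_{k-1}`, the first trial value `τtrial` of `τ_k`, and `γ_k`. -/
structure ApdbState (n p m : ℕ) where
  xPrev : PrimalSpace n
  x : PrimalSpace n
  yPrev : DualSpace p m
  y : DualSpace p m
  τPrev : ℝ
  σPrev : ℝ
  τtrial : ℝ
  γ : ℝ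

namespace Apdb

variable {n p m : ℕ} (P : ConicProgram n p m) (φ : BregmanPair n p m) (B : ENNReal)
  (a : StepParams)

/-- The initial state. -/
def init (z : PDSpace n p m) : ApdbState n p m where
  xPrev := z.fst
  x := z.fst
  yPrev := z.snd
  y := z.snd
  τPrev := a.τbar
  σPrev := a.γ0 * a.τbar
  τtrial := a.τbar
  γ := a.γ0

/-- The candidate point `(x^{k+1}, y^{k+1})` for the trial step size `τ_k = τ`. -/
def candidate (o : UpdateOrder) (s : ApdbState n p m) (τ : ℝ) : PrimalSpace n × DualSpace p m :=
  let σ := s.γ * τ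
  let θ := s.σPrev / σ
  match o with
  | .xy =>
    let d := (1 + θ) • P.gradX s.x s.y - θ • P.gradX s.xPrev s.yPrev
    let x' := argminOn P.X fun x => inner ℝ d x + 1 / τ * bregman φ.phiP x s.x
    let y' := argminOn (P.dualDomain B) fun y =>
      -inner ℝ (P.gradY x' s.y) y + 1 / σ * bregman φ.phiD y s.y
    (x', y')
  | .yx =>
    let d := (1 + θ) • P.gradY s.x s.y - θ • P.gradY s.xPrev s.yPrev
    let y' := argminOn (P.dualDomain B) fun y =>
      -inner ℝ d y + 1 / σ * bregman φ.phiD y s.y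
    let x' := argminOn P.X fun x => inner ℝ (P.gradX s.x y') x + 1 / τ * bregman φ.phiP x s.x
    (x', y')

/-- The test function `E_k(x, y)` for the trial step size `τ_k = τ`. The numbers `αk`, `βk` are
`α_k`, `β_k`, while `αn`, `βn` are `α_{k+1}`, `β_{k+1}`. -/
def testFunction (o : UpdateOrder) (s : ApdbState n p m) (τ : ℝ) (x : PrimalSpace n)
    (y : DualSpace p m) : ℝ :=
  let σ := s.γ * τ
  let θ := s.σPrev / σ
  match o with
  | .xy =>
    let αk := a.cα / s.τPrev
    let βk := a.γ0 * (a.cβ / s.σPrev)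
    let αn := a.cα / τ
    let βn := a.γ0 * (a.cβ / σ)
    1 / (2 * αn) * ‖P.gradX x y - P.gradX x s.y‖ ^ 2 - 1 / σ * bregman φ.phiD y s.y
      + 1 / (2 * βn) * ‖P.gradX x s.y - P.gradX s.x s.y‖ ^ 2
      - (1 / τ - θ * (αk + βk)) * bregman φ.phiP x s.x
  | .yx =>
    let αk := a.cα / s.σPrev
    let αn := a.cα / σ
    P.coupling x y - P.coupling s.x y - inner ℝ (P.gradX s.x y) (x - s.x)
      - 1 / τ * bregman φ.phiP x s.x
      + 1 / (2 * αn) * ‖P.gradY x y - P.gradY s.x y‖ ^ 2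
      - (1 / σ - θ * αk) * bregman φ.phiD y s.y

/-- The trial step size `τ` passes the backtracking test. -/
def Accepts (o : UpdateOrder) (s : ApdbState n p m) (τ : ℝ) : Prop :=
  let c := candidate P φ B o s τ
  testFunction P φ a o s τ c.1 c.2 ≤
    -(a.δ / τ) * bregman φ.phiP c.1 s.x - a.δ / (s.γ * τ) * bregman φ.phiD c.2 s.y

/-- The accepted step size: the first of `τtrial, η τtrial, η² τtrial, …` to pass the test. -/
def acceptedStep (o : UpdateOrder) (s : ApdbState n p m) : ℝ :=
  a.η ^ sInf {j : ℕ | Accepts P φ B a o s (a.η ^ j * s.τtrial)} * s.τtrial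

/-- One inner iteration. -/
def step (o : UpdateOrder) (s : ApdbState n p m) : ApdbState n p m :=
  let τ := acceptedStep P φ B a o s
  let c := candidate P φ B o s τ
  let γ' := s.γ * (1 + P.mu * τ)
  { xPrev := s.x
    x := c.1
    yPrev := s.y
    y := c.2
    τPrev := τ
    σPrev := s.γ * τ
    τtrial := τ * Real.sqrt (s.γ / γ' * (1 + a.cnm * (τ / s.τPrev)))
    γ := γ' }

/-- The state after `k` inner iterations from `z`. -/
def state (o : UpdateOrder) (z : PDSpace n p m) (k : ℕ) : ApdbState n p m :=
  (step P φ B a o)^[k] (init a z)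

/-- `σ_k`, the dual step size accepted in iteration `k`. -/
def sigma (o : UpdateOrder) (z : PDSpace n p m) (k : ℕ) : ℝ :=
  (state P φ B a o z (k + 1)).σPrev

/-- The weight `t_k = σ_k / σ_0`. -/
def weight (o : UpdateOrder) (z : PDSpace n p m) (k : ℕ) : ℝ :=
  sigma P φ B a o z k / sigma P φ B a o z 0

/-- The output of `K` iterations of APDB from `z`: the weighted average
`(∑_{k<K} t_k)⁻¹ ∑_{k<K} t_k z^{k+1}`. -/
def average (o : UpdateOrder) (z : PDSpace n p m) (K : ℕ) : PDSpace n p m :=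
  (∑ k ∈ Finset.range K, weight P φ B a o z k)⁻¹ •
    ∑ k ∈ Finset.range K, weight P φ B a o z k •
      mkPD (state P φ B a o z (k + 1)).x (state P φ B a o z (k + 1)).y

/-- The adaptive restart test after `K` inner iterations from the restart point `z`. -/
def RestartTest (ξ q : ℝ) (o : UpdateOrder) (z : PDSpace n p m) (K : ℕ) : Prop :=
  smoothedGap P φ B ξ (average P φ B a o z K) ≤ (q : EReal) * smoothedGap P φ B ξ z

/-- The length of an inner loop: the first `K ≥ 1` for which the restart test holds. -/
def innerLength (ξ q : ℝ) (o : UpdateOrder) (z : PDSpace n p m) : ℕ :=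
  sInf {K : ℕ | 1 ≤ K ∧ RestartTest P φ B a ξ q o z K}

/-- The restart points `z^{t,0}` of the adaptively restarted method started at `z`. -/
def restartPoint (ξ q : ℝ) (o : UpdateOrder) (z : PDSpace n p m) : ℕ → PDSpace n p m
  | 0 => z
  | t + 1 =>
    average P φ B a o (restartPoint ξ q o z t) (innerLength P φ B a ξ q o (restartPoint ξ q o z t))

end Apdb

/-! ### Explicit constants -/

/-- `Ψ₁`, for the `xy` order. -/
def psiXY (a : StepParams) (Lxx Lxy : ℝ) : ℝ :=
  min (Real.sqrt (a.cα * (1 - a.δ)) / (Lxy * Real.sqrt a.γ0))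
    (Real.sqrt (a.cβ * (1 - (a.cα + a.cβ + a.δ))) / Lxx)

/-- `Ψ₂`, for the `yx` order. -/
def psiYX (a : StepParams) (Lxx Lyx : ℝ) : ℝ :=
  a.cα / (2 * a.γ0) * (Lxx / Lyx ^ 2) *
    (-1 + Real.sqrt (1 + 4 * (1 - a.δ) * a.γ0 / a.cα * (Lyx ^ 2 / Lxx ^ 2)))

/-- The lower bound on the step sizes; it is `η Ψ` unless already the initial trial step size
`τbar` is smaller. -/
def tauHat (a : StepParams) (Ψ : ℝ) : ℝ := min a.τbar (a.η * Ψ)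

/-- `c₁ = (Lφ / 2) (τbar / τHat) / min {τ₀, σ₀}` with `τ₀ = τbar`, `σ₀ = γ0 τbar`. -/
def constOne (a : StepParams) (Lφ Ψ : ℝ) : ℝ :=
  Lφ / 2 * (a.τbar / tauHat a Ψ) * (1 / min a.τbar (a.γ0 * a.τbar))

/-- The constant `c₂` (`xy` order), respectively its analogue for the `yx` order. -/
def constTwo (a : StepParams) (Lφ : ℝ) : UpdateOrder → ℝ
  | .xy => Real.sqrt (Lφ * max a.γ0 1 / min (a.γ0 * (1 - (a.cα + a.cβ))) 1)
  | .yx => Real.sqrt (Lφ * max a.γ0 1 / min a.γ0 (1 - a.cα))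

/-- `⌈max {4 c₁ (1 + c₂²) ρ / q, 2 c₁ / ξ}⌉`. -/
def innerBound (c₁ c₂ ρ q ξ : ℝ) : ℕ := ⌈max (4 * c₁ * (1 + c₂ ^ 2) * ρ / q) (2 * c₁ / ξ)⌉₊

end

/-! The proof compares the smoothed gap G with the squared distance to the saddle set in both
directions. Metric subregularity gives quadratic growth, dist² ≤ ρ G (`exists_quadratic_growth`). An
ergodic estimate bounds G at the average of K inner iterates by D_K dist²(z), where z is the restart
point and D_K → 0 uniformly in z. Hence G(average) ≤ D_K ρ G(z), and the restart test holds once D_K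
ρ ≤ q. Gaps then decay geometrically, so do the distances, and since consecutive restart points
differ by a multiple of the distance, the points converge (`restart_converges`).

Quadratic growth. Maximizing the gap expression at z decouples into one proximal problem in x and
one in y. The maximizer w has gap term at least ξ‖w - z‖², and its optimality conditions exhibit an
element of the KKT map at w of norm O(‖w - z‖) (`exists_prox_point`). Near a saddle point,
subregularity at w bounds dist(z) by O(‖w - z‖); elsewhere the gap is positive. Compactness glues
the local constants, and no parameter of the algorithm enters.

Ergodic estimate. The backtracking test is the inequality that makes a Lyapunov function, built from
Bregman distances to a comparison point w and extrapolation terms, pay for σ_k times the Lagrangian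
gap at w (`step_xy_le`, `step_yx_le`). Summation and Jensen give S_K · gap ≤ O(‖w - z‖²) with S_K =
∑ σ_k. At a saddle point the gaps are nonnegative, so the average stays within a constant multiple
of the initial distance. The dependence on w is absorbed by the proximal penalty in G once S_K is
large (`gapTerm_le_of_sum_gap_le`). Sufficiently small steps are accepted, so γ_k τ_k² is bounded
below; S_K therefore grows linearly, and quadratically if μ > 0. In the primal-first order the dual
domain is unbounded, and the energy bound itself keeps the dual iterates in a ball on which the
Lipschitz constants hold (`energy_xy_le_and_acceptsBelow`).

Dual-first order with μ > 0. The primal gradient is taken at the old point, so strong convexity acts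
on the old distance and γ_{k+1} may be too large for telescoping, by a loss factor e_k ≥ 1. The
product U_K of these factors is O(√S_K), and it is bounded if `cnm = 0`. The loss also leaves an
error μ S_K ‖x - x⋆‖², of the same order as S_K. Testing with a point at fraction s of the way from
x⋆ to x makes this error quadratic in s, while convexity costs only a factor s
(`gapTerm_average_le_of_mu_pos`). -/

section ConvexAnalysis

/-! ### Convex analysis: first-order conditions, Bregman distances, proximal steps -/

variable {E : Type*} [NormedAddCommGroup E] [InnerProductSpace ℝ E] [CompleteSpace E]

theorem HasGradientAt.hasDerivAt_line {f : E → ℝ} {g w v : E} {t : ℝ}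
    (h : HasGradientAt f g (w + t • v)) :
    HasDerivAt (fun r : ℝ => f (w + r • v)) (inner ℝ g v) t := by
  have h1 : HasDerivAt (fun r : ℝ => w + r • v) v t := by
    simpa using ((hasDerivAt_id t).smul_const v).const_add w
  exact h.hasFDerivAt.comp_hasDerivAt t h1

theorem HasGradientAt.tendsto_slope {f : E → ℝ} {g w v : E} (h : HasGradientAt f g w) :
    Filter.Tendsto (fun t : ℝ => t⁻¹ * (f (w + t • v) - f w)) (nhdsWithin 0 (Set.Ioi 0))
      (nhds (inner ℝ g v)) := by
  have h0 : HasGradientAt f g (w + (0 : ℝ) • v) := by simpa using h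
  have h1 := h0.hasDerivAt_line.tendsto_slope_zero_right
  simpa using h1

/-- Divide the strong convexity inequality on the segment by t and let t decrease to 0. The gradient
is needed only at w. -/
theorem StrongConvexOn.add_inner_le {S : Set E} {μ : ℝ} {f : E → ℝ} (hf : StrongConvexOn S μ f)
    {w u g : E} (hw : w ∈ S) (hu : u ∈ S) (hg : HasGradientAt f g w) :
    f w + inner ℝ g (u - w) + μ / 2 * ‖u - w‖ ^ 2 ≤ f u := by
  have h1 := hg.tendsto_slope (v := u - w)
  have h2 : Filter.Tendsto (fun t : ℝ => f u - f w - (1 - t) * (μ / 2 * ‖u - w‖ ^ 2))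
      (nhdsWithin 0 (Set.Ioi 0)) (nhds (f u - f w - (1 - 0) * (μ / 2 * ‖u - w‖ ^ 2))) := by
    apply Filter.Tendsto.mono_left _ nhdsWithin_le_nhds
    exact Continuous.tendsto (by fun_prop) 0
  have h3 := le_of_tendsto_of_tendsto h1 h2 (by
    filter_upwards [Ioo_mem_nhdsGT (show (0 : ℝ) < 1 by norm_num)] with t ht
    have h := (hf.2 hw hu : ∀ ⦃a b : ℝ⦄, _) (by linarith [ht.2] : (0 : ℝ) ≤ 1 - t) ht.1.le
      (by ring)
    have e : (1 - t) • w + t • u = w + t • (u - w) := by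
      rw [smul_sub, sub_smul, one_smul]; abel
    rw [e, norm_sub_rev w u] at h
    simp only [smul_eq_mul] at h
    rw [inv_mul_le_iff₀ ht.1]
    linarith)
  linarith

theorem inner_nonneg_of_isMinOn {S : Set E} (hS : Convex ℝ S) {F : E → ℝ} {v g u : E}
    (hv : v ∈ S) (hmin : IsMinOn F S v) (hg : HasGradientAt F g v) (hu : u ∈ S) :
    0 ≤ inner ℝ g (u - v) := by
  refine ge_of_tendsto (hg.tendsto_slope (v := u - v)) ?_
  filter_upwards [Ioo_mem_nhdsGT (show (0 : ℝ) < 1 by norm_num)] with t ht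
  have hm : v + t • (u - v) ∈ S := by
    have := hS hv hu (a := 1 - t) (b := t) (by linarith [ht.2]) ht.1.le (by ring)
    have e : (1 - t) • v + t • u = v + t • (u - v) := by
      rw [smul_sub, sub_smul, one_smul]; abel
    rwa [e] at this
  have := isMinOn_iff.1 hmin _ hm
  exact mul_nonneg (inv_nonneg.2 ht.1.le) (by linarith)

/-- Along the segment from w to u, the difference of the two sides has nonpositive derivative.
Lipschitz continuity is needed only relative to the base point w. -/
theorem sub_sub_inner_le_of_lipschitz_gradient {S : Set E} (hS : Convex ℝ S) {f : E → ℝ} {g : E → E} {L : ℝ}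
    (hg : ∀ x ∈ S, HasGradientAt f (g x) x) {w u : E} (hw : w ∈ S) (hu : u ∈ S)
    (hL : ∀ x ∈ S, ‖g x - g w‖ ≤ L * ‖x - w‖) :
    f u - f w - inner ℝ (g w) (u - w) ≤ L / 2 * ‖u - w‖ ^ 2 := by
  have hm : ∀ t ∈ Set.Icc (0 : ℝ) 1, w + t • (u - w) ∈ S := fun t ht => by
    have := hS hw hu (a := 1 - t) (b := t) (by linarith [ht.2]) ht.1 (by ring)
    have e : (1 - t) • w + t • u = w + t • (u - w) := by
      rw [smul_sub, sub_smul, one_smul]; abel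
    rwa [e] at this
  set h : ℝ → ℝ := fun t => f (w + t • (u - w)) - t * inner ℝ (g w) (u - w)
    - L / 2 * ‖u - w‖ ^ 2 * t ^ 2 with hh
  have hd : ∀ t ∈ Set.Icc (0 : ℝ) 1, HasDerivAt h (inner ℝ (g (w + t • (u - w))) (u - w)
      - 1 * inner ℝ (g w) (u - w) - L / 2 * ‖u - w‖ ^ 2 * (2 * t)) t := fun t ht => by
    have h1 := (hg _ (hm t ht)).hasDerivAt_line
    have h2 := (hasDerivAt_id t).mul_const (inner ℝ (g w) (u - w))
    have h3 : HasDerivAt (fun r : ℝ => L / 2 * ‖u - w‖ ^ 2 * r ^ 2)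
        (L / 2 * ‖u - w‖ ^ 2 * (2 * t)) t := by
      have := (hasDerivAt_pow 2 t).const_mul (L / 2 * ‖u - w‖ ^ 2)
      simpa using this
    exact (h1.sub h2).sub h3
  have hanti : AntitoneOn h (Set.Icc 0 1) := by
    apply antitoneOn_of_deriv_nonpos (convex_Icc 0 1)
    · exact fun t ht => (hd t ht).continuousAt.continuousWithinAt
    · exact fun t ht => (hd t (interior_subset ht)).differentiableAt.differentiableWithinAt
    · intro t ht
      have ht' := interior_subset ht
      rw [(hd t ht').deriv]
      have h1 : inner ℝ (g (w + t • (u - w))) (u - w) - inner ℝ (g w) (u - w)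
          ≤ L * t * ‖u - w‖ ^ 2 := by
        rw [← inner_sub_left]
        refine (real_inner_le_norm _ _).trans ?_
        have := hL _ (hm t ht')
        rw [add_sub_cancel_left, norm_smul, Real.norm_of_nonneg ht'.1] at this
        nlinarith [norm_nonneg (u - w)]
      linarith
  have := hanti (Set.left_mem_Icc.2 zero_le_one) (Set.right_mem_Icc.2 zero_le_one) zero_le_one
  simp only [hh, zero_smul, one_smul, add_zero, add_sub_cancel] at this
  linarith

theorem bregman_self (φ : E → ℝ) (u : E) : bregman φ u u = 0 := by simp [bregman]

theorem bregman_three_point (φ : E → ℝ) (u v w : E) :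
    bregman φ u w - bregman φ u v - bregman φ v w
      = inner ℝ (gradient φ v - gradient φ w) (u - v) := by
  have : u - w = (u - v) + (v - w) := by abel
  simp only [bregman, this, inner_add_right, inner_sub_left]
  ring

theorem gradient_half_norm_sq (w : E) : gradient (fun x : E => (1 / 2 : ℝ) * ‖x‖ ^ 2) w = w := by
  apply HasGradientAt.gradient
  rw [hasGradientAt_iff_hasFDerivAt]
  have h := (hasStrictFDerivAt_norm_sq (F := E) w).hasFDerivAt.const_mul (1 / 2 : ℝ)
  refine h.congr_fderiv ?_
  ext v
  simp

theorem bregman_half_norm_sq (u w : E) :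
    bregman (fun x : E => (1 / 2 : ℝ) * ‖x‖ ^ 2) u w = 1 / 2 * ‖u - w‖ ^ 2 := by
  simp only [bregman, gradient_half_norm_sq, @norm_sub_sq_real, inner_sub_right,
    real_inner_self_eq_norm_sq, real_inner_comm w u]
  ring

namespace IsDistanceGenerating

variable {φ : E → ℝ} {S : Set E} {L : ℝ} (h : IsDistanceGenerating φ S L)
include h

theorem mono {T : Set E} (hT : T ⊆ S) : IsDistanceGenerating φ T L := by
  obtain ⟨U, hU, hSU, hd⟩ := h.2.1
  exact ⟨h.1, ⟨U, hU, hT.trans hSU, hd⟩, fun u hu w hw => h.2.2 u (hT hu) w (hT hw)⟩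

theorem hasGradientAt {w : E} (hw : w ∈ S) : HasGradientAt φ (gradient φ w) w := by
  obtain ⟨U, hU, hSU, hd⟩ := h.2.1
  exact ((hd w (hSU hw)).differentiableAt (hU.mem_nhds (hSU hw))).hasGradientAt

theorem continuousOn : ContinuousOn φ S :=
  fun _ hw => (h.hasGradientAt hw).differentiableAt.continuousAt.continuousWithinAt

theorem continuousOn_gradient : ContinuousOn (gradient φ) S := by
  have : LipschitzOnWith (Real.toNNReal (max L 0)) (gradient φ) S := by
    apply LipschitzOnWith.of_dist_le_mul
    intro u hu w hw
    rw [dist_eq_norm, dist_eq_norm, Real.coe_toNNReal _ (le_max_right _ _)]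
    exact (h.2.2 u hu w hw).trans (mul_le_mul_of_nonneg_right (le_max_left _ _) (norm_nonneg _))
  exact this.continuousOn

theorem half_norm_sq_le_bregman (u : E) {w : E} (hw : w ∈ S) :
    1 / 2 * ‖u - w‖ ^ 2 ≤ bregman φ u w := by
  have := h.1.add_inner_le (Set.mem_univ w) (Set.mem_univ u) (h.hasGradientAt hw)
  unfold bregman
  linarith

theorem bregman_nonneg (u : E) {w : E} (hw : w ∈ S) : 0 ≤ bregman φ u w :=
  le_trans (by positivity) (h.half_norm_sq_le_bregman u hw)

theorem bregman_le (hS : Convex ℝ S) {u w : E} (hu : u ∈ S) (hw : w ∈ S) :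
    bregman φ u w ≤ L / 2 * ‖u - w‖ ^ 2 :=
  sub_sub_inner_le_of_lipschitz_gradient hS (fun _ hx => h.hasGradientAt hx) hw hu
    (fun x hx => h.2.2 x hx w hw)

theorem hasGradientAt_bregman {v : E} (hv : v ∈ S) (w : E) :
    HasGradientAt (fun u => bregman φ u w) (gradient φ v - gradient φ w) v := by
  rw [hasGradientAt_iff_hasFDerivAt]
  have h1 := (h.hasGradientAt hv).hasFDerivAt
  have h2 : HasFDerivAt (fun u : E => inner ℝ (gradient φ w) (u - w))
      (InnerProductSpace.toDual ℝ E (gradient φ w)) v := by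
    simp only [inner_sub_right]
    exact (InnerProductSpace.toDual ℝ E (gradient φ w)).hasFDerivAt.sub_const _
  have h3 := (h1.sub_const (φ w)).sub h2
  rw [map_sub]
  exact h3

theorem continuousOn_bregman_right (u : E) : ContinuousOn (fun w => bregman φ u w) S := by
  unfold bregman
  exact (continuousOn_const.sub h.continuousOn).sub
    (h.continuousOn_gradient.inner (by fun_prop))

theorem hasGradientAt_prox {v : E} (hv : v ∈ S) (d w : E) (c : ℝ) :
    HasGradientAt (fun u => inner ℝ d u + c * bregman φ u w)
      (d + c • (gradient φ v - gradient φ w)) v := by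
  rw [hasGradientAt_iff_hasFDerivAt]
  have h1 := (h.hasGradientAt_bregman hv w).hasFDerivAt.const_mul c
  have h2 := (InnerProductSpace.toDual ℝ E d).hasFDerivAt (x := v)
  have h3 := h2.add h1
  rw [map_add, map_smul]
  exact h3

/-- First-order optimality at v combined with the three-point identity. Together with membership in
S, this is all that the analysis uses about an update of the algorithm. -/
theorem inner_le_of_isMinOn_prox (hS : Convex ℝ S) {d v w u : E} {c : ℝ} (hv : v ∈ S)
    (hmin : IsMinOn (fun u => inner ℝ d u + c * bregman φ u w) S v) (hu : u ∈ S) :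
    inner ℝ d (v - u) ≤ c * (bregman φ u w - bregman φ u v - bregman φ v w) := by
  have h1 := inner_nonneg_of_isMinOn hS hv hmin (h.hasGradientAt_prox hv d w c) hu
  rw [bregman_three_point]
  have h2 : inner ℝ d (v - u) = - inner ℝ d (u - v) := by rw [← inner_neg_right, neg_sub]
  rw [inner_add_left, real_inner_smul_left] at h1
  linarith

theorem exists_isMinOn_prox [ProperSpace E] (hS : IsClosed S) (d : E) {w : E} (hw : w ∈ S) {c : ℝ}
    (hc : 0 < c) :
    ∃ v, v ∈ S ∧ IsMinOn (fun u => inner ℝ d u + c * bregman φ u w) S v := by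
  have hcont : ContinuousOn (fun u => inner ℝ d u + c * bregman φ u w) S :=
    fun v hv => (h.hasGradientAt_prox hv d w c).differentiableAt.continuousAt.continuousWithinAt
  have key : ∀ᶠ u in Filter.cocompact E ⊓ Filter.principal S,
      inner ℝ d w + c * bregman φ w w ≤ inner ℝ d u + c * bregman φ u w := by
    -- Beyond distance 2‖d‖/c from w, the quadratic growth c/2 ‖u - w‖² of the Bregman term
    -- outweighs the linear term.
    have h1 : ∀ᶠ u in Filter.cocompact E, 2 * ‖d‖ / c ≤ dist u w :=
      (tendsto_dist_right_cocompact_atTop w).eventually_ge_atTop _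
    refine Filter.Eventually.filter_mono inf_le_left (h1.mono fun u hu => ?_)
    rw [dist_eq_norm, div_le_iff₀ hc] at hu
    have h2 := h.half_norm_sq_le_bregman u hw
    have h3 : inner ℝ d w - inner ℝ d u ≤ ‖d‖ * ‖u - w‖ := by
      rw [← inner_sub_right, norm_sub_rev]
      exact real_inner_le_norm _ _
    rw [bregman_self]
    nlinarith [norm_nonneg (u - w), mul_le_mul_of_nonneg_left h2 hc.le,
      mul_le_mul_of_nonneg_right hu (norm_nonneg (u - w))]
  obtain ⟨v, hv, hmin⟩ := hcont.exists_isMinOn' hS hw key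
  exact ⟨v, hv, hmin⟩

theorem argminOn_prox [ProperSpace E] (hS : IsClosed S) (d : E) {w : E} (hw : w ∈ S) {c : ℝ}
    (hc : 0 < c) :
    argminOn S (fun u => inner ℝ d u + c * bregman φ u w) ∈ S ∧
      IsMinOn (fun u => inner ℝ d u + c * bregman φ u w) S
        (argminOn S (fun u => inner ℝ d u + c * bregman φ u w)) :=
  Classical.epsilon_spec (p := fun v => v ∈ S ∧
    IsMinOn (fun u => inner ℝ d u + c * bregman φ u w) S v) (h.exists_isMinOn_prox hS d hw hc)

theorem inner_argminOn_prox_le [ProperSpace E] (hS : IsClosed S) (hS' : Convex ℝ S) (d : E) {w u : E}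
    (hw : w ∈ S) (hu : u ∈ S) {c : ℝ} (hc : 0 < c) {v : E}
    (hv : v = argminOn S (fun u => inner ℝ d u + c * bregman φ u w)) :
    inner ℝ d (v - u) ≤ c * (bregman φ u w - bregman φ u v - bregman φ v w) := by
  subst hv
  exact h.inner_le_of_isMinOn_prox hS' (h.argminOn_prox hS d hw hc).1
    (h.argminOn_prox hS d hw hc).2 hu

end IsDistanceGenerating

end ConvexAnalysis

theorem norm_le_of_forall_inner_le {E : Type*} [NormedAddCommGroup E] [InnerProductSpace ℝ E]
    {v : E} {C : ℝ} (hC : 0 ≤ C) (h : ∀ w, inner ℝ v w ≤ C * ‖w‖) : ‖v‖ ≤ C := by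
  have h1 := h v
  rw [real_inner_self_eq_norm_sq] at h1
  by_contra hlt
  push Not at hlt
  nlinarith [norm_nonneg v]

theorem sq_norm_sub_le_two_mul {E : Type*} [SeminormedAddCommGroup E] (u v w : E) :
    ‖u - w‖ ^ 2 ≤ 2 * ‖u - v‖ ^ 2 + 2 * ‖v - w‖ ^ 2 := by
  have h := norm_add_le (u - v) (v - w)
  rw [sub_add_sub_cancel] at h
  nlinarith [sq_nonneg (‖u - v‖ - ‖v - w‖), norm_nonneg (u - w)]

namespace ConicProgram

variable {n p m : ℕ} {P : ConicProgram n p m}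

/-! ### The domains -/

section Domains

variable (P)

theorem isClosed_dualCone : IsClosed P.dualCone := by
  have : P.dualCone = ⋂ w ∈ P.K, {l | 0 ≤ inner ℝ l w} := by
    ext l; simp [dualCone]
  rw [this]
  exact isClosed_biInter fun w _ => isClosed_le continuous_const (by fun_prop)

theorem convex_dualCone : Convex ℝ P.dualCone := by
  intro l hl l' hl' a c ha hc _ w hw
  rw [inner_add_left, real_inner_smul_left, real_inner_smul_left]
  exact add_nonneg (mul_nonneg ha (hl w hw)) (mul_nonneg hc (hl' w hw))

theorem isClosed_dualDomain (B : ENNReal) : IsClosed (P.dualDomain B) :=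
  (P.isClosed_dualCone.preimage (by fun_prop : Continuous fun y : DualSpace p m => y.snd)).inter
    (isClosed_le continuous_enorm continuous_const)

theorem convex_dualDomain (B : ENNReal) : Convex ℝ (P.dualDomain B) := by
  intro y hy y' hy' a c ha hc hac
  refine ⟨P.convex_dualCone hy.1 hy'.1 ha hc hac, ?_⟩
  rcases eq_or_ne B ⊤ with rfl | hB
  · exact le_top
  · have key : ∀ u : DualSpace p m, ‖u‖ₑ ≤ B ↔ u ∈ Metric.closedBall 0 B.toReal := fun u => by
      rw [mem_closedBall_zero_iff, ← ofReal_norm, ENNReal.ofReal_le_iff_le_toReal hB]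
    rw [key]
    exact convex_closedBall 0 B.toReal ((key y).1 hy.2) ((key y').1 hy'.2) ha hc hac

theorem dualDomain_subset_top (B : ENNReal) : P.dualDomain B ⊆ P.dualDomain ⊤ :=
  fun _ hy => ⟨hy.1, le_top⟩

theorem mem_dualDomain_ofReal {R : ℝ} (hR : 0 ≤ R) {y : DualSpace p m} :
    y ∈ P.dualDomain (ENNReal.ofReal R) ↔ y ∈ P.dualDomain ⊤ ∧ ‖y‖ ≤ R := by
  simp only [dualDomain, Set.mem_ofPred_eq, le_top, and_true]
  rw [← ofReal_norm, ENNReal.ofReal_le_ofReal_iff hR]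

theorem smul_mem_dualDomain_top {y : DualSpace p m} (hy : y ∈ P.dualDomain ⊤) {c : ℝ}
    (hc : 0 ≤ c) : c • y ∈ P.dualDomain ⊤ :=
  ⟨fun w hw => by
    change 0 ≤ inner ℝ (c • y.snd) w
    rw [real_inner_smul_left]; exact mul_nonneg hc (hy.1 w hw), le_top⟩

end Domains

theorem convex_domain (hX : Convex ℝ P.X) (B : ENNReal) : Convex ℝ (P.domain B) :=
  fun _ hz _ hz' _ _ ha hc hac =>
    ⟨hX hz.1 hz'.1 ha hc hac, P.convex_dualDomain B hz.2 hz'.2 ha hc hac⟩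

theorem isClosed_domain (hX : IsClosed P.X) (B : ENNReal) : IsClosed (P.domain B) :=
  (hX.preimage (by fun_prop : Continuous fun z : PDSpace n p m => z.fst)).inter
    ((P.isClosed_dualDomain B).preimage (by fun_prop : Continuous fun z : PDSpace n p m => z.snd))

theorem norm_sq_sub (z w : PDSpace n p m) :
    ‖z - w‖ ^ 2 = ‖z.fst - w.fst‖ ^ 2 + ‖z.snd - w.snd‖ ^ 2 :=
  WithLp.prod_norm_sq_eq_of_L2 (z - w)

/-! ### The coupling function -/

/-- The constraint map `x ↦ (A x - b, g x)`. -/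
noncomputable def constr (P : ConicProgram n p m) (x : PrimalSpace n) : DualSpace p m :=
  WithLp.toLp 2 (Matrix.toEuclideanLin P.A x - P.b, P.g x)

theorem coupling_eq (x : PrimalSpace n) (y : DualSpace p m) :
    P.coupling x y = P.f x + inner ℝ (P.constr x) y := by
  rw [coupling, constr, WithLp.prod_inner_apply, add_assoc, real_inner_comm _ y.fst,
    real_inner_comm _ y.snd]
  rfl

theorem gradY_eq (x : PrimalSpace n) (y : DualSpace p m) : P.gradY x y = P.constr x := by
  apply HasGradientAt.gradient
  rw [hasGradientAt_iff_hasFDerivAt]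
  simp only [coupling_eq]
  exact (InnerProductSpace.toDual ℝ _ (P.constr x)).hasFDerivAt.const_add _

theorem coupling_sub_coupling (x : PrimalSpace n) (y y' : DualSpace p m) :
    P.coupling x y' - P.coupling x y = inner ℝ (P.constr x) (y' - y) := by
  rw [coupling_eq, coupling_eq, inner_sub_right]; ring

/-! ### Derivatives, convexity and Lipschitz constants of the coupling function -/

section Smooth

variable (hm : P.SmoothnessAssumption)
include hm

theorem hasFDerivAt_f {x : PrimalSpace n} (hx : x ∈ P.X) : HasFDerivAt P.f (fderiv ℝ P.f x) x := by
  obtain ⟨U, hU, hXU, hf, -⟩ := hm.2.2.2.1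
  exact ((hf.differentiableOn one_ne_zero x (hXU hx)).differentiableAt
    (hU.mem_nhds (hXU hx))).hasFDerivAt

theorem hasFDerivAt_g {x : PrimalSpace n} (hx : x ∈ P.X) : HasFDerivAt P.g (fderiv ℝ P.g x) x := by
  obtain ⟨U, hU, hXU, -, hg⟩ := hm.2.2.2.1
  exact ((hg.differentiableOn one_ne_zero x (hXU hx)).differentiableAt
    (hU.mem_nhds (hXU hx))).hasFDerivAt

theorem hasFDerivAt_coupling {x : PrimalSpace n} (hx : x ∈ P.X) (y : DualSpace p m) :
    HasFDerivAt (fun x' => P.coupling x' y)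
      (fderiv ℝ P.f x + (innerSL ℝ y.fst).comp (Matrix.toEuclideanLin P.A).toContinuousLinearMap
        + (innerSL ℝ y.snd).comp (fderiv ℝ P.g x)) x := by
  have h2 : HasFDerivAt (fun x' => Matrix.toEuclideanLin P.A x' - P.b)
      (Matrix.toEuclideanLin P.A).toContinuousLinearMap x :=
    (Matrix.toEuclideanLin P.A).toContinuousLinearMap.hasFDerivAt.sub_const _
  exact ((hasFDerivAt_f hm hx).add ((innerSL ℝ y.fst).hasFDerivAt.comp x h2)).add
    ((innerSL ℝ y.snd).hasFDerivAt.comp x (hasFDerivAt_g hm hx))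

theorem hasGradientAt_coupling {x : PrimalSpace n} (hx : x ∈ P.X) (y : DualSpace p m) :
    HasGradientAt (fun x' => P.coupling x' y) (P.gradX x y) x :=
  (hasFDerivAt_coupling hm hx y).differentiableAt.hasGradientAt

theorem inner_gradX {x : PrimalSpace n} (hx : x ∈ P.X) (y : DualSpace p m) (w : PrimalSpace n) :
    inner ℝ (P.gradX x y) w = fderiv ℝ P.f x w + inner ℝ y.fst (Matrix.toEuclideanLin P.A w)
      + inner ℝ y.snd (fderiv ℝ P.g x w) := by
  have h := (hasGradientAt_coupling hm hx y).hasFDerivAt.unique (hasFDerivAt_coupling hm hx y)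
  have := congrArg (fun T : PrimalSpace n →L[ℝ] ℝ => T w) h
  simpa using this

theorem continuousOn_f : ContinuousOn P.f P.X :=
  fun _ hx => (hasFDerivAt_f hm hx).continuousAt.continuousWithinAt

theorem continuousOn_constr : ContinuousOn P.constr P.X := by
  have hg : ContinuousOn P.g P.X :=
    fun _ hx => (hasFDerivAt_g hm hx).continuousAt.continuousWithinAt
  have hA : Continuous fun x => Matrix.toEuclideanLin P.A x :=
    (Matrix.toEuclideanLin P.A).continuous_of_finiteDimensional
  unfold constr
  exact (WithLp.prod_continuous_toLp 2 _ _).comp_continuousOn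
    ((hA.continuousOn.sub continuousOn_const).prodMk hg)

theorem continuousOn_coupling_fst (B : ENNReal) (y : DualSpace p m) :
    ContinuousOn (fun z : PDSpace n p m => P.coupling z.fst y) (P.domain B) := by
  simp only [coupling_eq]
  have hfst : ContinuousOn (fun z : PDSpace n p m => z.fst) (P.domain B) := by fun_prop
  exact ((continuousOn_f hm).comp hfst fun z hz => hz.1).add
    (((continuousOn_constr hm).comp hfst fun z hz => hz.1).inner continuousOn_const)

omit hm in
theorem continuous_coupling_right (x : PrimalSpace n) : Continuous (P.coupling x) := by
  have : P.coupling x = fun y => P.f x + inner ℝ (P.constr x) y := funext fun y => coupling_eq x y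
  rw [this]
  fun_prop

/-- Pairing with an element of the dual cone turns `K`-convexity of `g` into scalar convexity; the
affine constraint contributes nothing, and the modulus comes from `f`. -/
theorem strongConvexOn_coupling (hX : Convex ℝ P.X) {y : DualSpace p m}
    (hy : y ∈ P.dualDomain ⊤) : StrongConvexOn P.X P.mu (fun x => P.coupling x y) := by
  refine ⟨hX, fun x hx x' hx' a c ha hc hac => ?_⟩
  have h1 : P.f (a • x + c • x') ≤ a • P.f x + c • P.f x' - a * c * (P.mu / 2 * ‖x - x'‖ ^ 2) :=
    hm.2.1.2 hx hx' ha hc hac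
  have h2 := hy.1 _ (hm.2.2.1 x hx x' hx' a c ha hc hac)
  rw [inner_sub_right, inner_add_right, real_inner_smul_right, real_inner_smul_right] at h2
  simp only [coupling, inner_sub_right, map_add, map_smul, inner_add_right, real_inner_smul_right,
    smul_eq_mul] at h1 ⊢
  have h3 : a * inner ℝ y.fst P.b + c * inner ℝ y.fst P.b = inner ℝ y.fst P.b := by
    rw [← add_mul, hac, one_mul]
  linarith

theorem coupling_add_inner_le (hX : Convex ℝ P.X) {y : DualSpace p m} (hy : y ∈ P.dualDomain ⊤)
    {x x' : PrimalSpace n} (hx : x ∈ P.X) (hx' : x' ∈ P.X) :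
    P.coupling x y + inner ℝ (P.gradX x y) (x' - x) + P.mu / 2 * ‖x' - x‖ ^ 2
      ≤ P.coupling x' y :=
  (strongConvexOn_coupling hm hX hy).add_inner_le hx hx' (hasGradientAt_coupling hm hx y)

theorem convexOn_coupling (hX : Convex ℝ P.X) {y : DualSpace p m}
    (hy : y ∈ P.dualDomain ⊤) : ConvexOn ℝ P.X (fun x => P.coupling x y) :=
  strongConvexOn_zero.1 ((strongConvexOn_coupling hm hX hy).mono hm.1)

/-- The constant is affine in ‖y‖, hence uniform only on bounded dual sets. This is why the
primal-first analysis must confine the dual iterates. -/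
theorem exists_lipschitz_gradX :
    ∃ Lf Lg : ℝ, 0 ≤ Lf ∧ 0 ≤ Lg ∧ ∀ x ∈ P.X, ∀ x' ∈ P.X, ∀ y : DualSpace p m,
      ‖P.gradX x' y - P.gradX x y‖ ≤ (Lf + Lg * ‖y‖) * ‖x' - x‖ := by
  obtain ⟨Lf, hLf, hf⟩ := hm.2.2.2.2.1
  obtain ⟨Lg, hLg, hg⟩ := hm.2.2.2.2.2
  refine ⟨Lf, Lg, hLf, hLg, fun x hx x' hx' y => norm_le_of_forall_inner_le (by positivity) fun w => ?_⟩
  rw [inner_sub_left, inner_gradX hm hx', inner_gradX hm hx]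
  have h1 : fderiv ℝ P.f x' w - fderiv ℝ P.f x w ≤ Lf * ‖x' - x‖ * ‖w‖ := by
    have e : ∀ u ∈ P.X, fderiv ℝ P.f u w = inner ℝ (gradient P.f u) w := fun u hu => by
      have := (hasFDerivAt_f hm hu).differentiableAt.hasGradientAt.hasFDerivAt.unique
        (hasFDerivAt_f hm hu)
      rw [← this]; rfl
    rw [e x hx, e x' hx', ← inner_sub_left]
    exact (real_inner_le_norm _ _).trans
      (mul_le_mul_of_nonneg_right (hf x hx x' hx') (norm_nonneg _))
  have h2 : inner ℝ y.snd (fderiv ℝ P.g x' w) - inner ℝ y.snd (fderiv ℝ P.g x w)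
      ≤ ‖y‖ * (Lg * ‖x' - x‖ * ‖w‖) := by
    rw [← inner_sub_right, ← sub_apply]
    refine (real_inner_le_norm _ _).trans (mul_le_mul ?_ ?_ (norm_nonneg _) (norm_nonneg _))
    · exact WithLp.norm_snd_le _ y
    · exact (ContinuousLinearMap.le_opNorm _ _).trans
        (mul_le_mul_of_nonneg_right (hg x hx x' hx') (norm_nonneg _))
  linarith

theorem exists_norm_fderiv_g_le (hX : IsCompact P.X) :
    ∃ C : ℝ, 0 ≤ C ∧ ∀ x ∈ P.X, ‖fderiv ℝ P.g x‖ ≤ C := by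
  obtain ⟨Lg, hLg, hg⟩ := hm.2.2.2.2.2
  rcases P.X.eq_empty_or_nonempty with he | ⟨x0, hx0⟩
  · exact ⟨0, le_rfl, fun x hx => by simp [he] at hx⟩
  · obtain ⟨D, hD⟩ := hX.isBounded.subset_closedBall x0
    refine ⟨‖fderiv ℝ P.g x0‖ + Lg * |D|, by positivity, fun x hx => ?_⟩
    have h1 := hg x0 hx0 x hx
    have h2 : ‖x - x0‖ ≤ |D| := by
      have := hD hx
      rw [mem_closedBall_iff_norm] at this
      exact this.trans (le_abs_self D)
    have h3 := norm_le_norm_add_norm_sub' (fderiv ℝ P.g x) (fderiv ℝ P.g x0)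
    have h4 := mul_le_mul_of_nonneg_left h2 hLg
    linarith

/-- In `y` the constant is global: the gradient is affine in `y`, with linear part the adjoint of
the constraint Jacobian, which is bounded on the compact set `X`. -/
theorem exists_lipschitz_gradX_dual (hX : IsCompact P.X) :
    ∃ L : ℝ, 0 < L ∧ ∀ x ∈ P.X, ∀ y y' : DualSpace p m,
      ‖P.gradX x y' - P.gradX x y‖ ≤ L * ‖y' - y‖ := by
  obtain ⟨C, hC, hg⟩ := exists_norm_fderiv_g_le hm hX
  set T := (Matrix.toEuclideanLin P.A).toContinuousLinearMap
  refine ⟨‖T‖ + C + 1, by positivity, fun x hx y y' =>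
    norm_le_of_forall_inner_le (by positivity) fun w => ?_⟩
  rw [inner_sub_left, inner_gradX hm hx, inner_gradX hm hx]
  have h1 : inner ℝ y'.fst (Matrix.toEuclideanLin P.A w) - inner ℝ y.fst (Matrix.toEuclideanLin P.A w)
      ≤ ‖y' - y‖ * (‖T‖ * ‖w‖) := by
    rw [← inner_sub_left]
    exact (real_inner_le_norm _ _).trans (mul_le_mul (WithLp.norm_fst_le _ (y' - y)) (T.le_opNorm w)
      (norm_nonneg _) (norm_nonneg _))
  have h2 : inner ℝ y'.snd (fderiv ℝ P.g x w) - inner ℝ y.snd (fderiv ℝ P.g x w)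
      ≤ ‖y' - y‖ * (C * ‖w‖) := by
    rw [← inner_sub_left]
    exact (real_inner_le_norm _ _).trans (mul_le_mul (WithLp.norm_snd_le _ (y' - y))
      ((ContinuousLinearMap.le_opNorm _ _).trans
        (mul_le_mul_of_nonneg_right (hg x hx) (norm_nonneg _))) (norm_nonneg _) (norm_nonneg _))
  nlinarith [mul_nonneg (norm_nonneg (y' - y)) (norm_nonneg w)]

theorem exists_lipschitz_constr (hX : IsCompact P.X) (hXc : Convex ℝ P.X) :
    ∃ L : ℝ, 0 < L ∧ ∀ x ∈ P.X, ∀ x' ∈ P.X, ‖P.constr x' - P.constr x‖ ≤ L * ‖x' - x‖ := by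
  obtain ⟨C, hC, hg⟩ := exists_norm_fderiv_g_le hm hX
  set T := (Matrix.toEuclideanLin P.A).toContinuousLinearMap
  refine ⟨‖T‖ + C + 1, by positivity, fun x hx x' hx' =>
    norm_le_of_forall_inner_le (by positivity) fun w => ?_⟩
  have hgl : ‖P.g x' - P.g x‖ ≤ C * ‖x' - x‖ :=
    hXc.norm_image_sub_le_of_norm_hasFDerivWithin_le
      (fun u hu => (hasFDerivAt_g hm hu).hasFDerivWithinAt) hg hx hx'
  have hTl : ‖T (x' - x)‖ ≤ ‖T‖ * ‖x' - x‖ := T.le_opNorm _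
  have e : inner ℝ (P.constr x' - P.constr x) w
      = inner ℝ (T (x' - x)) w.fst + inner ℝ (P.g x' - P.g x) w.snd := by
    have : (P.constr x' - P.constr x) = WithLp.toLp 2 (T (x' - x), P.g x' - P.g x) := by
      rw [map_sub]
      simp only [constr, ← WithLp.toLp_sub, Prod.mk_sub_mk, sub_sub_sub_cancel_right]
      rfl
    rw [this, WithLp.prod_inner_apply]
    rfl
  rw [e]
  have h1 := (real_inner_le_norm (T (x' - x)) w.fst).trans
    (mul_le_mul hTl (WithLp.norm_fst_le _ w) (norm_nonneg _) (by positivity))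
  have h2 := (real_inner_le_norm (P.g x' - P.g x) w.snd).trans
    (mul_le_mul hgl (WithLp.norm_snd_le _ w) (norm_nonneg _) (by positivity))
  nlinarith [mul_nonneg (norm_nonneg (x' - x)) (norm_nonneg w)]

end Smooth

end ConicProgram

namespace ConicProgram

variable {n p m : ℕ} {P : ConicProgram n p m}

/-! ### Values of the Lagrangian and saddle points -/

theorem lagrangian_of_mem {B : ENNReal} {x : PrimalSpace n} {y : DualSpace p m} (hx : x ∈ P.X)
    (hy : y ∈ P.dualDomain B) : P.lagrangian B x y = (P.coupling x y : EReal) := by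
  simp [lagrangian, hx, hy]

theorem lagrangian_of_notMem_right {B : ENNReal} (x : PrimalSpace n) {y : DualSpace p m}
    (hy : y ∉ P.dualDomain B) : P.lagrangian B x y = ⊥ := by
  simp only [lagrangian, hy, if_false]
  exact EReal.sub_top _

theorem lagrangian_of_notMem_left {B : ENNReal} {x : PrimalSpace n} {y : DualSpace p m}
    (hx : x ∉ P.X) (hy : y ∈ P.dualDomain B) : P.lagrangian B x y = ⊤ := by
  simp [lagrangian, hx, hy]

theorem mem_saddleSet_iff {B : ENNReal} {z : PDSpace n p m} :
    z ∈ P.saddleSet B ↔ z ∈ P.domain B ∧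
      (∀ y ∈ P.dualDomain B, P.coupling z.fst y ≤ P.coupling z.fst z.snd) ∧
      ∀ x ∈ P.X, P.coupling z.fst z.snd ≤ P.coupling x z.snd := by
  constructor
  · rintro ⟨hz, h⟩
    refine ⟨hz, fun y hy => ?_, fun x hx => ?_⟩
    · have := (h z.fst y).1
      rwa [lagrangian_of_mem hz.1 hy, lagrangian_of_mem hz.1 hz.2, EReal.coe_le_coe_iff] at this
    · have := (h x z.snd).2
      rwa [lagrangian_of_mem hx hz.2, lagrangian_of_mem hz.1 hz.2, EReal.coe_le_coe_iff] at this
  · rintro ⟨hz, h1, h2⟩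
    refine ⟨hz, fun x y => ⟨?_, ?_⟩⟩
    · by_cases hy : y ∈ P.dualDomain B
      · rw [lagrangian_of_mem hz.1 hy, lagrangian_of_mem hz.1 hz.2, EReal.coe_le_coe_iff]
        exact h1 y hy
      · rw [lagrangian_of_notMem_right _ hy]; exact bot_le
    · by_cases hx : x ∈ P.X
      · rw [lagrangian_of_mem hx hz.2, lagrangian_of_mem hz.1 hz.2, EReal.coe_le_coe_iff]
        exact h2 x hx
      · rw [lagrangian_of_notMem_left hx hz.2]; exact le_top

/-- The dual function at a saddle point equals the saddle value, so any dual optimal `y` may replace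
its dual component. Restricting the dual domain to a ball containing `y` only removes competitors.
-/
theorem saddleSet_nonempty_of_dualSolution {r R : ℝ} (hr : 0 < r) (hrR : r < R)
    (hs : (P.saddleSet ⊤).Nonempty) (hd : (P.dualSolutions ∩ {y | ‖y‖ ≤ r}).Nonempty) :
    (P.saddleSet (ENNReal.ofReal R)).Nonempty := by
  obtain ⟨z, hz⟩ := hs
  obtain ⟨y, ⟨hy, hopt⟩, hyr⟩ := hd
  rw [mem_saddleSet_iff] at hz
  obtain ⟨hz, h1, h2⟩ := hz
  have hdual : P.dualFunction z.snd = (P.coupling z.fst z.snd : EReal) := by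
    apply le_antisymm
    · exact (iInf_le _ z.fst).trans (lagrangian_of_mem hz.1 hz.2).le
    · refine le_iInf fun x => ?_
      by_cases hx : x ∈ P.X
      · rw [lagrangian_of_mem hx hz.2]; exact EReal.coe_le_coe_iff.2 (h2 x hx)
      · rw [lagrangian_of_notMem_left hx hz.2]; exact le_top
  have key : ∀ x ∈ P.X, P.coupling z.fst z.snd ≤ P.coupling x y := fun x hx => by
    have := (hdual.symm.le.trans (hopt z.snd)).trans (iInf_le _ x)
    rwa [lagrangian_of_mem hx hy, EReal.coe_le_coe_iff] at this
  have hR : 0 ≤ R := (hr.trans hrR).le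
  refine ⟨mkPD z.fst y, mem_saddleSet_iff.2 ⟨⟨hz.1, (P.mem_dualDomain_ofReal hR).2
    ⟨hy, (show ‖y‖ ≤ r from hyr).trans hrR.le⟩⟩, fun y' hy' => ?_, fun x hx => ?_⟩⟩
  · exact (h1 y' (P.dualDomain_subset_top _ hy')).trans (key z.fst hz.1)
  · exact (h1 y hy).trans (key x hx)

/-! ### Regularity assumptions and the smoothed gap -/

/-- The standing assumptions on a conic program and a pair of distance generating functions. -/
structure Regular (P : ConicProgram n p m) (φ : BregmanPair n p m) (Lφ : ℝ) : Prop where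
  sets : P.SetsAssumption
  smooth : P.SmoothnessAssumption
  pos : 0 < Lφ
  phiP : IsDistanceGenerating φ.phiP P.X Lφ
  phiD : IsDistanceGenerating φ.phiD (P.dualDomain ⊤) Lφ
  phiP_eq : 0 < P.mu → φ.phiP = fun x => (1 / 2 : ℝ) * ‖x‖ ^ 2

/-- The expression whose supremum over `z'` in the domain is the smoothed gap at `z`. -/
noncomputable def gapTerm (P : ConicProgram n p m) (φ : BregmanPair n p m) (ξ : ℝ)
    (z z' : PDSpace n p m) : ℝ :=
  P.coupling z.fst z'.snd - P.coupling z'.fst z.snd -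
    2 * ξ * (bregman φ.phiP z'.fst z.fst + bregman φ.phiD z'.snd z.snd)

theorem gapTerm_le_smoothedGap {φ : BregmanPair n p m} {B : ENNReal} {ξ : ℝ} {z z' : PDSpace n p m}
    (hz : z ∈ P.domain B) (hz' : z' ∈ P.domain B) :
    (P.gapTerm φ ξ z z' : EReal) ≤ smoothedGap P φ B ξ z := by
  refine le_trans (le_of_eq ?_) (le_iSup _ z')
  rw [lagrangian_of_mem hz.1 hz'.2, lagrangian_of_mem hz'.1 hz.2, gapTerm, EReal.coe_sub,
    EReal.coe_sub]

theorem smoothedGap_le {φ : BregmanPair n p m} {B : ENNReal} {ξ c : ℝ} {z : PDSpace n p m}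
    (hz : z ∈ P.domain B) (h : ∀ z' ∈ P.domain B, P.gapTerm φ ξ z z' ≤ c) :
    smoothedGap P φ B ξ z ≤ (c : EReal) := by
  refine iSup_le fun z' => ?_
  by_cases hy : z'.snd ∈ P.dualDomain B
  · by_cases hx : z'.fst ∈ P.X
    · rw [lagrangian_of_mem hz.1 hy, lagrangian_of_mem hx hz.2, ← EReal.coe_sub, ← EReal.coe_sub]
      exact EReal.coe_le_coe_iff.2 (h z' ⟨hx, hy⟩)
    · rw [lagrangian_of_mem hz.1 hy, lagrangian_of_notMem_left hx hz.2, EReal.sub_top,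
        EReal.bot_sub]
      exact bot_le
  · rw [lagrangian_of_notMem_right _ hy, EReal.bot_sub, EReal.bot_sub]
    exact bot_le

namespace Regular

variable {φ : BregmanPair n p m} {Lφ : ℝ} (h : P.Regular φ Lφ)
include h

theorem convex_X : Convex ℝ P.X := h.sets.1

theorem isCompact_X : IsCompact P.X := h.sets.2.1

theorem phiD_dualDomain (B : ENNReal) : IsDistanceGenerating φ.phiD (P.dualDomain B) Lφ :=
  h.phiD.mono (P.dualDomain_subset_top B)

theorem mu_nonneg : 0 ≤ P.mu := h.smooth.1

omit h in
theorem mem_top {B : ENNReal} {y : DualSpace p m} (hy : y ∈ P.dualDomain B) :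
    y ∈ P.dualDomain ⊤ := P.dualDomain_subset_top B hy

/-- Convexity in `x` and affinity in `y` make the coupling difference at most linear in z' - z, and
the Bregman penalties dominate it; completing squares gives the bound. Nonnegativity is the choice
z' = z. -/
theorem exists_smoothedGap_eq {B : ENNReal} {ξ : ℝ} (hξ : 0 < ξ) {z : PDSpace n p m}
    (hz : z ∈ P.domain B) : ∃ r : ℝ, 0 ≤ r ∧ smoothedGap P φ B ξ z = (r : EReal) := by
  have h0 : ((0 : ℝ) : EReal) ≤ smoothedGap P φ B ξ z := by
    refine le_of_eq_of_le ?_ (gapTerm_le_smoothedGap hz hz)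
    simp [gapTerm, bregman_self]
  have h1 : smoothedGap P φ B ξ z ≤
      (((‖P.constr z.fst‖ ^ 2 + ‖P.gradX z.fst z.snd‖ ^ 2) / (4 * ξ) : ℝ) : EReal) := by
    refine smoothedGap_le hz fun z' hz' => ?_
    have e1 := coupling_sub_coupling (P := P) z.fst z.snd z'.snd
    have e2 := coupling_add_inner_le h.smooth h.convex_X (mem_top hz.2) hz.1 hz'.1
    have e3 := h.phiP.half_norm_sq_le_bregman z'.fst hz.1
    have e4 := h.phiD.half_norm_sq_le_bregman z'.snd (mem_top hz.2)
    have e5 := real_inner_le_norm (P.constr z.fst) (z'.snd - z.snd)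
    have e6 := (abs_le.1 (abs_real_inner_le_norm (P.gradX z.fst z.snd) (z'.fst - z.fst))).1
    have e7 : 0 ≤ P.mu / 2 * ‖z'.fst - z.fst‖ ^ 2 := mul_nonneg (by linarith [h.mu_nonneg]) (sq_nonneg _)
    rw [gapTerm, le_div_iff₀ (by positivity)]
    nlinarith [sq_nonneg (‖P.constr z.fst‖ - 2 * ξ * ‖z'.snd - z.snd‖),
      sq_nonneg (‖P.gradX z.fst z.snd‖ - 2 * ξ * ‖z'.fst - z.fst‖),
      mul_le_mul_of_nonneg_left e3 hξ.le, mul_le_mul_of_nonneg_left e4 hξ.le,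
      mul_le_mul_of_nonneg_left (add_le_add e3 e4) (mul_pos hξ hξ).le]
  lift smoothedGap P φ B ξ z to ℝ using
    ⟨ne_of_lt (h1.trans_lt (EReal.coe_lt_top _)), ne_of_gt ((EReal.bot_lt_coe _).trans_le h0)⟩ with r
  exact ⟨r, EReal.coe_le_coe_iff.1 h0, rfl⟩

omit h in
-- Freezing one coordinate of `w` recovers the two saddle inequalities. In this form closedness of
-- the saddle set is visible: it is an intersection of sublevel sets of functions continuous on the
-- domain.
theorem mem_saddleSet_iff_forall {B : ENNReal} {z : PDSpace n p m} :
    z ∈ P.saddleSet B ↔ z ∈ P.domain B ∧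
      ∀ w ∈ P.domain B, P.coupling z.fst w.snd - P.coupling w.fst z.snd ≤ 0 := by
  rw [mem_saddleSet_iff]
  constructor
  · rintro ⟨hz, h1, h2⟩
    exact ⟨hz, fun w hw => by linarith [h1 w.snd hw.2, h2 w.fst hw.1]⟩
  · rintro ⟨hz, H⟩
    exact ⟨hz, fun y hy => by have := H (mkPD z.fst y) ⟨hz.1, hy⟩; exact sub_nonpos.1 this,
      fun x hx => by have := H (mkPD x z.snd) ⟨hx, hz.2⟩; exact sub_nonpos.1 this⟩

theorem continuousOn_gap (B : ENNReal) (w : PDSpace n p m) :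
    ContinuousOn (fun z : PDSpace n p m => P.coupling z.fst w.snd - P.coupling w.fst z.snd)
      (P.domain B) :=
  (continuousOn_coupling_fst h.smooth B w.snd).sub
    ((continuous_coupling_right w.fst).comp_continuousOn (by fun_prop))

theorem isClosed_saddleSet (B : ENNReal) : IsClosed (P.saddleSet B) := by
  have hdom := isClosed_domain (P := P) h.isCompact_X.isClosed B
  have e : P.saddleSet B = P.domain B ∩ ⋂ w ∈ P.domain B, (P.domain B ∩
      (fun z : PDSpace n p m => P.coupling z.fst w.snd - P.coupling w.fst z.snd) ⁻¹' Set.Iic 0) := by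
    ext z
    rw [mem_saddleSet_iff_forall]
    simp only [Set.mem_iInter, Set.mem_inter_iff, Set.mem_preimage, Set.mem_Iic]
    exact ⟨fun H => ⟨H.1, fun w hw => ⟨H.1, H.2 w hw⟩⟩, fun H => ⟨H.1, fun w hw => (H.2 w hw).2⟩⟩
  rw [e]
  exact hdom.inter (isClosed_biInter fun w _ =>
    (h.continuousOn_gap B w).preimage_isClosed_of_isClosed hdom isClosed_Iic)

theorem continuousOn_gapTerm (B : ENNReal) (ξ : ℝ) (w : PDSpace n p m) :
    ContinuousOn (fun z => P.gapTerm φ ξ z w) (P.domain B) := by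
  have h1 : ContinuousOn (fun z : PDSpace n p m => bregman φ.phiP w.fst z.fst) (P.domain B) :=
    (h.phiP.continuousOn_bregman_right w.fst).comp (by fun_prop) fun z hz => hz.1
  have h2 : ContinuousOn (fun z : PDSpace n p m => bregman φ.phiD w.snd z.snd) (P.domain B) :=
    ((h.phiD_dualDomain B).continuousOn_bregman_right w.snd).comp (by fun_prop) fun z hz => hz.2
  exact (h.continuousOn_gap B w).sub (continuousOn_const.mul (h1.add h2))

/-! ### Quadratic growth of the smoothed gap -/

theorem mem_kktMap {B : ENNReal} {z u : PDSpace n p m} (hz : z ∈ P.domain B)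
    (hx : ∀ x ∈ P.X, inner ℝ (u.fst - P.gradX z.fst z.snd) (x - z.fst) ≤ 0)
    (hy : ∀ y ∈ P.dualDomain B, inner ℝ (u.snd + P.constr z.fst) (y - z.snd) ≤ 0) :
    u ∈ P.kktMap B z := by
  refine ⟨fun x => ?_, fun y => ?_⟩
  · by_cases hxX : x ∈ P.X
    · change P.lagrangian B z.fst z.snd + _ ≤ P.lagrangian B x z.snd
      rw [lagrangian_of_mem hz.1 hz.2, lagrangian_of_mem hxX hz.2, ← EReal.coe_add,
        EReal.coe_le_coe_iff]
      have h1 := coupling_add_inner_le h.smooth h.convex_X (mem_top hz.2) hz.1 hxX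
      have h2 := hx x hxX
      rw [inner_sub_left] at h2
      have h3 : 0 ≤ P.mu / 2 * ‖x - z.fst‖ ^ 2 := mul_nonneg (by linarith [h.mu_nonneg]) (sq_nonneg _)
      linarith
    · change _ ≤ P.lagrangian B x z.snd
      rw [lagrangian_of_notMem_left hxX hz.2]; exact le_top
  · by_cases hyY : y ∈ P.dualDomain B
    · change -P.lagrangian B z.fst z.snd + _ ≤ -P.lagrangian B z.fst y
      rw [lagrangian_of_mem hz.1 hz.2, lagrangian_of_mem hz.1 hyY, ← EReal.coe_neg,
        ← EReal.coe_neg, ← EReal.coe_add, EReal.coe_le_coe_iff]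
      have h1 := coupling_sub_coupling (P := P) z.fst z.snd y
      have h2 := hy y hyY
      rw [inner_add_left] at h2
      linarith
    · change _ ≤ -P.lagrangian B z.fst y
      rw [lagrangian_of_notMem_right _ hyY, EReal.neg_bot]; exact le_top

/-- The point `w` maximizes the gap expression at `z`, which splits into independent problems in `x`
and `y`. Its optimality conditions differ from the KKT conditions at `w` by Bregman gradients and by
arguments still frozen at `z`, all of size O(‖w - z‖). -/
theorem exists_prox_point (B : ENNReal) {ξ : ℝ} (hξ : 0 < ξ) :
    ∃ C : ℝ, 0 ≤ C ∧ ∀ z ∈ P.domain B, ∃ w ∈ P.domain B,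
      ξ * ‖w - z‖ ^ 2 ≤ P.gapTerm φ ξ z w ∧
      Metric.infDist 0 (P.kktMap B w) ≤ C * ‖w - z‖ := by
  obtain ⟨L1, hL1, hlip1⟩ := exists_lipschitz_gradX_dual h.smooth h.isCompact_X
  obtain ⟨L2, hL2, hlip2⟩ := exists_lipschitz_constr h.smooth h.isCompact_X h.convex_X
  have hLφ := h.pos
  refine ⟨(L1 + 2 * ξ * Lφ) + (L2 + 2 * ξ * Lφ), by positivity, fun z hz => ?_⟩
  have hD := h.phiD_dualDomain B
  obtain ⟨y, hy, hymin⟩ := hD.exists_isMinOn_prox (P.isClosed_dualDomain B) (-P.constr z.fst) hz.2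
    (c := 2 * ξ) (by positivity)
  have hgrad : ∀ x ∈ P.X, HasGradientAt
      (fun x => P.coupling x z.snd + 2 * ξ * bregman φ.phiP x z.fst)
      (P.gradX x z.snd + (2 * ξ) • (gradient φ.phiP x - gradient φ.phiP z.fst)) x := fun x hx => by
    rw [hasGradientAt_iff_hasFDerivAt, map_add, map_smul]
    exact (hasGradientAt_coupling h.smooth hx z.snd).hasFDerivAt.add
      ((h.phiP.hasGradientAt_bregman hx z.fst).hasFDerivAt.const_mul (2 * ξ))
  obtain ⟨x, hx, hxmin⟩ := h.isCompact_X.exists_isMinOn ⟨z.fst, hz.1⟩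
    (fun x hx => (hgrad x hx).differentiableAt.continuousAt.continuousWithinAt)
  have hxopt : ∀ u ∈ P.X, 0 ≤ inner ℝ (P.gradX x z.snd) (u - x) +
      2 * ξ * inner ℝ (gradient φ.phiP x - gradient φ.phiP z.fst) (u - x) := fun u hu => by
    have := inner_nonneg_of_isMinOn h.convex_X hx hxmin (hgrad x hx) hu
    rwa [inner_add_left, real_inner_smul_left] at this
  have hyopt : ∀ u ∈ P.dualDomain B, 0 ≤ -inner ℝ (P.constr z.fst) (u - y) +
      2 * ξ * inner ℝ (gradient φ.phiD y - gradient φ.phiD z.snd) (u - y) := fun u hu => by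
    have := inner_nonneg_of_isMinOn (P.convex_dualDomain B) hy hymin
      (hD.hasGradientAt_prox hy _ z.snd _) hu
    rwa [inner_add_left, real_inner_smul_left, inner_neg_left] at this
  have hw : mkPD x y ∈ P.domain B := ⟨hx, hy⟩
  refine ⟨mkPD x y, hw, ?_, ?_⟩
  · rw [norm_sq_sub]
    change ξ * (‖x - z.fst‖ ^ 2 + ‖y - z.snd‖ ^ 2) ≤ P.coupling z.fst y - P.coupling x z.snd -
      2 * ξ * (bregman φ.phiP x z.fst + bregman φ.phiD y z.snd)
    -- Optimality of `x` tested at `z.fst` yields the symmetric sum 2ξ (D(z.fst, x) + D(x, z.fst)).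
    -- One term pays the penalty in the gap, the other leaves ξ‖x - z.fst‖². The dual part is
    -- analogous.
    have a1 := coupling_add_inner_le h.smooth h.convex_X (mem_top hz.2) hx hz.1
    have a2 : 0 ≤ P.mu / 2 * ‖z.fst - x‖ ^ 2 := mul_nonneg (by linarith [h.mu_nonneg]) (sq_nonneg _)
    have a3 := hxopt z.fst hz.1
    have a4 := bregman_three_point φ.phiP z.fst x z.fst
    have a5 := h.phiP.half_norm_sq_le_bregman z.fst hx
    have b1 := coupling_sub_coupling (P := P) z.fst y z.snd
    have b3 := hyopt z.snd hz.2
    have b4 := bregman_three_point φ.phiD z.snd y z.snd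
    have b5 := hD.half_norm_sq_le_bregman z.snd hy
    rw [bregman_self] at a4 b4
    rw [← a4] at a3
    rw [← b4] at b3
    rw [norm_sub_rev x, norm_sub_rev y]
    nlinarith [mul_le_mul_of_nonneg_left a5 hξ.le, mul_le_mul_of_nonneg_left b5 hξ.le]
  -- The optimality conditions with the frozen arguments moved from `z` to `w`; the corrections make
  -- up `u`.
  · set u : PDSpace n p m := mkPD
      (P.gradX x y - P.gradX x z.snd - (2 * ξ) • (gradient φ.phiP x - gradient φ.phiP z.fst))
      (P.constr z.fst - P.constr x - (2 * ξ) • (gradient φ.phiD y - gradient φ.phiD z.snd)) with hu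
    have hmem : u ∈ P.kktMap B (mkPD x y) := by
      refine h.mem_kktMap hw (fun x' hx' => ?_) (fun y' hy' => ?_)
      · have e : u.fst - P.gradX x y = -(P.gradX x z.snd
            + (2 * ξ) • (gradient φ.phiP x - gradient φ.phiP z.fst)) := by
          change P.gradX x y - P.gradX x z.snd - _ - P.gradX x y = _
          abel
        change inner ℝ (u.fst - P.gradX x y) (x' - x) ≤ 0
        rw [e, inner_neg_left, inner_add_left, real_inner_smul_left]
        linarith [hxopt x' hx']
      · have e : u.snd + P.constr x = P.constr z.fst
            - (2 * ξ) • (gradient φ.phiD y - gradient φ.phiD z.snd) := by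
          change P.constr z.fst - P.constr x - _ + P.constr x = _
          abel
        change inner ℝ (u.snd + P.constr x) (y' - y) ≤ 0
        rw [e, inner_sub_left, real_inner_smul_left]
        linarith [hyopt y' hy']
    refine (Metric.infDist_le_dist_of_mem hmem).trans ?_
    rw [dist_zero_left]
    have n1 : ‖x - z.fst‖ ≤ ‖mkPD x y - z‖ := WithLp.norm_fst_le _ (mkPD x y - z)
    have n2 : ‖y - z.snd‖ ≤ ‖mkPD x y - z‖ := WithLp.norm_snd_le _ (mkPD x y - z)
    have n3 : ‖u‖ ≤ ‖u.fst‖ + ‖u.snd‖ := by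
      have := WithLp.prod_norm_sq_eq_of_L2 u
      nlinarith [norm_nonneg u, norm_nonneg u.fst, norm_nonneg u.snd,
        mul_nonneg (norm_nonneg u.fst) (norm_nonneg u.snd)]
    have n4 : ‖u.fst‖ ≤ L1 * ‖y - z.snd‖ + 2 * ξ * (Lφ * ‖x - z.fst‖) := by
      refine (norm_sub_le _ _).trans (add_le_add (hlip1 x hx z.snd y) ?_)
      rw [norm_smul, Real.norm_of_nonneg (by positivity)]
      exact mul_le_mul_of_nonneg_left (h.phiP.2.2 x hx z.fst hz.1) (by positivity)
    have n5 : ‖u.snd‖ ≤ L2 * ‖x - z.fst‖ + 2 * ξ * (Lφ * ‖y - z.snd‖) := by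
      refine (norm_sub_le _ _).trans (add_le_add ?_ ?_)
      · rw [norm_sub_rev]; exact hlip2 _ hz.1 _ hx
      rw [norm_smul, Real.norm_of_nonneg (by positivity)]
      exact mul_le_mul_of_nonneg_left (hD.2.2 y hy z.snd hz.2) (by positivity)
    have m1 := mul_le_mul_of_nonneg_left n2 hL1.le
    have m2 := mul_le_mul_of_nonneg_left n1 hL2.le
    have m3 := mul_le_mul_of_nonneg_left n1 (by positivity : 0 ≤ 2 * ξ * Lφ)
    have m4 := mul_le_mul_of_nonneg_left n2 (by positivity : 0 ≤ 2 * ξ * Lφ)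
    linarith

/-- Subregularity is applied at the proximal point `w` rather than at `z`, since a small KKT element
is known only there. -/
theorem exists_quadratic_growth_near_saddle {B : ENNReal} {ξ : ℝ} (hξ : 0 < ξ)
    (hsub : P.MetricSubregularity B) {zs : PDSpace n p m} (hzs : zs ∈ P.saddleSet B) :
    ∃ ε > 0, ∃ ρ > 0, ∀ z ∈ P.domain B ∩ Metric.ball zs ε, ∃ w ∈ P.domain B,
      Metric.infDist z (P.saddleSet B) ^ 2 ≤ ρ * P.gapTerm φ ξ z w := by
  obtain ⟨ε, hε, ρ, hρ, H⟩ := hsub zs hzs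
  obtain ⟨C, hC, hprox⟩ := h.exists_prox_point B hξ
  -- With radius ε/2, a proximal point closer to `z` than ε/2 still lies in the ball of
  -- subregularity. If it is farther away, the distance of `z` to `zs` is already below ‖w - z‖. The
  -- sum of two constants serves both cases.
  refine ⟨ε / 2, half_pos hε, (1 + ρ * C) ^ 2 / ξ + 1 / ξ, by positivity, fun z hz => ?_⟩
  obtain ⟨w, hw, hgap, hkkt⟩ := hprox z hz.1
  refine ⟨w, hw, ?_⟩
  have hz2 : dist z zs < ε / 2 := hz.2
  have hinf : 0 ≤ Metric.infDist z (P.saddleSet B) := Metric.infDist_nonneg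
  have hgap' : ‖w - z‖ ^ 2 ≤ P.gapTerm φ ξ z w / ξ := by
    rw [le_div_iff₀ hξ, mul_comm]; exact hgap
  have e : ((1 + ρ * C) ^ 2 / ξ + 1 / ξ) * P.gapTerm φ ξ z w
      = ((1 + ρ * C) ^ 2 + 1) * (P.gapTerm φ ξ z w / ξ) := by ring
  rw [e]
  refine le_trans ?_ (mul_le_mul_of_nonneg_left hgap' (by positivity))
  rcases lt_or_ge ‖w - z‖ (ε / 2) with hlt | hge
  · have hwball : w ∈ Metric.ball zs ε := by
      rw [Metric.mem_ball]
      have := dist_triangle w z zs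
      rw [dist_eq_norm w z] at this
      linarith
    have h1 := H w ⟨hw, hwball⟩
    have h2 : Metric.infDist z (P.saddleSet B) ≤ Metric.infDist w (P.saddleSet B) + dist z w :=
      Metric.infDist_le_infDist_add_dist
    rw [dist_comm, dist_eq_norm] at h2
    have h3 : Metric.infDist z (P.saddleSet B) ≤ (1 + ρ * C) * ‖w - z‖ := by
      have := mul_le_mul_of_nonneg_left hkkt hρ.le
      linarith
    have h4 := pow_le_pow_left₀ hinf h3 2
    rw [mul_pow] at h4
    linarith [sq_nonneg ‖w - z‖]
  · have h1 : Metric.infDist z (P.saddleSet B) ≤ ‖w - z‖ :=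
      ((Metric.infDist_le_dist_of_mem hzs).trans hz2.le).trans hge
    have h2 := pow_le_pow_left₀ hinf h1 2
    nlinarith [mul_nonneg (sq_nonneg (1 + ρ * C)) (sq_nonneg ‖w - z‖)]

/-- Otherwise `z` is its own proximal point. The Bregman distances have zero gradient at `z`, so the
first-order conditions reduce to those of a saddle point. -/
theorem exists_gapTerm_pos {B : ENNReal} {ξ : ℝ} {z : PDSpace n p m}
    (hz : z ∈ P.domain B) (hns : z ∉ P.saddleSet B) : ∃ w ∈ P.domain B, 0 < P.gapTerm φ ξ z w := by
  by_contra! hcon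
  apply hns
  have hxmin : IsMinOn (fun x => P.coupling x z.snd + 2 * ξ * bregman φ.phiP x z.fst) P.X z.fst :=
    isMinOn_iff.2 fun x hx => by
      have := hcon (mkPD x z.snd) ⟨hx, hz.2⟩
      change P.coupling z.fst z.snd - P.coupling x z.snd - 2 * ξ * (bregman φ.phiP x z.fst +
        bregman φ.phiD z.snd z.snd) ≤ 0 at this
      rw [bregman_self] at this ⊢
      linarith
  have hymin : IsMinOn (fun y => inner ℝ (-P.constr z.fst) y + 2 * ξ * bregman φ.phiD y z.snd)
      (P.dualDomain B) z.snd :=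
    isMinOn_iff.2 fun y hy => by
      have := hcon (mkPD z.fst y) ⟨hz.1, hy⟩
      change P.coupling z.fst y - P.coupling z.fst z.snd - 2 * ξ * (bregman φ.phiP z.fst z.fst +
        bregman φ.phiD y z.snd) ≤ 0 at this
      rw [bregman_self, coupling_sub_coupling, inner_sub_right] at this
      rw [bregman_self, inner_neg_left, inner_neg_left]
      linarith
  refine mem_saddleSet_iff.2 ⟨hz, fun y hy => ?_, fun x hx => ?_⟩
  · have := inner_nonneg_of_isMinOn (P.convex_dualDomain B) hz.2 hymin
      ((h.phiD_dualDomain B).hasGradientAt_prox hz.2 _ z.snd _) hy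
    rw [sub_self, smul_zero, add_zero, inner_neg_left, ← coupling_sub_coupling] at this
    linarith
  · have hg : HasGradientAt (fun x => P.coupling x z.snd + 2 * ξ * bregman φ.phiP x z.fst)
        (P.gradX z.fst z.snd + (2 * ξ) • (gradient φ.phiP z.fst - gradient φ.phiP z.fst)) z.fst := by
      rw [hasGradientAt_iff_hasFDerivAt, map_add, map_smul]
      exact (hasGradientAt_coupling h.smooth hz.1 z.snd).hasFDerivAt.add
        ((h.phiP.hasGradientAt_bregman hz.1 z.fst).hasFDerivAt.const_mul (2 * ξ))
    have := inner_nonneg_of_isMinOn h.convex_X hz.1 hxmin hg hx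
    rw [sub_self, smul_zero, add_zero] at this
    have h1 := coupling_add_inner_le h.smooth h.convex_X (mem_top hz.2) hz.1 hx
    have h2 : 0 ≤ P.mu / 2 * ‖x - z.fst‖ ^ 2 := mul_nonneg (by linarith [h.mu_nonneg]) (sq_nonneg _)
    linarith

theorem exists_quadratic_growth {B : ENNReal} {ξ : ℝ} (hξ : 0 < ξ)
    (hsub : P.MetricSubregularity B) (M : ℝ) :
    ∃ ρ : ℝ, 0 < ρ ∧ ∀ z ∈ P.domain B, ‖z‖ ≤ M →
      ((Metric.infDist z (P.saddleSet B) ^ 2 : ℝ) : EReal) ≤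
        (ρ : EReal) * smoothedGap P φ B ξ z := by
  have hcomp : IsCompact (P.domain B ∩ Metric.closedBall 0 M) :=
    (isCompact_closedBall (0 : PDSpace n p m) M).inter_left
      (isClosed_domain h.isCompact_X.isClosed B)
  have key : ∃ ρ : ℝ, 0 < ρ ∧ ∀ z ∈ (P.domain B ∩ Metric.closedBall 0 M) ∩ P.domain B,
      ∃ w ∈ P.domain B, Metric.infDist z (P.saddleSet B) ^ 2 ≤ ρ * P.gapTerm φ ξ z w ∧
        0 ≤ P.gapTerm φ ξ z w := by
    -- Constants add up under finite unions, so one neighborhood of each point suffices.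
    refine hcomp.induction_on (p := fun S => ∃ ρ : ℝ, 0 < ρ ∧ ∀ z ∈ S ∩ P.domain B,
      ∃ w ∈ P.domain B, Metric.infDist z (P.saddleSet B) ^ 2 ≤ ρ * P.gapTerm φ ξ z w ∧
        0 ≤ P.gapTerm φ ξ z w) ?_ ?_ ?_ ?_
    · exact ⟨1, one_pos, fun z hz => absurd hz.1 (Set.notMem_empty z)⟩
    · rintro S T hST ⟨ρ, hρ, H⟩
      exact ⟨ρ, hρ, fun z hz => H z ⟨hST hz.1, hz.2⟩⟩
    · rintro S T ⟨ρ, hρ, H⟩ ⟨ρ', hρ', H'⟩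
      refine ⟨ρ + ρ', by positivity, fun z hz => ?_⟩
      rcases hz.1 with hS | hT
      · obtain ⟨w, hw, h1, h2⟩ := H z ⟨hS, hz.2⟩
        exact ⟨w, hw, by nlinarith, h2⟩
      · obtain ⟨w, hw, h1, h2⟩ := H' z ⟨hT, hz.2⟩
        exact ⟨w, hw, by nlinarith, h2⟩
    · rintro z ⟨hz, -⟩
      by_cases hzs : z ∈ P.saddleSet B
      · obtain ⟨ε, hε, ρ, hρ, H⟩ := h.exists_quadratic_growth_near_saddle hξ hsub hzs
        refine ⟨Metric.ball z ε, mem_nhdsWithin_of_mem_nhds (Metric.ball_mem_nhds z hε), ρ, hρ,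
          fun u hu => ?_⟩
        obtain ⟨w, hw, h1⟩ := H u ⟨hu.2, hu.1⟩
        exact ⟨w, hw, h1, by
          by_contra! hneg
          nlinarith [sq_nonneg (Metric.infDist u (P.saddleSet B)), mul_neg_of_pos_of_neg hρ hneg]⟩
      -- Off the saddle set, a fixed `w` keeps half of its positive gap term nearby by continuity,
      -- while the distance to the saddle set grows by at most 1.
      · obtain ⟨w, hw, hpos⟩ := h.exists_gapTerm_pos (ξ := ξ) hz hzs
        set c := P.gapTerm φ ξ z w
        have hev : ∀ᶠ u in nhdsWithin z (P.domain B), c / 2 < P.gapTerm φ ξ u w :=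
          (h.continuousOn_gapTerm B ξ w z hz).eventually (lt_mem_nhds (half_lt_self hpos))
        obtain ⟨V, hV, hVsub⟩ := mem_nhdsWithin_iff_exists_mem_nhds_inter.1 hev
        set d := Metric.infDist z (P.saddleSet B) + 1
        have hd : 0 < d := add_pos_of_nonneg_of_pos Metric.infDist_nonneg one_pos
        refine ⟨V ∩ Metric.ball z 1, mem_nhdsWithin_of_mem_nhds
          (Filter.inter_mem hV (Metric.ball_mem_nhds z one_pos)), d ^ 2 / (c / 2), by positivity,
          fun u hu => ⟨w, hw, ?_, ?_⟩⟩
        · have h1 : c / 2 < P.gapTerm φ ξ u w := hVsub ⟨hu.1.1, hu.2⟩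
          have h2 : Metric.infDist u (P.saddleSet B) ≤ d := by
            have h3 : Metric.infDist u (P.saddleSet B) ≤ Metric.infDist z (P.saddleSet B) + dist u z :=
              Metric.infDist_le_infDist_add_dist
            have h4 : dist u z < 1 := hu.1.2
            linarith
          have h3 := pow_le_pow_left₀ Metric.infDist_nonneg h2 2
          refine h3.trans ?_
          rw [div_mul_eq_mul_div, le_div_iff₀ (by positivity)]
          exact mul_le_mul_of_nonneg_left h1.le (sq_nonneg d)
        · have h1 : c / 2 < P.gapTerm φ ξ u w := hVsub ⟨hu.1.1, hu.2⟩
          linarith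
  obtain ⟨ρ, hρ, H⟩ := key
  refine ⟨ρ, hρ, fun z hz hzM => ?_⟩
  obtain ⟨w, hw, h1, -⟩ := H z ⟨⟨hz, mem_closedBall_zero_iff.2 hzM⟩, hz⟩
  obtain ⟨r, hr, e⟩ := h.exists_smoothedGap_eq hξ hz
  have h2 := gapTerm_le_smoothedGap (φ := φ) (ξ := ξ) hz hw
  rw [e, EReal.coe_le_coe_iff] at h2
  rw [e, ← EReal.coe_mul, EReal.coe_le_coe_iff]
  exact h1.trans (mul_le_mul_of_nonneg_left h2 hρ.le)

end Regular

end ConicProgram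

/-! ### The step size thresholds Ψ₁ and Ψ₂ -/

theorem StepParams.Admissible.common {a : StepParams} {o : UpdateOrder} (ha : a.Admissible o) :
    0 < a.cα ∧ 0 ≤ a.δ ∧ 0 < a.η ∧ a.η < 1 ∧ 0 < a.τbar ∧ 0 < a.γ0 ∧ (a.cnm = 0 ∨ a.cnm = 1) := by
  cases o
  · obtain ⟨h1, h2, h3, h4, h5, h6, h7, h8, h9⟩ := ha
    exact ⟨h1, h3, h5, h6, h7, h8, h9⟩
  · obtain ⟨h1, h2, h3, h4, h5, h6, h7, h8, h9, h10⟩ := ha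
    exact ⟨h1, h4, h6, h7, h8, h9, h10⟩

theorem psiYX_pos {a : StepParams} (ha : a.Admissible .yx) {Lxx Lyx : ℝ} (hxx : 0 < Lxx)
    (hyx : 0 < Lyx) : 0 < psiYX a Lxx Lyx := by
  obtain ⟨h1, h2, h3, h4, h5, h6, h7, h8, h9, h10⟩ := ha
  have hd : 0 < 1 - a.δ := by linarith
  unfold psiYX
  have : 1 < Real.sqrt (1 + 4 * (1 - a.δ) * a.γ0 / a.cα * (Lyx ^ 2 / Lxx ^ 2)) := by
    rw [Real.lt_sqrt (by norm_num)]
    have : 0 < 4 * (1 - a.δ) * a.γ0 / a.cα * (Lyx ^ 2 / Lxx ^ 2) := by positivity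
    linarith
  have h : 0 < -1 + Real.sqrt (1 + 4 * (1 - a.δ) * a.γ0 / a.cα * (Lyx ^ 2 / Lxx ^ 2)) := by linarith
  positivity

/-- Ψ₂ is the positive root of this quadratic, which is the worst-case backtracking condition for γ
= γ0. -/
theorem psiYX_quadratic {a : StepParams} (ha : a.Admissible .yx) {Lxx Lyx : ℝ} (hxx : 0 < Lxx)
    (hyx : 0 < Lyx) :
    a.γ0 * psiYX a Lxx Lyx ^ 2 * (Lyx ^ 2 / a.cα) + Lxx * psiYX a Lxx Lyx = 1 - a.δ := by
  obtain ⟨h1, h2, h3, h4, h5, h6, h7, h8, h9, h10⟩ := ha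
  have hd : 0 < 1 - a.δ := by linarith
  have hs := Real.sq_sqrt (show 0 ≤ 1 + 4 * (1 - a.δ) * a.γ0 / a.cα * (Lyx ^ 2 / Lxx ^ 2) by positivity)
  unfold psiYX
  set r := Real.sqrt (1 + 4 * (1 - a.δ) * a.γ0 / a.cα * (Lyx ^ 2 / Lxx ^ 2))
  have e : a.γ0 * (a.cα / (2 * a.γ0) * (Lxx / Lyx ^ 2) * (-1 + r)) ^ 2 * (Lyx ^ 2 / a.cα)
      + Lxx * (a.cα / (2 * a.γ0) * (Lxx / Lyx ^ 2) * (-1 + r))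
      = a.cα / (4 * a.γ0) * (Lxx ^ 2 / Lyx ^ 2) * (r ^ 2 - 1) := by
    field_simp
    ring
  rw [e, hs]
  field_simp
  ring

theorem psiXY_pos {a : StepParams} (ha : a.Admissible .xy) {Lxx Lxy : ℝ} (hxx : 0 < Lxx)
    (hxy : 0 < Lxy) : 0 < psiXY a Lxx Lxy := by
  obtain ⟨h1, h2, h3, h4, h5, h6, h7, h8, h9⟩ := ha
  have hd : 0 < 1 - a.δ := by linarith
  have hd' : 0 < 1 - (a.cα + a.cβ + a.δ) := by linarith
  unfold psiXY
  have := Real.sqrt_pos.2 (mul_pos h1 hd)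
  have := Real.sqrt_pos.2 (mul_pos h2 hd')
  have := Real.sqrt_pos.2 h8
  exact lt_min (by positivity) (by positivity)

/-- The two entries of the minimum in Ψ₁ belong to the coefficients of D_d and D_p in the
backtracking test. -/
theorem psiXY_sq_le {a : StepParams} (ha : a.Admissible .xy) {Lxx Lxy : ℝ} (hxx : 0 < Lxx)
    (hxy : 0 < Lxy) :
    a.γ0 * psiXY a Lxx Lxy ^ 2 * (Lxy ^ 2 / a.cα) ≤ 1 - a.δ ∧
      psiXY a Lxx Lxy ^ 2 * (Lxx ^ 2 / a.cβ) ≤ 1 - (a.cα + a.cβ + a.δ) := by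
  have hpos := (psiXY_pos ha hxx hxy).le
  obtain ⟨h1, h2, h3, h4, h5, h6, h7, h8, h9⟩ := ha
  have hd : 0 < 1 - a.δ := by linarith
  have hd' : 0 < 1 - (a.cα + a.cβ + a.δ) := by linarith
  constructor
  · have h := pow_le_pow_left₀ hpos (min_le_left _ _ : psiXY a Lxx Lxy ≤ _) 2
    rw [div_pow, mul_pow, Real.sq_sqrt (mul_pos h1 hd).le, Real.sq_sqrt h8.le] at h
    have h' := mul_le_mul_of_nonneg_right (mul_le_mul_of_nonneg_left h h8.le)
      (by positivity : 0 ≤ Lxy ^ 2 / a.cα)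
    refine h'.trans (le_of_eq ?_)
    field_simp
  · have h := pow_le_pow_left₀ hpos (min_le_right _ _ : psiXY a Lxx Lxy ≤ _) 2
    rw [div_pow, Real.sq_sqrt (mul_pos h2 hd').le] at h
    have h' := mul_le_mul_of_nonneg_right h (by positivity : 0 ≤ Lxx ^ 2 / a.cβ)
    refine h'.trans (le_of_eq ?_)
    field_simp

theorem neg_inner_le_young {E : Type*} [NormedAddCommGroup E] [InnerProductSpace ℝ E] (q v : E) {s c : ℝ}
    (hc : 0 < c) : -(s * inner ℝ q v) ≤ c / 2 * ‖v‖ ^ 2 + s ^ 2 / (2 * c) * ‖q‖ ^ 2 := by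
  have h : 0 ≤ ‖c • v + s • q‖ ^ 2 := sq_nonneg _
  rw [norm_add_sq_real, norm_smul, norm_smul, real_inner_smul_left, real_inner_smul_right,
    mul_pow, mul_pow, Real.norm_eq_abs, Real.norm_eq_abs, sq_abs, sq_abs, real_inner_comm] at h
  have e : c / 2 * ‖v‖ ^ 2 + s ^ 2 / (2 * c) * ‖q‖ ^ 2 + s * inner ℝ q v
      = (c ^ 2 * ‖v‖ ^ 2 + 2 * (c * (s * inner ℝ q v)) + s ^ 2 * ‖q‖ ^ 2) / (2 * c) := by
    field_simp
    ring
  have := div_nonneg h (by positivity : 0 ≤ 2 * c)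
  linarith

namespace Apdb

open ConicProgram

variable {n p m : ℕ} {P : ConicProgram n p m} {φ : BregmanPair n p m} {B : ENNReal}
  {a : StepParams}

/-- The properties of a state that are preserved by the iteration. -/
structure Valid (P : ConicProgram n p m) (B : ENNReal) (a : StepParams) (s : ApdbState n p m) :
    Prop where
  x : s.x ∈ P.X
  y : s.y ∈ P.dualDomain B
  τPrev : 0 < s.τPrev
  σPrev : 0 < s.σPrev
  σPrev_le : s.σPrev ≤ s.γ * s.τPrev
  γ0_le : a.γ0 ≤ s.γ
  τtrial : 0 < s.τtrial

/-! ### Backtracking -/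

/-- Every sufficiently small step size is accepted at `s`. -/
def AcceptsBelow (P : ConicProgram n p m) (φ : BregmanPair n p m) (B : ENNReal) (a : StepParams)
    (o : UpdateOrder) (s : ApdbState n p m) (Ψ : ℝ) : Prop :=
  ∀ τ : ℝ, 0 < τ → s.γ * τ ^ 2 ≤ a.γ0 * Ψ ^ 2 → Accepts P φ B a o s τ

section Backtracking

variable {o : UpdateOrder} {s : ApdbState n p m} {Ψ : ℝ} (ha : a.Admissible o) (hs : Valid P B a s)
  (hΨ : 0 < Ψ) (hacc : AcceptsBelow P φ B a o s Ψ)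
include ha hs hΨ hacc

theorem exists_accepts : ∃ j : ℕ, Accepts P φ B a o s (a.η ^ j * s.τtrial) := by
  obtain ⟨-, -, hη, hη1, -, hγ0, -⟩ := ha.common
  have hγ : 0 < s.γ := hγ0.trans_le hs.γ0_le
  have ht : Filter.Tendsto (fun j : ℕ => s.γ * (a.η ^ j * s.τtrial) ^ 2) Filter.atTop
      (nhds (s.γ * (0 * s.τtrial) ^ 2)) :=
    (((tendsto_pow_atTop_nhds_zero_of_lt_one hη.le hη1).mul_const _).pow 2).const_mul _
  have hlt : s.γ * (0 * s.τtrial) ^ 2 < a.γ0 * Ψ ^ 2 := by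
    have : 0 < a.γ0 * Ψ ^ 2 := by positivity
    simpa using this
  obtain ⟨j, hj⟩ := (ht.eventually (gt_mem_nhds hlt)).exists
  exact ⟨j, hacc _ (mul_pos (pow_pos hη j) hs.τtrial) hj.le⟩

theorem accepts_acceptedStep : Accepts P φ B a o s (acceptedStep P φ B a o s) :=
  Nat.sInf_mem (s := {j | Accepts P φ B a o s (a.η ^ j * s.τtrial)}) (exists_accepts ha hs hΨ hacc)

omit hΨ hacc in
theorem acceptedStep_pos : 0 < acceptedStep P φ B a o s :=
  mul_pos (pow_pos ha.common.2.2.1 _) hs.τtrial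

omit hΨ hacc in
theorem acceptedStep_le : acceptedStep P φ B a o s ≤ s.τtrial :=
  mul_le_of_le_one_left hs.τtrial.le (pow_le_one₀ ha.common.2.2.1.le ha.common.2.2.2.1.le)

omit hΨ in
-- Either the first trial passes, or the preceding trial, larger by 1/η, was rejected and thus
-- violates γ τ² ≤ γ0 Ψ². The product γ τ² is tracked because the trial rule preserves it while γ
-- grows.
theorem le_mul_acceptedStep_sq {κ : ℝ} (h1 : κ ≤ s.γ * s.τtrial ^ 2)
    (h2 : κ ≤ a.γ0 * (a.η * Ψ) ^ 2) : κ ≤ s.γ * acceptedStep P φ B a o s ^ 2 := by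
  obtain ⟨-, -, hη, hη1, -, hγ0, -⟩ := ha.common
  unfold acceptedStep
  set j := sInf {j | Accepts P φ B a o s (a.η ^ j * s.τtrial)} with hj
  rcases Nat.eq_zero_or_pos j with h0 | hpos
  · rw [h0]; simpa using h1
  · have hnot : ¬ Accepts P φ B a o s (a.η ^ (j - 1) * s.τtrial) :=
      fun hcon => Nat.notMem_of_lt_sInf (show j - 1 < j by omega) hcon
    have h3 : a.γ0 * Ψ ^ 2 < s.γ * (a.η ^ (j - 1) * s.τtrial) ^ 2 := by
      by_contra! hcon
      exact hnot (hacc _ (mul_pos (pow_pos hη _) hs.τtrial) hcon)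
    have e : a.η ^ j = a.η * a.η ^ (j - 1) := by
      rw [← pow_succ', Nat.sub_add_cancel hpos]
    rw [e]
    have := mul_le_mul_of_nonneg_left h3.le (sq_nonneg a.η)
    calc κ ≤ a.γ0 * (a.η * Ψ) ^ 2 := h2
      _ = a.η ^ 2 * (a.γ0 * Ψ ^ 2) := by ring
      _ ≤ a.η ^ 2 * (s.γ * (a.η ^ (j - 1) * s.τtrial) ^ 2) := this
      _ = _ := by ring

end Backtracking

/-! ### One step with the dual update first -/

/-- The part of the Lyapunov function that involves the dual variable. -/
noncomputable def dualEnergy (P : ConicProgram n p m) (φ : BregmanPair n p m)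
    (a : StepParams) (s : ApdbState n p m) (y : DualSpace p m) : ℝ :=
  bregman φ.phiD y s.y - s.σPrev * inner ℝ (P.constr s.x - P.constr s.xPrev) (y - s.y)
    + s.σPrev ^ 2 / (2 * a.cα) * ‖P.constr s.x - P.constr s.xPrev‖ ^ 2

section DualFirst

variable {s : ApdbState n p m} (h : P.Regular φ Lφ) (ha : a.Admissible .yx) (hs : Valid P B a s)
include h ha hs

theorem candidate_yx {τ : ℝ} (hτ : 0 < τ) {x' : PrimalSpace n} {y' : DualSpace p m}
    (hc : candidate P φ B .yx s τ = (x', y')) :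
    x' ∈ P.X ∧ y' ∈ P.dualDomain B ∧
    (∀ y ∈ P.dualDomain B, inner ℝ (-(P.constr s.x + (s.σPrev / (s.γ * τ)) •
        (P.constr s.x - P.constr s.xPrev))) (y' - y) ≤
      1 / (s.γ * τ) * (bregman φ.phiD y s.y - bregman φ.phiD y y' - bregman φ.phiD y' s.y)) ∧
    ∀ x ∈ P.X, inner ℝ (P.gradX s.x y') (x' - x) ≤
      1 / τ * (bregman φ.phiP x s.x - bregman φ.phiP x x' - bregman φ.phiP x' s.x) := by
  have hγ : 0 < s.γ := ha.common.2.2.2.2.2.1.trans_le hs.γ0_le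
  have hD := h.phiD_dualDomain B
  simp only [candidate, gradY_eq, Prod.mk.injEq] at hc
  obtain ⟨hx, hy⟩ := hc
  rw [hy] at hx
  have e : ∀ θ : ℝ, (fun y : DualSpace p m => -inner ℝ ((1 + θ) • P.constr s.x - θ • P.constr s.xPrev) y
      + 1 / (s.γ * τ) * bregman φ.phiD y s.y) = fun y => inner ℝ (-(P.constr s.x + θ •
        (P.constr s.x - P.constr s.xPrev))) y + 1 / (s.γ * τ) * bregman φ.phiD y s.y := fun θ => by
    funext y
    rw [inner_neg_left]
    congr 4
    module
  rw [e] at hy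
  have hσ : 0 < 1 / (s.γ * τ) := by positivity
  have hτ' : 0 < 1 / τ := by positivity
  refine ⟨?_, ?_, fun y hyB => ?_, fun x hxX => ?_⟩
  · rw [← hx]; exact (h.phiP.argminOn_prox h.isCompact_X.isClosed _ hs.x hτ').1
  · rw [← hy]; exact (hD.argminOn_prox (P.isClosed_dualDomain B) _ hs.y hσ).1
  · exact hD.inner_argminOn_prox_le (P.isClosed_dualDomain B) (P.convex_dualDomain B) _ hs.y hyB hσ
      hy.symm
  · exact h.phiP.inner_argminOn_prox_le h.isCompact_X.isClosed h.convex_X _ hs.x hxX hτ' hx.symm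

/-- The descent lemma and the bound on the constraint increment reduce the primal part of the test
to Lxx τ + γ τ² Lyx²/cα ≤ 1 - δ. The dual part is cα + δ ≤ 1. -/
theorem acceptsBelow_yx {Lxx Lyx : ℝ} (hxx : 0 < Lxx) (hyx : 0 < Lyx)
    (hL : ∀ x ∈ P.X, ∀ x' ∈ P.X, ∀ y ∈ P.dualDomain B,
      ‖P.gradX x' y - P.gradX x y‖ ≤ Lxx * ‖x' - x‖ ∧
      ‖P.gradY x' y - P.gradY x y‖ ≤ Lyx * ‖x' - x‖) :
    AcceptsBelow P φ B a .yx s (psiYX a Lxx Lyx) := by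
  intro τ hτ hτΨ
  have hΨ := psiYX_pos ha hxx hyx
  have hquad := psiYX_quadratic ha hxx hyx
  obtain ⟨hcα, hcα1, hcβ, hδ, hsum, hη, hη1, hτbar, hγ0, hcnm⟩ := ha
  have ha' : a.Admissible .yx := ⟨hcα, hcα1, hcβ, hδ, hsum, hη, hη1, hτbar, hγ0, hcnm⟩
  have hγ : 0 < s.γ := hγ0.trans_le hs.γ0_le
  obtain ⟨⟨x', y'⟩, hc⟩ : ∃ c, candidate P φ B .yx s τ = c := ⟨_, rfl⟩
  obtain ⟨hx', hy', -, -⟩ := candidate_yx h ha' hs hτ hc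
  simp only [Accepts, testFunction, hc]
  set σ := s.γ * τ with hσ
  have hσ0 : 0 < σ := mul_pos hγ hτ
  set Dp := bregman φ.phiP x' s.x
  set Dd := bregman φ.phiD y' s.y
  have hDp : 1 / 2 * ‖x' - s.x‖ ^ 2 ≤ Dp := h.phiP.half_norm_sq_le_bregman x' hs.x
  have hDd : 0 ≤ Dd := (h.phiD_dualDomain B).bregman_nonneg y' hs.y
  have hDp0 : 0 ≤ Dp := h.phiP.bregman_nonneg x' hs.x
  have h1 : P.coupling x' y' - P.coupling s.x y' - inner ℝ (P.gradX s.x y') (x' - s.x)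
      ≤ Lxx * Dp := by
    have := sub_sub_inner_le_of_lipschitz_gradient h.convex_X
      (fun x hx => hasGradientAt_coupling h.smooth hx y') hs.x hx'
      (fun x hx => (hL s.x hs.x x hx y' hy').1)
    nlinarith
  have h2 : ‖P.gradY x' y' - P.gradY s.x y'‖ ^ 2 ≤ Lyx ^ 2 * (2 * Dp) := by
    have := pow_le_pow_left₀ (norm_nonneg _) (hL s.x hs.x x' hx' y' hy').2 2
    rw [mul_pow] at this
    nlinarith [sq_nonneg Lyx]
  have h3 : 1 / (2 * (a.cα / σ)) * ‖P.gradY x' y' - P.gradY s.x y'‖ ^ 2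
      ≤ σ * (Lyx ^ 2 / a.cα) * Dp := by
    have e : 1 / (2 * (a.cα / σ)) = σ / (2 * a.cα) := by field_simp
    rw [e]
    refine (mul_le_mul_of_nonneg_left h2 (by positivity)).trans (le_of_eq ?_)
    field_simp
  -- θ_k α_k = cα/σ_k: the previous dual step size cancels.
  have h4 : s.σPrev / σ * (a.cα / s.σPrev) = a.cα / σ := by
    have := hs.σPrev.ne'
    field_simp
  rw [h4]
  -- Since γ0 ≤ γ, the bound on γ τ² also bounds τ itself, as the linear term of the quadratic
  -- requires.
  have hτle : τ ≤ psiYX a Lxx Lyx := by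
    have : a.γ0 * τ ^ 2 ≤ a.γ0 * psiYX a Lxx Lyx ^ 2 :=
      (mul_le_mul_of_nonneg_right hs.γ0_le (sq_nonneg τ)).trans hτΨ
    exact le_of_sq_le_sq (le_of_mul_le_mul_left this hγ0) hΨ.le
  have h5 : Lxx + σ * (Lyx ^ 2 / a.cα) ≤ (1 - a.δ) / τ := by
    rw [le_div_iff₀ hτ, ← hquad]
    have e1 := mul_le_mul_of_nonneg_right hτΨ (by positivity : 0 ≤ Lyx ^ 2 / a.cα)
    have e2 := mul_le_mul_of_nonneg_left hτle hxx.le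
    calc _ = s.γ * τ ^ 2 * (Lyx ^ 2 / a.cα) + Lxx * τ := by rw [hσ]; ring
      _ ≤ _ := add_le_add e1 e2
  have h6 := mul_le_mul_of_nonneg_right h5 hDp0
  have h7 : (1 / σ - a.cα / σ) * Dd ≥ a.δ / σ * Dd := by
    refine mul_le_mul_of_nonneg_right ?_ hDd
    rw [← sub_div]
    exact div_le_div_of_nonneg_right (by linarith) hσ0.le
  have e8 : (1 - a.δ) / τ * Dp = 1 / τ * Dp - a.δ / τ * Dp := by ring
  linarith

/-- By Young's inequality with weight cα, extrapolation costs at most the fraction cα of the Bregman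
distance, beyond the square already contained in `dualEnergy`. -/
theorem le_dualEnergy (y : DualSpace p m) :
    (1 - a.cα) * bregman φ.phiD y s.y ≤ dualEnergy P φ a s y := by
  have hcα := ha.common.1
  have h1 := neg_inner_le_young (P.constr s.x - P.constr s.xPrev) (-(y - s.y)) (s := s.σPrev) hcα
  have h2 := (h.phiD_dualDomain B).half_norm_sq_le_bregman y hs.y
  rw [inner_neg_right, norm_neg] at h1
  unfold dualEnergy
  nlinarith

/-- Both proximal inequalities are added to the strong convexity inequality based at the old point
`s.x`, where the primal gradient is evaluated; the test controls the linearization error. This base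
point is the reason why `P.mu` multiplies the old distance. -/
theorem step_yx_le (hacc : Accepts P φ B a .yx s (acceptedStep P φ B a .yx s))
    {x : PrimalSpace n} {y : DualSpace p m} (hx : x ∈ P.X) (hy : y ∈ P.dualDomain B)
    {s' : ApdbState n p m} (hs' : s' = step P φ B a .yx s) :
    s'.σPrev * (P.coupling s'.x y - P.coupling x s'.y) + s.γ * bregman φ.phiP x s'.x
        + dualEnergy P φ a s' y ≤
      s.γ * bregman φ.phiP x s.x - s'.σPrev * (P.mu / 2 * ‖x - s.x‖ ^ 2) + dualEnergy P φ a s y := by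
  have hτ := acceptedStep_pos (φ := φ) ha hs
  obtain ⟨hcα, hcα1, hcβ, hδ, hsum, hη, hη1, hτbar, hγ0, hcnm⟩ := ha
  have ha' : a.Admissible .yx := ⟨hcα, hcα1, hcβ, hδ, hsum, hη, hη1, hτbar, hγ0, hcnm⟩
  have hγ : 0 < s.γ := hγ0.trans_le hs.γ0_le
  have hx'e : s'.x = (candidate P φ B .yx s (acceptedStep P φ B a .yx s)).1 := by rw [hs']; rfl
  have hy'e : s'.y = (candidate P φ B .yx s (acceptedStep P φ B a .yx s)).2 := by rw [hs']; rfl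
  have hσ'e : s'.σPrev = s.γ * acceptedStep P φ B a .yx s := by rw [hs']; rfl
  have hxpe : s'.xPrev = s.x := by rw [hs']; rfl
  set τ := acceptedStep P φ B a .yx s
  obtain ⟨⟨x', y'⟩, hc⟩ : ∃ c, candidate P φ B .yx s τ = c := ⟨_, rfl⟩
  obtain ⟨hx', hy', hopty, hoptx⟩ := candidate_yx h ha' hs hτ hc
  simp only [Accepts, testFunction, hc] at hacc
  rw [hc] at hx'e hy'e
  unfold dualEnergy
  rw [hx'e, hy'e, hxpe, hσ'e]
  have hσ0 : 0 < s.γ * τ := mul_pos hγ hτ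
  have hopty := hopty y hy
  have hoptx := hoptx x hx
  set σ := s.γ * τ with hσ
  simp only [gradY_eq] at hacc
  set q := P.constr s.x - P.constr s.xPrev
  set q' := P.constr x' - P.constr s.x
  have h4 : s.σPrev / σ * (a.cα / s.σPrev) = a.cα / σ := by
    have := hs.σPrev.ne'
    field_simp
  rw [h4] at hacc
  have hDp0 : 0 ≤ bregman φ.phiP x' s.x := h.phiP.bregman_nonneg x' hs.x
  have hDd := (h.phiD_dualDomain B).half_norm_sq_le_bregman y' hs.y
  have hDd0 : 0 ≤ bregman φ.phiD y' s.y := (h.phiD_dualDomain B).bregman_nonneg y' hs.y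
  -- The accepted test multiplied by σ, with the nonnegative δ terms dropped.
  have t1 : σ * (P.coupling x' y' - P.coupling s.x y' - inner ℝ (P.gradX s.x y') (x' - s.x))
      ≤ s.γ * bregman φ.phiP x' s.x - σ ^ 2 / (2 * a.cα) * ‖q'‖ ^ 2
        + (1 - a.cα) * bregman φ.phiD y' s.y := by
    have e1 : 0 ≤ a.δ / τ * bregman φ.phiP x' s.x := by positivity
    have e2 : 0 ≤ a.δ / σ * bregman φ.phiD y' s.y := by positivity
    have e3 : P.coupling x' y' - P.coupling s.x y' - inner ℝ (P.gradX s.x y') (x' - s.x)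
        ≤ 1 / τ * bregman φ.phiP x' s.x - 1 / (2 * (a.cα / σ)) * ‖q'‖ ^ 2
          + (1 / σ - a.cα / σ) * bregman φ.phiD y' s.y := by linarith
    refine (mul_le_mul_of_nonneg_left e3 hσ0.le).trans (le_of_eq ?_)
    rw [hσ]
    field_simp
  have t2 : σ * inner ℝ (P.gradX s.x y') (x' - x) ≤
      s.γ * (bregman φ.phiP x s.x - bregman φ.phiP x x' - bregman φ.phiP x' s.x) := by
    refine (mul_le_mul_of_nonneg_left hoptx hσ0.le).trans (le_of_eq ?_)
    rw [hσ]
    field_simp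
  have t3 : σ * inner ℝ (P.constr s.x) (y - y') + s.σPrev * inner ℝ q (y - y')
      ≤ bregman φ.phiD y s.y - bregman φ.phiD y y' - bregman φ.phiD y' s.y := by
    have e : inner ℝ (-(P.constr s.x + (s.σPrev / σ) • q)) (y' - y)
        = inner ℝ (P.constr s.x) (y - y') + s.σPrev / σ * inner ℝ q (y - y') := by
      rw [← neg_sub y y', inner_neg_neg, inner_add_left, real_inner_smul_left]
    rw [e] at hopty
    have := mul_le_mul_of_nonneg_left hopty hσ0.le
    calc _ = σ * (inner ℝ (P.constr s.x) (y - y') + s.σPrev / σ * inner ℝ q (y - y')) := by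
          field_simp
      _ ≤ _ := this
      _ = _ := by field_simp
  have t4 := mul_le_mul_of_nonneg_left
    (coupling_add_inner_le h.smooth h.convex_X (Regular.mem_top hy') hs.x hx) hσ0.le
  have t5 := coupling_sub_coupling (P := P) x' y' y
  have t6 : inner ℝ (P.constr x') (y - y') = inner ℝ q' (y - y') + inner ℝ (P.constr s.x) (y - y') := by
    rw [← inner_add_left, sub_add_cancel]
  -- The extrapolation term is split at `s.y`. The part y - s.y belongs to the old energy; the part
  -- s.y - y' costs cα D_d(y', s.y), which is what the test leaves of the proximal term.
  have t7 := neg_inner_le_young q (s.y - y') (s := s.σPrev) hcα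
  rw [norm_sub_rev s.y] at t7
  have t8 : inner ℝ q (y - y') = inner ℝ q (y - s.y) + inner ℝ q (s.y - y') := by
    rw [← inner_add_right, sub_add_sub_cancel]
  have t9 : inner ℝ (P.gradX s.x y') (x - s.x) = inner ℝ (P.gradX s.x y') (x' - s.x)
      - inner ℝ (P.gradX s.x y') (x' - x) := by
    rw [← inner_sub_right, sub_sub_sub_cancel_left]
  have t10 := mul_le_mul_of_nonneg_left hDd hcα.le
  have t5' : P.coupling x' y = P.coupling x' y' + inner ℝ (P.constr x') (y - y') := by linarith
  rw [t5', t6]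
  rw [t8] at t3
  rw [t9] at t4
  linarith

end DualFirst

end Apdb

namespace Apdb

open ConicProgram

variable {n p m : ℕ} {P : ConicProgram n p m} {φ : BregmanPair n p m} {B : ENNReal}
  {a : StepParams}

/-! ### One step with the primal update first -/

theorem gradX_smul_sub_smul (hm : P.SmoothnessAssumption) {x : PrimalSpace n} (hx : x ∈ P.X)
    (y y' : DualSpace p m) (c : ℝ) :
    P.gradX x (c • y') - P.gradX x (c • y) = c • (P.gradX x y' - P.gradX x y) := by
  refine ext_inner_right ℝ fun w => ?_
  rw [real_inner_smul_left, inner_sub_left, inner_sub_left, inner_gradX hm hx, inner_gradX hm hx,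
    inner_gradX hm hx, inner_gradX hm hx]
  simp only [WithLp.smul_fst, WithLp.smul_snd, real_inner_smul_left]
  ring

/-- Differences of the gradient in `y` are linear in `y`, so both points can be scaled into the ball
without changing the ratio. Candidates outside the ball are therefore harmless. -/
theorem lipschitz_gradX_dual_of_ball (hm : P.SmoothnessAssumption) {R L : ℝ} (hR : 0 < R)
    (hL : ∀ x ∈ P.X, ∀ y ∈ P.dualDomain (ENNReal.ofReal R),
      ∀ y' ∈ P.dualDomain (ENNReal.ofReal R), ‖P.gradX x y' - P.gradX x y‖ ≤ L * ‖y' - y‖)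
    {x : PrimalSpace n} (hx : x ∈ P.X) {y y' : DualSpace p m} (hy : y ∈ P.dualDomain ⊤)
    (hy' : y' ∈ P.dualDomain ⊤) : ‖P.gradX x y' - P.gradX x y‖ ≤ L * ‖y' - y‖ := by
  set c := R / (R + ‖y‖ + ‖y'‖) with hc
  have hden : 0 < R + ‖y‖ + ‖y'‖ := by positivity
  have hc0 : 0 < c := by positivity
  have hmem : ∀ u ∈ P.dualDomain ⊤, ‖u‖ ≤ R + ‖y‖ + ‖y'‖ →
      c • u ∈ P.dualDomain (ENNReal.ofReal R) := fun u hu hle => by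
    refine (P.mem_dualDomain_ofReal hR.le).2 ⟨P.smul_mem_dualDomain_top hu hc0.le, ?_⟩
    rw [norm_smul, Real.norm_of_nonneg hc0.le, hc, div_mul_eq_mul_div, div_le_iff₀ hden]
    exact mul_le_mul_of_nonneg_left hle hR.le
  have := hL x hx (c • y) (hmem y hy (by linarith [norm_nonneg y'])) (c • y')
    (hmem y' hy' (by linarith [norm_nonneg y]))
  rw [gradX_smul_sub_smul hm hx, ← smul_sub, norm_smul, norm_smul, Real.norm_of_nonneg hc0.le] at this
  refine le_of_mul_le_mul_left ?_ hc0
  linarith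

/-- The Lyapunov function for the primal-first order. -/
noncomputable def primalDualEnergy (P : ConicProgram n p m) (φ : BregmanPair n p m)
    (a : StepParams) (s : ApdbState n p m) (x : PrimalSpace n) (y : DualSpace p m) : ℝ :=
  s.γ * bregman φ.phiP x s.x + bregman φ.phiD y s.y
    - s.σPrev * inner ℝ (P.gradX s.x s.y - P.gradX s.xPrev s.yPrev) (s.x - x)
    + (s.σPrev * s.τPrev / (2 * a.cα) * ‖P.gradX s.x s.y - P.gradX s.x s.yPrev‖ ^ 2
      + s.σPrev ^ 2 / (2 * (a.γ0 * a.cβ)) * ‖P.gradX s.x s.yPrev - P.gradX s.xPrev s.yPrev‖ ^ 2)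

section PrimalFirst

variable {s : ApdbState n p m} (h : P.Regular φ Lφ) (ha : a.Admissible .xy) (hs : Valid P B a s)
include h ha hs

theorem candidate_xy {τ : ℝ} (hτ : 0 < τ) {x' : PrimalSpace n} {y' : DualSpace p m}
    (hc : candidate P φ B .xy s τ = (x', y')) :
    x' ∈ P.X ∧ y' ∈ P.dualDomain B ∧
    (∀ x ∈ P.X, inner ℝ (P.gradX s.x s.y + (s.σPrev / (s.γ * τ)) •
        (P.gradX s.x s.y - P.gradX s.xPrev s.yPrev)) (x' - x) ≤
      1 / τ * (bregman φ.phiP x s.x - bregman φ.phiP x x' - bregman φ.phiP x' s.x)) ∧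
    ∀ y ∈ P.dualDomain B, inner ℝ (-P.constr x') (y' - y) ≤
      1 / (s.γ * τ) * (bregman φ.phiD y s.y - bregman φ.phiD y y' - bregman φ.phiD y' s.y) := by
  have hγ : 0 < s.γ := ha.common.2.2.2.2.2.1.trans_le hs.γ0_le
  have hD := h.phiD_dualDomain B
  simp only [candidate, gradY_eq, Prod.mk.injEq, ← inner_neg_left] at hc
  obtain ⟨hx, hy⟩ := hc
  rw [hx] at hy
  have e : ∀ θ : ℝ, (1 + θ) • P.gradX s.x s.y - θ • P.gradX s.xPrev s.yPrev
      = P.gradX s.x s.y + θ • (P.gradX s.x s.y - P.gradX s.xPrev s.yPrev) := fun θ => by module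
  rw [e] at hx
  have hσ : 0 < 1 / (s.γ * τ) := by positivity
  have hτ' : 0 < 1 / τ := by positivity
  refine ⟨?_, ?_, fun x hxX => ?_, fun y hyB => ?_⟩
  · rw [← hx]; exact (h.phiP.argminOn_prox h.isCompact_X.isClosed _ hs.x hτ').1
  · rw [← hy]; exact (hD.argminOn_prox (P.isClosed_dualDomain B) _ hs.y hσ).1
  · exact h.phiP.inner_argminOn_prox_le h.isCompact_X.isClosed h.convex_X _ hs.x hxX hτ' hx.symm
  · exact hD.inner_argminOn_prox_le (P.isClosed_dualDomain B) (P.convex_dualDomain B) _ hs.y hyB hσ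
      hy.symm

omit h in
-- The left side is σ_k θ_k (α_k + β_k): extrapolation uses at most the fraction cα + cβ of the
-- weighted primal distance.
theorem extrapolation_weight_le :
    a.cα * (s.σPrev / s.τPrev) + a.γ0 * a.cβ ≤ s.γ * (a.cα + a.cβ) := by
  have h1 : s.σPrev / s.τPrev ≤ s.γ := (div_le_iff₀ hs.τPrev).2 hs.σPrev_le
  have h2 := mul_le_mul_of_nonneg_left h1 ha.common.1.le
  have h3 := mul_le_mul_of_nonneg_right hs.γ0_le ha.2.1.le
  linarith

/-- Only the current dual point must lie in the ball: `Lxx` is used there, and `Lxy` extends to the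
whole dual domain by scaling. -/
theorem acceptsBelow_xy {R Lxx Lxy : ℝ} (hR : 0 < R) (hxx : 0 < Lxx) (hxy : 0 < Lxy)
    (hLxx : ∀ x ∈ P.X, ∀ x' ∈ P.X, ∀ y ∈ P.dualDomain (ENNReal.ofReal R),
      ‖P.gradX x' y - P.gradX x y‖ ≤ Lxx * ‖x' - x‖)
    (hLxy : ∀ x ∈ P.X, ∀ y ∈ P.dualDomain (ENNReal.ofReal R),
      ∀ y' ∈ P.dualDomain (ENNReal.ofReal R), ‖P.gradX x y' - P.gradX x y‖ ≤ Lxy * ‖y' - y‖)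
    (hsR : ‖s.y‖ ≤ R) :
    AcceptsBelow P φ B a .xy s (psiXY a Lxx Lxy) := by
  intro τ hτ hτΨ
  obtain ⟨hq1, hq2⟩ := psiXY_sq_le ha hxx hxy
  have hw := extrapolation_weight_le ha hs
  obtain ⟨⟨x', y'⟩, hc⟩ : ∃ c, candidate P φ B .xy s τ = c := ⟨_, rfl⟩
  obtain ⟨hx', hy', -, -⟩ := candidate_xy h ha hs hτ hc
  obtain ⟨hcα, hcβ, hδ, hsum, hη, hη1, hτbar, hγ0, hcnm⟩ := ha
  have hγ : 0 < s.γ := hγ0.trans_le hs.γ0_le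
  simp only [Accepts, testFunction, hc]
  set σ := s.γ * τ with hσ
  have hσ0 : 0 < σ := mul_pos hγ hτ
  set Dp := bregman φ.phiP x' s.x
  set Dd := bregman φ.phiD y' s.y
  have hDp : 1 / 2 * ‖x' - s.x‖ ^ 2 ≤ Dp := h.phiP.half_norm_sq_le_bregman x' hs.x
  have hDd : 1 / 2 * ‖y' - s.y‖ ^ 2 ≤ Dd := (h.phiD_dualDomain B).half_norm_sq_le_bregman y' hs.y
  have hDd0 : 0 ≤ Dd := (h.phiD_dualDomain B).bregman_nonneg y' hs.y
  have hDp0 : 0 ≤ Dp := h.phiP.bregman_nonneg x' hs.x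
  have h1 : ‖P.gradX x' y' - P.gradX x' s.y‖ ^ 2 ≤ Lxy ^ 2 * (2 * Dd) := by
    have := pow_le_pow_left₀ (norm_nonneg _) (lipschitz_gradX_dual_of_ball h.smooth hR hLxy hx'
      (Regular.mem_top hs.y) (Regular.mem_top hy')) 2
    rw [mul_pow] at this
    nlinarith [sq_nonneg Lxy]
  have h2 : ‖P.gradX x' s.y - P.gradX s.x s.y‖ ^ 2 ≤ Lxx ^ 2 * (2 * Dp) := by
    have := pow_le_pow_left₀ (norm_nonneg _) (hLxx s.x hs.x x' hx' s.y
      ((P.mem_dualDomain_ofReal hR.le).2 ⟨Regular.mem_top hs.y, hsR⟩)) 2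
    rw [mul_pow] at this
    nlinarith [sq_nonneg Lxx]
  have h3 : 1 / (2 * (a.cα / τ)) * ‖P.gradX x' y' - P.gradX x' s.y‖ ^ 2
      ≤ (1 - a.δ) / σ * Dd := by
    have e : 1 / (2 * (a.cα / τ)) = τ / (2 * a.cα) := by field_simp
    rw [e]
    refine (mul_le_mul_of_nonneg_left h1 (by positivity)).trans ?_
    have e2 : τ / (2 * a.cα) * (Lxy ^ 2 * (2 * Dd)) = τ * (Lxy ^ 2 / a.cα) * Dd := by field_simp
    rw [e2]
    refine mul_le_mul_of_nonneg_right ?_ hDd0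
    rw [le_div_iff₀ hσ0]
    have := mul_le_mul_of_nonneg_right hτΨ (by positivity : 0 ≤ Lxy ^ 2 / a.cα)
    refine le_trans (le_of_eq ?_) (this.trans hq1)
    rw [hσ]; ring
  have h4 : 1 / (2 * (a.γ0 * (a.cβ / σ))) * ‖P.gradX x' s.y - P.gradX s.x s.y‖ ^ 2
      ≤ (1 - (a.cα + a.cβ + a.δ)) / τ * Dp := by
    have e : 1 / (2 * (a.γ0 * (a.cβ / σ))) = σ / (2 * (a.γ0 * a.cβ)) := by field_simp
    rw [e]
    refine (mul_le_mul_of_nonneg_left h2 (by positivity)).trans ?_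
    have e2 : σ / (2 * (a.γ0 * a.cβ)) * (Lxx ^ 2 * (2 * Dp))
        = σ / a.γ0 * (Lxx ^ 2 / a.cβ) * Dp := by field_simp
    rw [e2]
    refine mul_le_mul_of_nonneg_right ?_ hDp0
    rw [le_div_iff₀ hτ]
    refine le_trans ?_ hq2
    have e3 : σ / a.γ0 * (Lxx ^ 2 / a.cβ) * τ = s.γ * τ ^ 2 / a.γ0 * (Lxx ^ 2 / a.cβ) := by
      rw [hσ]; ring
    rw [e3]
    refine mul_le_mul_of_nonneg_right ?_ (by positivity)
    rw [div_le_iff₀ hγ0]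
    linarith
  have h5 : s.σPrev / σ * (a.cα / s.τPrev + a.γ0 * (a.cβ / s.σPrev)) * Dp
      ≤ (a.cα + a.cβ) / τ * Dp := by
    refine mul_le_mul_of_nonneg_right ?_ hDp0
    have e : s.σPrev / σ * (a.cα / s.τPrev + a.γ0 * (a.cβ / s.σPrev))
        = (a.cα * (s.σPrev / s.τPrev) + a.γ0 * a.cβ) / σ := by
      have := hs.σPrev.ne'
      have := hs.τPrev.ne'
      field_simp
    rw [e, div_le_div_iff₀ hσ0 hτ, hσ]
    have := mul_le_mul_of_nonneg_right hw hτ.le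
    linarith
  have e6 : (1 - a.δ) / σ * Dd = 1 / σ * Dd - a.δ / σ * Dd := by ring
  have e7 : (1 - (a.cα + a.cβ + a.δ)) / τ * Dp = 1 / τ * Dp - (a.cα + a.cβ) / τ * Dp
    - a.δ / τ * Dp := by ring
  linarith

omit ha hs in
-- Strong convexity is measured by the norm and the Lyapunov functions by D_p. These agree for the
-- Euclidean φ_p required when `P.mu` is positive, and otherwise both sides vanish.
theorem mu_mul_half_norm_sq (x x' : PrimalSpace n) :
    P.mu * (1 / 2 * ‖x - x'‖ ^ 2) = P.mu * bregman φ.phiP x x' := by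
  rcases h.mu_nonneg.eq_or_lt with h0 | hpos
  · rw [← h0, zero_mul, zero_mul]
  · rw [h.phiP_eq hpos, bregman_half_norm_sq]

omit h in
-- The gradient increment is split at the mixed point (x^k, y^{k-1}), and Young's inequality is
-- applied with weights σ_{k-1} α_k and σ_{k-1} β_k.
theorem neg_inner_gradX_le (v : PrimalSpace n) :
    -(s.σPrev * inner ℝ (P.gradX s.x s.y - P.gradX s.xPrev s.yPrev) v) ≤
      (a.cα * (s.σPrev / s.τPrev) + a.γ0 * a.cβ) / 2 * ‖v‖ ^ 2 +
      (s.σPrev * s.τPrev / (2 * a.cα) * ‖P.gradX s.x s.y - P.gradX s.x s.yPrev‖ ^ 2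
      + s.σPrev ^ 2 / (2 * (a.γ0 * a.cβ)) * ‖P.gradX s.x s.yPrev - P.gradX s.xPrev s.yPrev‖ ^ 2) := by
  obtain ⟨hcα, hcβ, hδ, hsum, hη, hη1, hτbar, hγ0, hcnm⟩ := ha
  have hσ := hs.σPrev
  have hτ := hs.τPrev
  have h1 := neg_inner_le_young (P.gradX s.x s.y - P.gradX s.x s.yPrev) v (s := s.σPrev)
    (by positivity : 0 < a.cα * (s.σPrev / s.τPrev))
  have h2 := neg_inner_le_young (P.gradX s.x s.yPrev - P.gradX s.xPrev s.yPrev) v (s := s.σPrev)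
    (by positivity : 0 < a.γ0 * a.cβ)
  have e : inner ℝ (P.gradX s.x s.y - P.gradX s.xPrev s.yPrev) v
      = inner ℝ (P.gradX s.x s.y - P.gradX s.x s.yPrev) v
        + inner ℝ (P.gradX s.x s.yPrev - P.gradX s.xPrev s.yPrev) v := by
    rw [← inner_add_left, sub_add_sub_cancel]
  have e2 : s.σPrev ^ 2 / (2 * (a.cα * (s.σPrev / s.τPrev))) = s.σPrev * s.τPrev / (2 * a.cα) := by
    field_simp
  rw [e2] at h1
  rw [e]
  linarith

theorem le_primalDualEnergy (x : PrimalSpace n) (y : DualSpace p m) :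
    s.γ * (1 - (a.cα + a.cβ)) * bregman φ.phiP x s.x + bregman φ.phiD y s.y
      ≤ primalDualEnergy P φ a s x y := by
  have h1 := neg_inner_gradX_le ha hs (x - s.x)
  rw [← neg_sub s.x x, inner_neg_right, norm_neg, norm_sub_rev] at h1
  have h2 := h.phiP.half_norm_sq_le_bregman x hs.x
  have hw := extrapolation_weight_le ha hs
  have hD0 := h.phiP.bregman_nonneg x hs.x
  have hσ := hs.σPrev
  have hτ := hs.τPrev
  have hw0 : 0 ≤ a.cα * (s.σPrev / s.τPrev) + a.γ0 * a.cβ := by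
    have := ha.common.1
    have := ha.2.1
    have := ha.common.2.2.2.2.2.1
    positivity
  have h3 := mul_le_mul_of_nonneg_left h2 hw0
  have h4 := mul_le_mul_of_nonneg_right hw hD0
  unfold primalDualEnergy
  linarith

/-- Convexity is used at the new point, so `P.mu` acts on the new distance and produces exactly
γ_{k+1} = γ_k (1 + μ τ_k). The energies telescope without loss. -/
theorem step_xy_le (hacc : Accepts P φ B a .xy s (acceptedStep P φ B a .xy s))
    {x : PrimalSpace n} {y : DualSpace p m} (hx : x ∈ P.X) (hy : y ∈ P.dualDomain B)
    {s' : ApdbState n p m} (hs' : s' = step P φ B a .xy s) :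
    s'.σPrev * (P.coupling s'.x y - P.coupling x s'.y) + primalDualEnergy P φ a s' x y
      ≤ primalDualEnergy P φ a s x y := by
  have hτ := acceptedStep_pos (φ := φ) ha hs
  have hx'e : s'.x = (candidate P φ B .xy s (acceptedStep P φ B a .xy s)).1 := by rw [hs']; rfl
  have hy'e : s'.y = (candidate P φ B .xy s (acceptedStep P φ B a .xy s)).2 := by rw [hs']; rfl
  have hσ'e : s'.σPrev = s.γ * acceptedStep P φ B a .xy s := by rw [hs']; rfl
  have hτ'e : s'.τPrev = acceptedStep P φ B a .xy s := by rw [hs']; rfl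
  have hγ'e : s'.γ = s.γ * (1 + P.mu * acceptedStep P φ B a .xy s) := by rw [hs']; rfl
  have hxpe : s'.xPrev = s.x := by rw [hs']; rfl
  have hype : s'.yPrev = s.y := by rw [hs']; rfl
  set τ := acceptedStep P φ B a .xy s
  obtain ⟨⟨x', y'⟩, hc⟩ : ∃ c, candidate P φ B .xy s τ = c := ⟨_, rfl⟩
  obtain ⟨hx', hy', hoptx, hopty⟩ := candidate_xy h ha hs hτ hc
  simp only [Accepts, testFunction, hc] at hacc
  rw [hc] at hx'e hy'e
  have hoptx := hoptx x hx
  have hopty := hopty y hy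
  have t7 := neg_inner_gradX_le ha hs (x' - s.x)
  have hw := extrapolation_weight_le ha hs
  obtain ⟨hcα, hcβ, hδ, hsum, hη, hη1, hτbar, hγ0, hcnm⟩ := ha
  have hγ : 0 < s.γ := hγ0.trans_le hs.γ0_le
  have hmu := h.mu_nonneg
  unfold primalDualEnergy
  rw [hx'e, hy'e, hxpe, hype, hσ'e, hτ'e, hγ'e]
  have hσ0 : 0 < s.γ * τ := mul_pos hγ hτ
  set σ := s.γ * τ with hσ
  have hσp := hs.σPrev
  have hτp := hs.τPrev
  have hD := h.phiD_dualDomain B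
  have hDp := h.phiP.half_norm_sq_le_bregman x' hs.x
  have hDp0 : 0 ≤ bregman φ.phiP x' s.x := h.phiP.bregman_nonneg x' hs.x
  have hDd0 : 0 ≤ bregman φ.phiD y' s.y := hD.bregman_nonneg y' hs.y
  set w := a.cα * (s.σPrev / s.τPrev) + a.γ0 * a.cβ with hwdef
  have hw0 : 0 ≤ w := by positivity
  -- The accepted test multiplied by σ, without its δ terms; σ/τ = γ, and w is the share taken by
  -- extrapolation.
  have t1 : σ * τ / (2 * a.cα) * ‖P.gradX x' y' - P.gradX x' s.y‖ ^ 2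
      + σ ^ 2 / (2 * (a.γ0 * a.cβ)) * ‖P.gradX x' s.y - P.gradX s.x s.y‖ ^ 2
      ≤ bregman φ.phiD y' s.y + (s.γ - w) * bregman φ.phiP x' s.x := by
    have e1 : 0 ≤ a.δ / τ * bregman φ.phiP x' s.x := by positivity
    have e2 : 0 ≤ a.δ / σ * bregman φ.phiD y' s.y := by positivity
    have e4 : s.σPrev / σ * (a.cα / s.τPrev + a.γ0 * (a.cβ / s.σPrev)) = w / σ := by
      rw [hwdef]
      field_simp
    rw [e4] at hacc
    have e3 : 1 / (2 * (a.cα / τ)) * ‖P.gradX x' y' - P.gradX x' s.y‖ ^ 2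
        + 1 / (2 * (a.γ0 * (a.cβ / σ))) * ‖P.gradX x' s.y - P.gradX s.x s.y‖ ^ 2
        ≤ 1 / σ * bregman φ.phiD y' s.y + (1 / τ - w / σ) * bregman φ.phiP x' s.x := by linarith
    have e5 := mul_le_mul_of_nonneg_left e3 hσ0.le
    have e6 : σ * (1 / σ * bregman φ.phiD y' s.y + (1 / τ - w / σ) * bregman φ.phiP x' s.x)
        = bregman φ.phiD y' s.y + (σ / τ - w) * bregman φ.phiP x' s.x := by field_simp
    have e7 : σ / τ = s.γ := by rw [hσ]; field_simp
    rw [e6, e7] at e5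
    refine le_trans (le_of_eq ?_) e5
    rw [mul_add]
    congr 1 <;> field_simp
  have t2 : σ * inner ℝ (P.gradX s.x s.y) (x' - x)
      + s.σPrev * inner ℝ (P.gradX s.x s.y - P.gradX s.xPrev s.yPrev) (x' - x) ≤
      s.γ * (bregman φ.phiP x s.x - bregman φ.phiP x x' - bregman φ.phiP x' s.x) := by
    rw [inner_add_left, real_inner_smul_left] at hoptx
    have := mul_le_mul_of_nonneg_left hoptx hσ0.le
    calc _ = σ * (inner ℝ (P.gradX s.x s.y) (x' - x) + s.σPrev / σ *
          inner ℝ (P.gradX s.x s.y - P.gradX s.xPrev s.yPrev) (x' - x)) := by field_simp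
      _ ≤ _ := this
      _ = _ := by rw [hσ]; field_simp
  have t3 : σ * inner ℝ (P.constr x') (y - y')
      ≤ bregman φ.phiD y s.y - bregman φ.phiD y y' - bregman φ.phiD y' s.y := by
    rw [← neg_sub y y', inner_neg_neg] at hopty
    refine (mul_le_mul_of_nonneg_left hopty hσ0.le).trans (le_of_eq ?_)
    field_simp
  have t4 := mul_le_mul_of_nonneg_left
    (coupling_add_inner_le h.smooth h.convex_X (Regular.mem_top hy') hx' hx) hσ0.le
  have t5 := coupling_sub_coupling (P := P) x' y' y
  have t5' : P.coupling x' y = P.coupling x' y' + inner ℝ (P.constr x') (y - y') := by linarith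
  have t6 : inner ℝ (P.gradX x' y') (x - x') = -inner ℝ (P.gradX x' y' - P.gradX s.x s.y) (x' - x)
      - inner ℝ (P.gradX s.x s.y) (x' - x) := by
    rw [← neg_sub x' x, inner_neg_right, inner_sub_left]; ring
  have t8 : inner ℝ (P.gradX s.x s.y - P.gradX s.xPrev s.yPrev) (x' - x)
      = inner ℝ (P.gradX s.x s.y - P.gradX s.xPrev s.yPrev) (x' - s.x)
        + inner ℝ (P.gradX s.x s.y - P.gradX s.xPrev s.yPrev) (s.x - x) := by
    rw [← inner_add_right, sub_add_sub_cancel]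
  have t10 := mul_le_mul_of_nonneg_left hDp hw0
  have t11 : σ * (P.mu / 2 * ‖x - x'‖ ^ 2) = s.γ * (P.mu * τ) * bregman φ.phiP x x' := by
    have := mu_mul_half_norm_sq h x x'
    calc _ = σ * (P.mu * (1 / 2 * ‖x - x'‖ ^ 2)) := by ring
      _ = _ := by rw [this, hσ]; ring
  rw [t5']
  rw [t8] at t2
  rw [t6] at t4
  linarith

end PrimalFirst

end Apdb

/-! ### Step size sequences -/

/-- The recursion satisfied by `γ_k` and `t_k = τ_{k-1}`, with a lower bound `κ` for
`γ_k τ_k²`. -/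
structure StepSequence (μ γ0 τbar κ cnm : ℝ) (γ t : ℕ → ℝ) : Prop where
  mu_nonneg : 0 ≤ μ
  γ0_pos : 0 < γ0
  κ_pos : 0 < κ
  cnm_eq : cnm = 0 ∨ cnm = 1
  γ_zero : γ 0 = γ0
  γ_succ : ∀ k, γ (k + 1) = γ k * (1 + μ * t (k + 1))
  t_pos : ∀ k, 0 < t k
  t_zero : t 0 = τbar
  t_one_le : t 1 ≤ t 0
  le_sq : ∀ k, κ ≤ γ k * t (k + 1) ^ 2
  sq_le : ∀ k, γ (k + 1) * t (k + 2) ^ 2 ≤ γ k * t (k + 1) ^ 2 * (1 + cnm * (t (k + 1) / t k))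

namespace StepSequence

variable {μ γ0 τbar κ cnm : ℝ} {γ t : ℕ → ℝ} (h : StepSequence μ γ0 τbar κ cnm γ t)
include h

theorem γ_pos (k : ℕ) : 0 < γ k := by
  induction k with
  | zero => rw [h.γ_zero]; exact h.γ0_pos
  | succ k ih =>
    rw [h.γ_succ]
    have := mul_nonneg h.mu_nonneg (h.t_pos (k + 1)).le
    positivity

theorem γ_le_succ (k : ℕ) : γ k ≤ γ (k + 1) := by
  rw [h.γ_succ]
  have := mul_nonneg h.mu_nonneg (h.t_pos (k + 1)).le
  nlinarith [h.γ_pos k]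

theorem γ0_le (k : ℕ) : γ0 ≤ γ k := by
  rw [← h.γ_zero]
  exact monotone_nat_of_le_succ h.γ_le_succ (Nat.zero_le k)

/-- As γ does not decrease, the square of a step grows at most by the factor 1 + cnm t_{k+1}/t_k,
which is at most 3 by induction; 4 gives the convenient ratio 2. -/
theorem t_succ_le (k : ℕ) : t (k + 1) ≤ 2 * t k := by
  induction k with
  | zero => linarith [h.t_one_le, h.t_pos 0]
  | succ k ih =>
    have h1 := h.sq_le k
    have hk := h.t_pos k
    have hk1 := h.t_pos (k + 1)
    have h2 : t (k + 1) / t k ≤ 2 := (div_le_iff₀ hk).2 ih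
    have h3 : 1 + cnm * (t (k + 1) / t k) ≤ 4 := by
      rcases h.cnm_eq with e | e <;> rw [e] <;> linarith
    have h4 : γ (k + 1) * t (k + 2) ^ 2 ≤ γ (k + 1) * (2 * t (k + 1)) ^ 2 :=
      calc _ ≤ _ := h1
        _ ≤ γ k * t (k + 1) ^ 2 * 4 :=
          mul_le_mul_of_nonneg_left h3 (mul_nonneg (h.γ_pos k).le (sq_nonneg _))
        _ = γ k * (2 * t (k + 1)) ^ 2 := by ring
        _ ≤ _ := mul_le_mul_of_nonneg_right (h.γ_le_succ k) (sq_nonneg _)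
    exact le_of_sq_le_sq (le_of_mul_le_mul_left h4 (h.γ_pos (k + 1))) (by linarith)

theorem t_le (k : ℕ) : t k ≤ 2 ^ k * τbar := by
  induction k with
  | zero => rw [h.t_zero]; simp
  | succ k ih =>
    have := h.t_succ_le k
    rw [pow_succ]
    linarith

theorem sqrt_le_σ (k : ℕ) : Real.sqrt κ * Real.sqrt (γ k) ≤ γ k * t (k + 1) := by
  have h1 := Real.sqrt_le_sqrt (h.le_sq k)
  rw [Real.sqrt_mul (h.γ_pos k).le, Real.sqrt_sq (h.t_pos _).le] at h1
  calc _ ≤ Real.sqrt (γ k) * t (k + 1) * Real.sqrt (γ k) :=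
        mul_le_mul_of_nonneg_right h1 (Real.sqrt_nonneg _)
    _ = Real.sqrt (γ k) * Real.sqrt (γ k) * t (k + 1) := by ring
    _ = _ := by rw [Real.mul_self_sqrt (h.γ_pos k).le]

theorem linear_le_sum (K : ℕ) :
    (K : ℝ) * (Real.sqrt κ * Real.sqrt γ0) ≤ ∑ k ∈ Finset.range K, γ k * t (k + 1) := by
  have : ∑ _k ∈ Finset.range K, Real.sqrt κ * Real.sqrt γ0 ≤ ∑ k ∈ Finset.range K, γ k * t (k + 1) :=
    Finset.sum_le_sum fun k _ => (mul_le_mul_of_nonneg_left (Real.sqrt_le_sqrt (h.γ0_le k))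
      (Real.sqrt_nonneg _)).trans (h.sqrt_le_σ k)
  simpa using this

theorem sum_eq (K : ℕ) : μ * ∑ k ∈ Finset.range K, γ k * t (k + 1) = γ K - γ0 := by
  induction K with
  | zero => simp [h.γ_zero]
  | succ K ih =>
    rw [Finset.sum_range_succ, mul_add, ih, h.γ_succ]
    ring

/-- From γ_{k+1} = γ_k + μ σ_k and σ_k ≥ √κ √γ_k, the sequence γ_k obeys a discrete form of γ' ≥
const √γ, so √γ_k grows linearly. -/
theorem sqrt_γ_ge (k : ℕ) :
    min (Real.sqrt γ0) (μ * Real.sqrt κ / 3) * (k + 1) ≤ Real.sqrt (γ k) := by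
  set c := min (Real.sqrt γ0) (μ * Real.sqrt κ / 3)
  have hc1 : c ≤ Real.sqrt γ0 := min_le_left _ _
  have hc2 : c ≤ μ * Real.sqrt κ / 3 := min_le_right _ _
  have hc0 : 0 ≤ c := le_min (Real.sqrt_nonneg _)
    (by have := h.mu_nonneg; positivity)
  induction k with
  | zero => rw [h.γ_zero]; simpa using hc1
  | succ k ih =>
    have h1 := h.sqrt_le_σ k
    -- (√γ + c)² ≤ γ + 3c√γ because c ≤ √γ; this is the 3 in the definition of c.
    have h2 : Real.sqrt (γ k) + c ≤ Real.sqrt (γ (k + 1)) := by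
      apply Real.le_sqrt_of_sq_le
      have h3 : γ (k + 1) = γ k + μ * (γ k * t (k + 1)) := by rw [h.γ_succ]; ring
      have h4 := mul_le_mul_of_nonneg_left h1 h.mu_nonneg
      have h5 := Real.sq_sqrt (h.γ_pos k).le
      have h6 : Real.sqrt γ0 ≤ Real.sqrt (γ k) := Real.sqrt_le_sqrt (h.γ0_le k)
      have h7 := mul_le_mul_of_nonneg_right hc2 (Real.sqrt_nonneg (γ k))
      have h8 : c * c ≤ c * Real.sqrt (γ k) := mul_le_mul_of_nonneg_left (hc1.trans h6) hc0
      nlinarith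
    push_cast
    linarith

theorem quadratic_le_sum (K : ℕ) :
    Real.sqrt κ * min (Real.sqrt γ0) (μ * Real.sqrt κ / 3) / 2 * (K : ℝ) ^ 2
      ≤ ∑ k ∈ Finset.range K, γ k * t (k + 1) := by
  set c := min (Real.sqrt γ0) (μ * Real.sqrt κ / 3) with hc
  have hc0 : 0 ≤ c := le_min (Real.sqrt_nonneg _)
    (by have := h.mu_nonneg; positivity)
  induction K with
  | zero => simp
  | succ K ih =>
    rw [Finset.sum_range_succ]
    have h1 := h.sqrt_le_σ K
    have h2 := mul_le_mul_of_nonneg_left (h.sqrt_γ_ge K) (Real.sqrt_nonneg κ)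
    rw [← hc] at h2
    have h3 : 0 ≤ Real.sqrt κ * c := mul_nonneg (Real.sqrt_nonneg _) hc0
    push_cast
    nlinarith

/-! The factor `e_k` by which the weight `γ_{k+1} (1 - μ τ_{k+1})` exceeds `γ_k`, and the product of
these factors. -/

omit h in
/-- The factor `max 1 (γ_{k+1} (1 - μ τ_{k+1}) / γ_k)`. -/
noncomputable def lossFactor (μ : ℝ) (γ t : ℕ → ℝ) (k : ℕ) : ℝ :=
  max 1 (γ (k + 1) * (1 - μ * t (k + 2)) / γ k)

omit h in
/-- The product of the first `k` loss factors. -/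
noncomputable def lossProd (μ : ℝ) (γ t : ℕ → ℝ) (k : ℕ) : ℝ :=
  ∏ j ∈ Finset.range k, lossFactor μ γ t j

omit h in
theorem one_le_lossFactor (k : ℕ) : 1 ≤ lossFactor μ γ t k := le_max_left _ _

omit h in
theorem lossProd_succ (k : ℕ) :
    lossProd μ γ t (k + 1) = lossProd μ γ t k * lossFactor μ γ t k :=
  Finset.prod_range_succ _ _

omit h in
theorem one_le_lossProd (k : ℕ) : 1 ≤ lossProd μ γ t k := by
  induction k with
  | zero => simp [lossProd]
  | succ k ih => rw [lossProd_succ]; exact one_le_mul_of_one_le_of_one_le ih (one_le_lossFactor k)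

omit h in
theorem lossProd_mono : Monotone (lossProd μ γ t) :=
  monotone_nat_of_le_succ fun k => by
    rw [lossProd_succ]
    exact le_mul_of_one_le_right (zero_le_one.trans (one_le_lossProd k)) (one_le_lossFactor k)

theorem le_lossFactor_mul (k : ℕ) :
    γ (k + 1) * (1 - μ * t (k + 2)) ≤ lossFactor μ γ t k * γ k :=
  (div_le_iff₀ (h.γ_pos k)).1 (le_max_right _ _)

/-- Write A = μ t_{k+1} and B = μ t_{k+2}. If the factor is 1, the claim is B ≤ 2A; otherwise it
reduces to (1 - B)(1 + B/2) ≤ 1. -/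
theorem lossFactor_le (k : ℕ) :
    lossFactor μ γ t k * (1 + μ * t (k + 2) / 2) ≤ 1 + μ * t (k + 1) := by
  have h1 := mul_nonneg h.mu_nonneg (h.t_pos (k + 1)).le
  have h2 := mul_nonneg h.mu_nonneg (h.t_pos (k + 2)).le
  have h3 := mul_le_mul_of_nonneg_left (h.t_succ_le (k + 1)) h.mu_nonneg
  have hd : 0 < 1 + μ * t (k + 2) / 2 := by linarith
  rw [← le_div_iff₀ hd]
  refine max_le ?_ ?_
  · rw [le_div_iff₀ hd]
    linarith
  · rw [h.γ_succ, mul_assoc, mul_div_cancel_left₀ _ (h.γ_pos k).ne', le_div_iff₀ hd]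
    nlinarith [mul_nonneg h1 h2, mul_nonneg h1 (sq_nonneg (μ * t (k + 2)))]

/-- The factors 1 + μ t/2 telescope, so each step multiplies the invariant by at most (1 + A)/(1 +
A/2) with A = μ t_{k+1}. Its square is at most 1 + A = γ_{k+1}/γ_k. Hence the loss is O(√γ_k). -/
theorem lossProd_sq_le (k : ℕ) :
    lossProd μ γ t k ^ 2 * γ0 ≤ (1 + μ * τbar / 2) ^ 2 * γ k := by
  have key : ∀ k, (lossProd μ γ t k * (1 + μ * t (k + 1) / 2)) ^ 2 * γ0
      ≤ (1 + μ * τbar / 2) ^ 2 * γ k := by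
    intro k
    induction k with
    | zero =>
      rw [h.γ_zero]
      refine mul_le_mul_of_nonneg_right ?_ h.γ0_pos.le
      simp only [lossProd, Finset.range_zero, Finset.prod_empty, one_mul]
      have h1 := mul_nonneg h.mu_nonneg (h.t_pos 1).le
      have h2 := mul_le_mul_of_nonneg_left h.t_one_le h.mu_nonneg
      rw [h.t_zero] at h2
      exact pow_le_pow_left₀ (by simpa using by linarith) (by simpa using by linarith) 2
    | succ k ih =>
      have h1 := h.lossFactor_le k
      have hμ := mul_nonneg h.mu_nonneg (h.t_pos (k + 1)).le
      have hμ' := mul_nonneg h.mu_nonneg (h.t_pos (k + 2)).le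
      have hU := zero_le_one.trans (one_le_lossProd (μ := μ) (γ := γ) (t := t) k)
      have he := zero_le_one.trans (one_le_lossFactor (μ := μ) (γ := γ) (t := t) k)
      have h2 : (lossFactor μ γ t k * (1 + μ * t (k + 2) / 2)) ^ 2 ≤
          (1 + μ * t (k + 1) / 2) ^ 2 * (1 + μ * t (k + 1)) := by
        refine (pow_le_pow_left₀ (mul_nonneg he (by linarith)) h1 2).trans ?_
        nlinarith [mul_nonneg hμ hμ, mul_nonneg hμ (mul_nonneg hμ hμ)]
      calc (lossProd μ γ t (k + 1) * (1 + μ * t (k + 1 + 1) / 2)) ^ 2 * γ0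
          = lossProd μ γ t k ^ 2 * γ0 * (lossFactor μ γ t k * (1 + μ * t (k + 2) / 2)) ^ 2 := by
            rw [lossProd_succ]; ring
        _ ≤ lossProd μ γ t k ^ 2 * γ0 * ((1 + μ * t (k + 1) / 2) ^ 2 * (1 + μ * t (k + 1))) :=
            mul_le_mul_of_nonneg_left h2 (mul_nonneg (sq_nonneg _) h.γ0_pos.le)
        _ = (lossProd μ γ t k * (1 + μ * t (k + 1) / 2)) ^ 2 * γ0 * (1 + μ * t (k + 1)) := by ring
        _ ≤ (1 + μ * τbar / 2) ^ 2 * γ k * (1 + μ * t (k + 1)) :=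
            mul_le_mul_of_nonneg_right ih (by linarith)
        _ = _ := by rw [h.γ_succ]; ring
  refine le_trans (mul_le_mul_of_nonneg_right ?_ h.γ0_pos.le) (key k)
  have hμ := mul_nonneg h.mu_nonneg (h.t_pos (k + 1)).le
  have hU := zero_le_one.trans (one_le_lossProd (μ := μ) (γ := γ) (t := t) k)
  exact pow_le_pow_left₀ hU (le_mul_of_one_le_right hU (by linarith)) 2

theorem γ_le (k : ℕ) : γ k ≤ γ0 * ∏ j ∈ Finset.range k, (1 + μ * (2 ^ (j + 1) * τbar)) := by
  induction k with
  | zero => simp [h.γ_zero]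
  | succ k ih =>
    rw [h.γ_succ, Finset.prod_range_succ, ← mul_assoc]
    have h1 := mul_le_mul_of_nonneg_left (h.t_le (k + 1)) h.mu_nonneg
    have h2 := mul_nonneg h.mu_nonneg (h.t_pos (k + 1)).le
    exact mul_le_mul ih (by linarith) (by linarith) ((h.γ_pos k).le.trans ih)

/-- Loss arises only when backtracking lowers γ τ²: if r² is the ratio of successive values and A =
μ t_{k+1}, then √(1 + A) μ t_{k+2} = A r, so (1 + A)(1 - μ t_{k+2}) ≤ 1 + A(1 - r). -/
theorem lossFactor_le_of_cnm_eq_zero (h0 : cnm = 0) (k : ℕ) :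
    lossFactor μ γ t k ≤ 1 + μ * t (k + 1) *
      (1 - Real.sqrt (γ (k + 1) * t (k + 2) ^ 2 / (γ k * t (k + 1) ^ 2))) := by
  have hμ := mul_nonneg h.mu_nonneg (h.t_pos (k + 1)).le
  have hsq := h.sq_le k
  rw [h0, zero_mul, add_zero, mul_one] at hsq
  have hω : 0 < γ k * t (k + 1) ^ 2 := mul_pos (h.γ_pos k) (pow_pos (h.t_pos _) 2)
  set A := μ * t (k + 1)
  set r := Real.sqrt (γ (k + 1) * t (k + 2) ^ 2 / (γ k * t (k + 1) ^ 2)) with hr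
  have hr1 : r ≤ 1 := by
    rw [hr]
    apply Real.sqrt_le_one.2
    exact div_le_one_of_le₀ hsq hω.le
  have hr0 : 0 ≤ r := Real.sqrt_nonneg _
  refine max_le ?_ ?_
  · nlinarith [mul_nonneg hμ (sub_nonneg.2 hr1)]
  · rw [h.γ_succ, mul_assoc, mul_div_cancel_left₀ _ (h.γ_pos k).ne']
    have e : r = Real.sqrt (1 + A) * t (k + 2) / t (k + 1) := by
      rw [hr, h.γ_succ]
      have e1 : γ k * (1 + A) * t (k + 2) ^ 2 / (γ k * t (k + 1) ^ 2)
          = (1 + A) * (t (k + 2) / t (k + 1)) ^ 2 := by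
        have := (h.γ_pos k).ne'
        have := (h.t_pos (k + 1)).ne'
        field_simp
      rw [e1, Real.sqrt_mul (by linarith), Real.sqrt_sq (div_nonneg (h.t_pos _).le (h.t_pos _).le),
        mul_div_assoc]
    have e2 : A * r = Real.sqrt (1 + A) * (μ * t (k + 2)) := by
      rw [e]
      have := (h.t_pos (k + 1)).ne'
      change μ * t (k + 1) * _ = _
      field_simp
    have h3 : Real.sqrt (1 + A) ≤ 1 + A := Real.sqrt_le_iff.2 ⟨by linarith, by nlinarith⟩
    have h4 := mul_le_mul_of_nonneg_right h3 (mul_nonneg h.mu_nonneg (h.t_pos (k + 2)).le)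
    nlinarith

theorem t_le_τbar_of_cnm_eq_zero (h0 : cnm = 0) (k : ℕ) : t k ≤ τbar := by
  have hstep : ∀ k, t (k + 1) ≤ t k := fun k => by
    cases k with
    | zero => exact h.t_one_le
    | succ k =>
      have hsq := h.sq_le k
      rw [h0, zero_mul, add_zero, mul_one] at hsq
      have h1 : γ (k + 1) * t (k + 2) ^ 2 ≤ γ (k + 1) * t (k + 1) ^ 2 :=
        hsq.trans (mul_le_mul_of_nonneg_right (h.γ_le_succ k) (sq_nonneg _))
      exact le_of_sq_le_sq (le_of_mul_le_mul_left h1 (h.γ_pos _)) (h.t_pos _).le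
  rw [← h.t_zero]
  exact antitone_nat_of_succ_le hstep (Nat.zero_le k)

/-- Here γ τ² is nonincreasing and at least κ. Bounding 1 - r by -log r makes the logarithms of the
factors telescope, so the product is bounded uniformly in k. -/
theorem lossProd_le_of_cnm_eq_zero (h0 : cnm = 0) (k : ℕ) :
    lossProd μ γ t k ≤ Real.exp (μ * τbar / 2 * (Real.log (γ0 * τbar ^ 2) - Real.log κ)) := by
  have hτ : 0 < τbar := h.t_zero ▸ h.t_pos 0
  have hω : ∀ k, 0 < γ k * t (k + 1) ^ 2 := fun k => mul_pos (h.γ_pos k) (pow_pos (h.t_pos _) 2)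
  have hμτ : 0 ≤ μ * τbar / 2 := by have := h.mu_nonneg; positivity
  have key : ∀ k, lossProd μ γ t k ≤ Real.exp (μ * τbar / 2 *
      (Real.log (γ 0 * t 1 ^ 2) - Real.log (γ k * t (k + 1) ^ 2))) := by
    intro k
    induction k with
    | zero => simp [lossProd]
    | succ k ih =>
      rw [lossProd_succ]
      set r := Real.sqrt (γ (k + 1) * t (k + 2) ^ 2 / (γ k * t (k + 1) ^ 2)) with hr
      have hr0 : 0 < r := Real.sqrt_pos.2 (div_pos (hω (k + 1)) (hω k))
      have hlog : Real.log r = (Real.log (γ (k + 1) * t (k + 2) ^ 2)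
          - Real.log (γ k * t (k + 1) ^ 2)) / 2 := by
        rw [hr, Real.log_sqrt (div_pos (hω (k + 1)) (hω k)).le,
          Real.log_div (hω (k + 1)).ne' (hω k).ne']
      have hr1 : r ≤ 1 := by
        have hsq := h.sq_le k
        rw [h0, zero_mul, add_zero, mul_one] at hsq
        rw [hr]
        apply Real.sqrt_le_one.2
        exact div_le_one_of_le₀ hsq (hω k).le
      have h1 : lossFactor μ γ t k ≤ Real.exp (μ * τbar * (-Real.log r)) := by
        have h2 := Real.log_le_sub_one_of_pos hr0
        have h3 := mul_le_mul_of_nonneg_left (h.t_le_τbar_of_cnm_eq_zero h0 (k + 1)) h.mu_nonneg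
        have h4 : μ * t (k + 1) * (1 - r) ≤ μ * τbar * (-Real.log r) :=
          mul_le_mul h3 (by linarith) (by linarith) (by linarith)
        have h5 := Real.add_one_le_exp (μ * τbar * (-Real.log r))
        have h6 := h.lossFactor_le_of_cnm_eq_zero h0 k
        rw [← hr] at h6
        linarith
      have hU := zero_le_one.trans (one_le_lossProd (μ := μ) (γ := γ) (t := t) k)
      refine (mul_le_mul ih h1 (zero_le_one.trans (one_le_lossFactor k)) (Real.exp_pos _).le).trans
        (le_of_eq ?_)
      rw [← Real.exp_add, hlog]
      congr 1
      ring
  refine (key k).trans (Real.exp_le_exp.2 (mul_le_mul_of_nonneg_left (sub_le_sub ?_ ?_) hμτ))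
  · refine Real.log_le_log (hω 0) ?_
    rw [h.γ_zero]
    refine mul_le_mul_of_nonneg_left (pow_le_pow_left₀ (h.t_pos 1).le ?_ 2) h.γ0_pos.le
    rw [← h.t_zero]; exact h.t_one_le
  · exact Real.log_le_log h.κ_pos (h.le_sq k)

end StepSequence

namespace Apdb

open ConicProgram

variable {n p m : ℕ} {P : ConicProgram n p m} {φ : BregmanPair n p m} {B : ENNReal}
  {a : StepParams} {Lφ : ℝ}

/-! ### Runs of the base method -/

theorem valid_init {o : UpdateOrder} (ha : a.Admissible o) {z : PDSpace n p m}
    (hz : z ∈ P.domain B) : Valid P B a (init a z) := by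
  obtain ⟨-, -, -, -, hτ, hγ, -⟩ := ha.common
  exact ⟨hz.1, hz.2, hτ, mul_pos hγ hτ, le_rfl, le_rfl, hτ⟩

theorem valid_step (h : P.Regular φ Lφ) {o : UpdateOrder} (ha : a.Admissible o)
    {s : ApdbState n p m} (hs : Valid P B a s) : Valid P B a (step P φ B a o s) := by
  have hτ := acceptedStep_pos (φ := φ) ha hs
  have hγ : 0 < s.γ := ha.common.2.2.2.2.2.1.trans_le hs.γ0_le
  have hmem : (candidate P φ B o s (acceptedStep P φ B a o s)).1 ∈ P.X ∧
      (candidate P φ B o s (acceptedStep P φ B a o s)).2 ∈ P.dualDomain B := by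
    cases o
    · have := candidate_xy h ha hs hτ (x' := _) (y' := _) rfl
      exact ⟨this.1, this.2.1⟩
    · have := candidate_yx h ha hs hτ (x' := _) (y' := _) rfl
      exact ⟨this.1, this.2.1⟩
  have hμτ := mul_nonneg h.mu_nonneg hτ.le
  have hγ' : s.γ ≤ s.γ * (1 + P.mu * acceptedStep P φ B a o s) := by nlinarith
  have hcnm : 0 ≤ a.cnm := by
    rcases ha.common.2.2.2.2.2.2 with e | e <;> norm_num [e]
  refine ⟨hmem.1, hmem.2, hτ, mul_pos hγ hτ, ?_, hs.γ0_le.trans hγ', ?_⟩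
  · exact mul_le_mul_of_nonneg_right hγ' hτ.le
  · refine mul_pos hτ (Real.sqrt_pos.2 ?_)
    have h1 : 0 ≤ a.cnm * (acceptedStep P φ B a o s / s.τPrev) :=
      mul_nonneg hcnm (div_pos hτ hs.τPrev).le
    exact mul_pos (div_pos hγ (hγ.trans_le hγ')) (by linarith)

theorem state_succ (o : UpdateOrder) (z : PDSpace n p m) (k : ℕ) :
    state P φ B a o z (k + 1) = step P φ B a o (state P φ B a o z k) :=
  Function.iterate_succ_apply' _ _ _

theorem valid_state (h : P.Regular φ Lφ) {o : UpdateOrder} (ha : a.Admissible o)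
    {z : PDSpace n p m} (hz : z ∈ P.domain B) (k : ℕ) : Valid P B a (state P φ B a o z k) := by
  induction k with
  | zero => exact valid_init ha hz
  | succ k ih => rw [state_succ]; exact valid_step h ha ih

/-- The `k`-th iterate. -/
noncomputable def iterate (P : ConicProgram n p m) (φ : BregmanPair n p m) (B : ENNReal)
    (a : StepParams) (o : UpdateOrder) (z : PDSpace n p m) (k : ℕ) : PDSpace n p m :=
  mkPD (state P φ B a o z k).x (state P φ B a o z k).y

theorem iterate_mem (h : P.Regular φ Lφ) {o : UpdateOrder} (ha : a.Admissible o)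
    {z : PDSpace n p m} (hz : z ∈ P.domain B) (k : ℕ) : iterate P φ B a o z k ∈ P.domain B :=
  ⟨(valid_state h ha hz k).x, (valid_state h ha hz k).y⟩

theorem sigma_pos (h : P.Regular φ Lφ) {o : UpdateOrder} (ha : a.Admissible o)
    {z : PDSpace n p m} (hz : z ∈ P.domain B) (k : ℕ) : 0 < sigma P φ B a o z k :=
  (valid_state h ha hz (k + 1)).σPrev

theorem sigma_eq (o : UpdateOrder) (z : PDSpace n p m) (k : ℕ) :
    sigma P φ B a o z k =
      (state P φ B a o z k).γ * (state P φ B a o z (k + 1)).τPrev := by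
  rw [sigma, state_succ]
  rfl

theorem tauHat_pos (ha : a.Admissible o) {Ψ : ℝ} (hΨ : 0 < Ψ) : 0 < tauHat a Ψ :=
  lt_min ha.common.2.2.2.2.1 (mul_pos ha.common.2.2.1 hΨ)

theorem stepSequence (h : P.Regular φ Lφ) {o : UpdateOrder} (ha : a.Admissible o)
    {z : PDSpace n p m} (hz : z ∈ P.domain B) {Ψ : ℝ} (hΨ : 0 < Ψ)
    (hacc : ∀ k, AcceptsBelow P φ B a o (state P φ B a o z k) Ψ) :
    StepSequence P.mu a.γ0 a.τbar (a.γ0 * tauHat a Ψ ^ 2) a.cnm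
      (fun k => (state P φ B a o z k).γ) (fun k => (state P φ B a o z k).τPrev) := by
  have hv := valid_state h ha hz
  have hτhat := tauHat_pos ha hΨ
  obtain ⟨-, -, hη, hη1, hτbar, hγ0, hcnm⟩ := ha.common
  have hcnm0 : 0 ≤ a.cnm := by
    rcases hcnm with e | e <;> norm_num [e]
  have hγ : ∀ k, 0 < (state P φ B a o z k).γ := fun k => hγ0.trans_le (hv k).γ0_le
  -- The square root in the trial rule serves this identity: the trial value of γ τ² is never below
  -- the last accepted value, so only backtracking can decrease it.
  have htrial : ∀ k, (state P φ B a o z (k + 1)).γ * (state P φ B a o z (k + 1)).τtrial ^ 2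
      = (state P φ B a o z k).γ * (state P φ B a o z (k + 1)).τPrev ^ 2 *
        (1 + a.cnm * ((state P φ B a o z (k + 1)).τPrev / (state P φ B a o z k).τPrev)) := fun k => by
    have e : (state P φ B a o z (k + 1)).τtrial = (state P φ B a o z (k + 1)).τPrev *
        Real.sqrt ((state P φ B a o z k).γ / (state P φ B a o z (k + 1)).γ *
          (1 + a.cnm * ((state P φ B a o z (k + 1)).τPrev / (state P φ B a o z k).τPrev))) := by
      rw [state_succ]; rfl
    have h1 : 0 ≤ a.cnm * ((state P φ B a o z (k + 1)).τPrev / (state P φ B a o z k).τPrev) :=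
      mul_nonneg hcnm0 (div_pos (hv _).τPrev (hv _).τPrev).le
    rw [e, mul_pow, Real.sq_sqrt (mul_nonneg (div_pos (hγ _) (hγ _)).le (by linarith))]
    have := (hγ (k + 1)).ne'
    field_simp
  have hstep : ∀ k, (state P φ B a o z (k + 1)).τPrev
      = acceptedStep P φ B a o (state P φ B a o z k) := fun k => by rw [state_succ]; rfl
  have hκ : a.γ0 * tauHat a Ψ ^ 2 ≤ a.γ0 * (a.η * Ψ) ^ 2 :=
    mul_le_mul_of_nonneg_left (pow_le_pow_left₀ hτhat.le (min_le_right _ _) 2) hγ0.le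
  have hlow : ∀ k, a.γ0 * tauHat a Ψ ^ 2 ≤ (state P φ B a o z k).γ * (state P φ B a o z k).τtrial ^ 2 := by
    intro k
    induction k with
    | zero =>
      exact mul_le_mul_of_nonneg_left (pow_le_pow_left₀ hτhat.le (min_le_left _ _) 2) hγ0.le
    | succ k ih =>
      rw [htrial]
      have h1 := le_mul_acceptedStep_sq ha (hv k) (hacc k) ih hκ
      rw [← hstep] at h1
      have h2 : 0 ≤ a.cnm * ((state P φ B a o z (k + 1)).τPrev / (state P φ B a o z k).τPrev) :=
        mul_nonneg hcnm0 (div_pos (hv _).τPrev (hv _).τPrev).le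
      exact h1.trans (le_mul_of_one_le_right (mul_nonneg (hγ k).le (sq_nonneg _)) (by linarith))
  refine ⟨h.mu_nonneg, hγ0, by positivity, hcnm, rfl, fun k => ?_, fun k => (hv k).τPrev, rfl,
    ?_, fun k => ?_, fun k => ?_⟩
  · simp only [state_succ]; rfl
  · simp only [state_succ]
    exact acceptedStep_le (φ := φ) ha (hv 0)
  · have h1 := le_mul_acceptedStep_sq ha (hv k) (hacc k) (hlow k) hκ
    rwa [← hstep] at h1
  · rw [← htrial, hstep (k + 1)]
    exact mul_le_mul_of_nonneg_left (pow_le_pow_left₀ (acceptedStep_pos ha (hv _)).le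
      (acceptedStep_le ha (hv _)) 2) (hγ _).le

/-! ### The weighted average -/

/-- The normalization of the weights by σ_0 cancels. -/
theorem average_eq_centerMass (h : P.Regular φ Lφ) {o : UpdateOrder} (ha : a.Admissible o)
    {z : PDSpace n p m} (hz : z ∈ P.domain B) (K : ℕ) :
    average P φ B a o z K = (Finset.range K).centerMass (sigma P φ B a o z)
      (fun k => iterate P φ B a o z (k + 1)) := by
  have e : weight P φ B a o z = (sigma P φ B a o z 0)⁻¹ • sigma P φ B a o z := by
    funext k
    simp only [weight, Pi.smul_apply, smul_eq_mul]
    rw [div_eq_inv_mul]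
  have hc : (sigma P φ B a o z 0)⁻¹ ≠ 0 := inv_ne_zero (sigma_pos h ha hz 0).ne'
  rw [← Finset.centerMass_smul_left (hc := hc), ← e]
  rfl

section Average

variable (h : P.Regular φ Lφ) {o : UpdateOrder} (ha : a.Admissible o) {z : PDSpace n p m}
  (hz : z ∈ P.domain B) {K : ℕ} (hK : 1 ≤ K)
include h ha hz hK

theorem sum_sigma_pos : 0 < ∑ k ∈ Finset.range K, sigma P φ B a o z k :=
  Finset.sum_pos (fun k _ => sigma_pos h ha hz k) (Finset.nonempty_range_iff.2 (by omega))

theorem average_mem_of_convex {T : Set (PDSpace n p m)} (hT : Convex ℝ T)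
    (hmem : ∀ k < K, iterate P φ B a o z (k + 1) ∈ T) : average P φ B a o z K ∈ T := by
  rw [average_eq_centerMass h ha hz]
  exact hT.centerMass_mem (fun k _ => (sigma_pos h ha hz k).le) (sum_sigma_pos h ha hz hK)
    fun k hk => hmem k (Finset.mem_range.1 hk)

theorem average_mem : average P φ B a o z K ∈ P.domain B :=
  average_mem_of_convex h ha hz hK (convex_domain h.convex_X B) fun k _ => iterate_mem h ha hz (k + 1)

omit ha hz hK in
theorem convexOn_gap {w : PDSpace n p m} (hw : w ∈ P.domain B) :
    ConvexOn ℝ (P.domain B)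
      (fun u : PDSpace n p m => P.coupling u.fst w.snd - P.coupling w.fst u.snd) := by
  refine ⟨convex_domain h.convex_X B, fun u hu v hv c d hc hd hcd => ?_⟩
  have h1 := (convexOn_coupling h.smooth h.convex_X (Regular.mem_top hw.2)).2 hu.1 hv.1 hc hd hcd
  have h2 : P.coupling w.fst (c • u.snd + d • v.snd)
      = c * P.coupling w.fst u.snd + d * P.coupling w.fst v.snd := by
    rw [coupling_eq, coupling_eq, coupling_eq, inner_add_right, real_inner_smul_right,
      real_inner_smul_right]
    linear_combination (-hcd) * P.f w.fst
  change P.coupling (c • u.fst + d • v.fst) w.snd - P.coupling w.fst (c • u.snd + d • v.snd) ≤ _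
  rw [h2]
  simp only [smul_eq_mul] at h1 ⊢
  linarith

theorem sum_sigma_mul_gap_average_le {w : PDSpace n p m} (hw : w ∈ P.domain B) :
    (∑ k ∈ Finset.range K, sigma P φ B a o z k) *
      (P.coupling (average P φ B a o z K).fst w.snd - P.coupling w.fst (average P φ B a o z K).snd)
    ≤ ∑ k ∈ Finset.range K, sigma P φ B a o z k *
      (P.coupling (state P φ B a o z (k + 1)).x w.snd
        - P.coupling w.fst (state P φ B a o z (k + 1)).y) := by
  have hS := sum_sigma_pos h ha hz hK
  have := (convexOn_gap h hw).map_centerMass_le (t := Finset.range K) (w := sigma P φ B a o z)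
    (p := fun k => iterate P φ B a o z (k + 1)) (fun k _ => (sigma_pos h ha hz k).le)
    hS (fun k _ => iterate_mem h ha hz (k + 1))
  rw [← average_eq_centerMass h ha hz, Finset.centerMass, smul_eq_mul, inv_mul_eq_div,
    le_div_iff₀ hS] at this
  rw [mul_comm]
  exact this

theorem average_norm_sub_sq_le {w : PDSpace n p m} {C : ℝ}
    (hC : ∀ k < K, ‖iterate P φ B a o z (k + 1) - w‖ ^ 2 ≤ C) :
    ‖average P φ B a o z K - w‖ ^ 2 ≤ C := by
  have hC0 : 0 ≤ C := (sq_nonneg _).trans (hC 0 (by omega))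
  have := average_mem_of_convex h ha hz hK (convex_closedBall w (Real.sqrt C)) fun k hk => by
    rw [mem_closedBall_iff_norm]
    exact Real.le_sqrt_of_sq_le (hC k hk)
  rw [mem_closedBall_iff_norm] at this
  exact (Real.le_sqrt (norm_nonneg _) hC0).1 this

theorem average_snd_norm_sub_sq_le {y : DualSpace p m} {C : ℝ}
    (hC : ∀ k < K, ‖(state P φ B a o z (k + 1)).y - y‖ ^ 2 ≤ C) :
    ‖(average P φ B a o z K).snd - y‖ ^ 2 ≤ C := by
  have hC0 : 0 ≤ C := (sq_nonneg _).trans (hC 0 (by omega))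
  have hconv : Convex ℝ {u : PDSpace n p m | u.snd ∈ Metric.closedBall y (Real.sqrt C)} :=
    fun u hu v hv c d hc hd hcd => convex_closedBall y (Real.sqrt C) hu hv hc hd hcd
  have : (average P φ B a o z K).snd ∈ Metric.closedBall y (Real.sqrt C) :=
    average_mem_of_convex h ha hz hK hconv fun k hk => by
      change (state P φ B a o z (k + 1)).y ∈ Metric.closedBall y (Real.sqrt C)
      rw [mem_closedBall_iff_norm]
      exact Real.le_sqrt_of_sq_le (hC k hk)
  rw [mem_closedBall_iff_norm] at this
  exact (Real.le_sqrt (norm_nonneg _) hC0).1 this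

end Average

/-! ### Consequences of a bound on the gap of the average -/

/-- The initial value of the Lyapunov functions. -/
noncomputable def initialEnergy (φ : BregmanPair n p m) (a : StepParams) (w z : PDSpace n p m) : ℝ :=
  a.γ0 * bregman φ.phiP w.fst z.fst + bregman φ.phiD w.snd z.snd

theorem initialEnergy_le (h : P.Regular φ Lφ) (hγ0 : 0 < a.γ0) {w z : PDSpace n p m}
    (hw : w ∈ P.domain B) (hz : z ∈ P.domain B) :
    initialEnergy φ a w z ≤ Lφ / 2 * max a.γ0 1 * ‖w - z‖ ^ 2 := by
  have h1 := h.phiP.bregman_le h.convex_X hw.1 hz.1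
  have h2 := (h.phiD_dualDomain B).bregman_le (P.convex_dualDomain B) hw.2 hz.2
  have h3 := mul_le_mul_of_nonneg_left h1 hγ0.le
  have hL := h.pos
  have h4 : a.γ0 * (Lφ / 2 * ‖w.fst - z.fst‖ ^ 2) ≤ max a.γ0 1 * (Lφ / 2 * ‖w.fst - z.fst‖ ^ 2) :=
    mul_le_mul_of_nonneg_right (le_max_left _ _) (by positivity)
  have h5 : 1 * (Lφ / 2 * ‖w.snd - z.snd‖ ^ 2) ≤ max a.γ0 1 * (Lφ / 2 * ‖w.snd - z.snd‖ ^ 2) :=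
    mul_le_mul_of_nonneg_right (le_max_right _ _) (by positivity)
  rw [norm_sq_sub, initialEnergy]
  linarith

theorem initialEnergy_nonneg (h : P.Regular φ Lφ) (hγ0 : 0 < a.γ0) (w : PDSpace n p m)
    {z : PDSpace n p m} (hz : z ∈ P.domain B) : 0 ≤ initialEnergy φ a w z :=
  add_nonneg (mul_nonneg hγ0.le (h.phiP.bregman_nonneg _ hz.1))
    ((h.phiD_dualDomain B).bregman_nonneg _ hz.2)

theorem exists_saddle_norm_eq (h : P.Regular φ Lφ) (hne : (P.saddleSet B).Nonempty)
    (z : PDSpace n p m) :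
    ∃ zs ∈ P.saddleSet B, ‖zs - z‖ = Metric.infDist z (P.saddleSet B) := by
  obtain ⟨zs, hzs, e⟩ := (h.isClosed_saddleSet B).exists_infDist_eq_dist hne z
  exact ⟨zs, hzs, by rw [e, dist_comm, dist_eq_norm]⟩

/-- The term ‖w - z‖² is split at `zb`. The part ‖w - zb‖² is absorbed by the Bregman penalty
because ξ S is large; the rest is split at the nearest saddle point. -/
theorem gapTerm_le_of_sum_gap_le (h : P.Regular φ Lφ) (hγ0 : 0 < a.γ0)
    (hne : (P.saddleSet B).Nonempty) {z zb : PDSpace n p m} (hz : z ∈ P.domain B)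
    (hzb : zb ∈ P.domain B) {S C ξ : ℝ} (hS : 0 < S)
    (hrun : ∀ w ∈ P.domain B,
      S * (P.coupling zb.fst w.snd - P.coupling w.fst zb.snd) ≤ initialEnergy φ a w z)
    (hξ : 0 < ξ) (hSξ : Lφ * max a.γ0 1 ≤ ξ * S)
    (hC : ∀ zs ∈ P.saddleSet B, ‖zb - zs‖ ^ 2 ≤ C * ‖zs - z‖ ^ 2) {w : PDSpace n p m}
    (hw : w ∈ P.domain B) :
    P.gapTerm φ ξ zb w ≤
      2 * (Lφ * max a.γ0 1 / S) * (1 + C) * Metric.infDist z (P.saddleSet B) ^ 2 := by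
  obtain ⟨zs, hzs, e⟩ := exists_saddle_norm_eq h hne z
  rw [← e]
  have h1 := (hrun w hw).trans (initialEnergy_le h hγ0 hw hz)
  have h2 := h.phiP.half_norm_sq_le_bregman w.fst hzb.1
  have h3 := (h.phiD_dualDomain B).half_norm_sq_le_bregman w.snd hzb.2
  have h4 := sq_norm_sub_le_two_mul w zb z
  have h5 := sq_norm_sub_le_two_mul zb zs z
  have h6 := hC zs hzs
  have h7 := norm_sq_sub w zb
  have hL := h.pos
  have hmax : 0 < max a.γ0 1 := lt_max_of_lt_left hγ0
  rw [gapTerm]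
  set N := Lφ * max a.γ0 1
  have hN : 0 < N := mul_pos hL hmax
  refine le_of_mul_le_mul_left ?_ hS
  have e2 : S * (2 * (N / S) * (1 + C) * ‖zs - z‖ ^ 2) = 2 * N * ((1 + C) * ‖zs - z‖ ^ 2) := by
    field_simp
  rw [e2]
  have h8 : N / 2 * ‖w - z‖ ^ 2 ≤ N * ‖w - zb‖ ^ 2 + N * ‖zb - z‖ ^ 2 := by nlinarith
  have h9 : N * ‖w - zb‖ ^ 2 ≤ ξ * S * ‖w - zb‖ ^ 2 :=
    mul_le_mul_of_nonneg_right hSξ (sq_nonneg _)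
  have h10 : N * ‖zb - z‖ ^ 2 ≤ N * (2 * (1 + C) * ‖zs - z‖ ^ 2) :=
    mul_le_mul_of_nonneg_left (by linarith) hN.le
  have h11 : ξ * S * ‖w - zb‖ ^ 2
      ≤ S * (2 * ξ * (bregman φ.phiP w.fst zb.fst + bregman φ.phiD w.snd zb.snd)) := by
    rw [h7]
    have := mul_le_mul_of_nonneg_left (add_le_add h2 h3) (mul_pos hξ hS).le
    linarith
  linarith

/-- The two estimates are chained: G(average) ≤ D dist² ≤ D ρ G(z) ≤ q G(z). -/
theorem restartTest_of_gapTerm_le (h : P.Regular φ Lφ) {o : UpdateOrder} (ha : a.Admissible o)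
    {ξ q ρ D : ℝ} (hξ : 0 < ξ) (hq : 0 < q) {z : PDSpace n p m} (hz : z ∈ P.domain B)
    {K : ℕ} (hK : 1 ≤ K) (hgrowth : ((Metric.infDist z (P.saddleSet B) ^ 2 : ℝ) : EReal) ≤
      (ρ : EReal) * smoothedGap P φ B ξ z)
    (hgap : ∀ w ∈ P.domain B, P.gapTerm φ ξ (average P φ B a o z K) w ≤
      D * Metric.infDist z (P.saddleSet B) ^ 2) (hD : D * ρ ≤ q) :
    RestartTest P φ B a ξ q o z K := by
  obtain ⟨r, hr, e⟩ := h.exists_smoothedGap_eq hξ hz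
  rw [e, ← EReal.coe_mul, EReal.coe_le_coe_iff] at hgrowth
  rw [RestartTest, e, ← EReal.coe_mul]
  refine smoothedGap_le (average_mem h ha hz hK) fun w hw => (hgap w hw).trans ?_
  rcases le_or_gt D 0 with hD0 | hD0
  · exact (mul_nonpos_of_nonpos_of_nonneg hD0 (sq_nonneg _)).trans (by positivity)
  · calc _ ≤ D * (ρ * r) := mul_le_mul_of_nonneg_left hgrowth hD0.le
      _ = D * ρ * r := by ring
      _ ≤ q * r := mul_le_mul_of_nonneg_right hD hr

end Apdb

namespace Apdb

open ConicProgram StepSequence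

variable {n p m : ℕ} {P : ConicProgram n p m} {φ : BregmanPair n p m} {B : ENNReal}
  {a : StepParams} {Lφ : ℝ}

theorem gap_nonneg_of_saddle {zs w : PDSpace n p m} (hzs : zs ∈ P.saddleSet B)
    (hw : w ∈ P.domain B) : 0 ≤ P.coupling w.fst zs.snd - P.coupling zs.fst w.snd := by
  obtain ⟨-, h1, h2⟩ := mem_saddleSet_iff.1 hzs
  linarith [h1 w.snd hw.2, h2 w.fst hw.1]

/-! ### Runs with the primal update first -/

section PrimalFirst

variable (h : P.Regular φ Lφ) (ha : a.Admissible .xy) {z : PDSpace n p m} (hz : z ∈ P.domain B)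
include h ha hz

omit h ha hz in
theorem primalDualEnergy_init (w : PDSpace n p m) :
    primalDualEnergy P φ a (state P φ B a .xy z 0) w.fst w.snd = initialEnergy φ a w z := by
  change primalDualEnergy P φ a (init a z) w.fst w.snd = _
  simp [primalDualEnergy, init, initialEnergy]

theorem norm_iterate_sub_sq_le_of_energy {w : PDSpace n p m} {k : ℕ}
    (hE : primalDualEnergy P φ a (state P φ B a .xy z k) w.fst w.snd ≤ initialEnergy φ a w z) :
    1 / 2 * ‖w.snd - (state P φ B a .xy z k).y‖ ^ 2 ≤ initialEnergy φ a w z ∧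
    min (a.γ0 * (1 - (a.cα + a.cβ))) 1 / 2 * ‖iterate P φ B a .xy z k - w‖ ^ 2
      ≤ initialEnergy φ a w z := by
  have hv := valid_state h ha hz k
  have h1 := (le_primalDualEnergy h ha hv w.fst w.snd).trans hE
  have h2 := h.phiP.half_norm_sq_le_bregman w.fst hv.x
  have h3 := (h.phiD_dualDomain B).half_norm_sq_le_bregman w.snd hv.y
  obtain ⟨hcα, hcβ, hδ, hsum, hη, hη1, hτbar, hγ0, hcnm⟩ := ha
  have hc : 0 < 1 - (a.cα + a.cβ) := by linarith
  have hD := h.phiP.bregman_nonneg w.fst hv.x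
  have h4 : a.γ0 * (1 - (a.cα + a.cβ)) * bregman φ.phiP w.fst (state P φ B a .xy z k).x ≤
      (state P φ B a .xy z k).γ * (1 - (a.cα + a.cβ)) * bregman φ.phiP w.fst (state P φ B a .xy z k).x :=
    mul_le_mul_of_nonneg_right (mul_le_mul_of_nonneg_right hv.γ0_le hc.le) hD
  have h5 : 0 ≤ a.γ0 * (1 - (a.cα + a.cβ)) := mul_nonneg hγ0.le hc.le
  refine ⟨by linarith [mul_nonneg h5 hD], ?_⟩
  rw [norm_sub_rev, norm_sq_sub]
  change min (a.γ0 * (1 - (a.cα + a.cβ))) 1 / 2 * (‖w.fst - (state P φ B a .xy z k).x‖ ^ 2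
    + ‖w.snd - (state P φ B a .xy z k).y‖ ^ 2) ≤ _
  have h6 := mul_le_mul_of_nonneg_right (min_le_left (a.γ0 * (1 - (a.cα + a.cβ))) 1)
    (sq_nonneg ‖w.fst - (state P φ B a .xy z k).x‖)
  have h7 := mul_le_mul_of_nonneg_right (min_le_right (a.γ0 * (1 - (a.cα + a.cβ))) 1)
    (sq_nonneg ‖w.snd - (state P φ B a .xy z k).y‖)
  have h8 := mul_le_mul_of_nonneg_left h2 h5
  linarith

/-- A joint induction: the energy bound at step k puts y^k in the ball of radius `R`, there small
steps are accepted, and the accepted step carries the energy bound to step k + 1. -/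
theorem energy_xy_le_and_acceptsBelow {R Lxx Lxy : ℝ} (hR : 0 < R) (hxx : 0 < Lxx) (hxy : 0 < Lxy)
    (hLxx : ∀ x ∈ P.X, ∀ x' ∈ P.X, ∀ y ∈ P.dualDomain (ENNReal.ofReal R),
      ‖P.gradX x' y - P.gradX x y‖ ≤ Lxx * ‖x' - x‖)
    (hLxy : ∀ x ∈ P.X, ∀ y ∈ P.dualDomain (ENNReal.ofReal R),
      ∀ y' ∈ P.dualDomain (ENNReal.ofReal R), ‖P.gradX x y' - P.gradX x y‖ ≤ Lxy * ‖y' - y‖)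
    {zs : PDSpace n p m} (hzs : zs ∈ P.saddleSet B)
    (hzsR : ‖zs.snd‖ + Real.sqrt (2 * a.γ0 * bregman φ.phiP zs.fst z.fst +
      2 * bregman φ.phiD zs.snd z.snd) ≤ R) (k : ℕ) :
    primalDualEnergy P φ a (state P φ B a .xy z k) zs.fst zs.snd ≤ initialEnergy φ a zs z ∧
      AcceptsBelow P φ B a .xy (state P φ B a .xy z k) (psiXY a Lxx Lxy) := by
  have hacc : ∀ k, primalDualEnergy P φ a (state P φ B a .xy z k) zs.fst zs.snd
      ≤ initialEnergy φ a zs z → AcceptsBelow P φ B a .xy (state P φ B a .xy z k)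
        (psiXY a Lxx Lxy) := fun k hk => by
    refine acceptsBelow_xy h ha (valid_state h ha hz k) hR hxx hxy hLxx hLxy ?_
    have h1 := (norm_iterate_sub_sq_le_of_energy h ha hz hk).1
    have h2 : ‖zs.snd - (state P φ B a .xy z k).y‖ ≤ Real.sqrt (2 * a.γ0 * bregman φ.phiP zs.fst z.fst +
        2 * bregman φ.phiD zs.snd z.snd) := by
      apply Real.le_sqrt_of_sq_le
      rw [initialEnergy] at h1
      linarith
    have h3 := norm_le_norm_add_norm_sub zs.snd (state P φ B a .xy z k).y
    linarith
  suffices hE : ∀ k, primalDualEnergy P φ a (state P φ B a .xy z k) zs.fst zs.snd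
      ≤ initialEnergy φ a zs z from ⟨hE k, hacc k (hE k)⟩
  intro k
  induction k with
  | zero => exact (primalDualEnergy_init zs).le
  | succ k ih =>
    have hv := valid_state h ha hz k
    have h1 := step_xy_le h ha hv (accepts_acceptedStep ha hv (psiXY_pos ha hxx hxy) (hacc k ih))
      hzs.1.1 hzs.1.2 (state_succ (P := P) (φ := φ) (B := B) (a := a) .xy z k)
    have h2 := gap_nonneg_of_saddle hzs (iterate_mem h ha hz (k + 1))
    have h3 := mul_nonneg (valid_state h ha hz (k + 1)).σPrev.le h2
    change 0 ≤ _ * (P.coupling (state P φ B a .xy z (k + 1)).x zs.snd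
      - P.coupling zs.fst (state P φ B a .xy z (k + 1)).y) at h3
    linarith

variable {Ψ : ℝ} (hΨ : 0 < Ψ) (hacc : ∀ k, AcceptsBelow P φ B a .xy (state P φ B a .xy z k) Ψ)
include hΨ hacc

theorem sum_gap_add_energy_le {w : PDSpace n p m} (hw : w ∈ P.domain B) (K : ℕ) :
    ∑ k ∈ Finset.range K, sigma P φ B a .xy z k *
      (P.coupling (state P φ B a .xy z (k + 1)).x w.snd
        - P.coupling w.fst (state P φ B a .xy z (k + 1)).y)
      + primalDualEnergy P φ a (state P φ B a .xy z K) w.fst w.snd ≤ initialEnergy φ a w z := by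
  induction K with
  | zero => simpa using (primalDualEnergy_init w).le
  | succ k ih =>
    have hv := valid_state h ha hz k
    have h1 := step_xy_le h ha hv (accepts_acceptedStep ha hv hΨ (hacc k))
      hw.1 hw.2 (state_succ (P := P) (φ := φ) (B := B) (a := a) .xy z k)
    rw [Finset.sum_range_succ]
    change _ + sigma P φ B a .xy z k * _ + _ ≤ _
    have e : sigma P φ B a .xy z k = (state P φ B a .xy z (k + 1)).σPrev := rfl
    rw [e]
    linarith

theorem sum_sigma_mul_gap_average_le_xy {K : ℕ} (hK : 1 ≤ K) {w : PDSpace n p m}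
    (hw : w ∈ P.domain B) :
    (∑ k ∈ Finset.range K, sigma P φ B a .xy z k) *
      (P.coupling (average P φ B a .xy z K).fst w.snd
        - P.coupling w.fst (average P φ B a .xy z K).snd) ≤ initialEnergy φ a w z := by
  have h1 := sum_gap_add_energy_le h ha hz hΨ hacc hw K
  have h2 := sum_sigma_mul_gap_average_le h ha hz hK hw
  have hv := valid_state h ha hz K
  have h3 := le_primalDualEnergy h ha hv w.fst w.snd
  have h4 := h.phiP.bregman_nonneg w.fst hv.x
  have h5 := (h.phiD_dualDomain B).bregman_nonneg w.snd hv.y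
  have hγ : 0 < (state P φ B a .xy z K).γ := ha.common.2.2.2.2.2.1.trans_le hv.γ0_le
  obtain ⟨hcα, hcβ, hδ, hsum, hη, hη1, hτbar, hγ0, hcnm⟩ := ha
  have h6 := mul_nonneg (mul_nonneg hγ.le (by linarith : 0 ≤ 1 - (a.cα + a.cβ))) h4
  linarith

/-- With a saddle point as comparison point the gaps are nonnegative, so the energy never exceeds
its initial value; balls are convex. -/
theorem norm_average_sub_sq_le_xy {K : ℕ} (hK : 1 ≤ K) {zs : PDSpace n p m}
    (hzs : zs ∈ P.saddleSet B) :
    ‖average P φ B a .xy z K - zs‖ ^ 2 ≤ constTwo a Lφ .xy ^ 2 * ‖zs - z‖ ^ 2 := by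
  have hinit := initialEnergy_le h ha.common.2.2.2.2.2.1 hzs.1 hz
  refine average_norm_sub_sq_le h ha hz hK fun k _ => ?_
  have h1 := sum_gap_add_energy_le h ha hz hΨ hacc hzs.1 (k + 1)
  have h2 : 0 ≤ ∑ k ∈ Finset.range (k + 1), sigma P φ B a .xy z k *
      (P.coupling (state P φ B a .xy z (k + 1)).x zs.snd
        - P.coupling zs.fst (state P φ B a .xy z (k + 1)).y) :=
    Finset.sum_nonneg fun k _ => mul_nonneg (sigma_pos h ha hz k).le
      (gap_nonneg_of_saddle hzs (iterate_mem h ha hz (k + 1)))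
  have h3 := (norm_iterate_sub_sq_le_of_energy h ha hz (w := zs) (k := k + 1) (by linarith)).2
  have hL := h.pos
  obtain ⟨hcα, hcβ, hδ, hsum, hη, hη1, hτbar, hγ0, hcnm⟩ := ha
  have hmin : 0 < min (a.γ0 * (1 - (a.cα + a.cβ))) 1 :=
    lt_min (mul_pos hγ0 (by linarith)) one_pos
  have hmax : 0 < max a.γ0 1 := lt_max_of_lt_left hγ0
  rw [constTwo, Real.sq_sqrt (by positivity), div_mul_eq_mul_div, le_div_iff₀ hmin]
  linarith

end PrimalFirst

/-! ### Runs with the dual update first -/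

section DualFirst

variable (h : P.Regular φ Lφ) (ha : a.Admissible .yx) {z : PDSpace n p m} (hz : z ∈ P.domain B)
  {Ψ : ℝ} (hΨ : 0 < Ψ) (hacc : ∀ k, AcceptsBelow P φ B a .yx (state P φ B a .yx z k) Ψ)

/-- The loss factors along a run. -/
noncomputable def runLossFactor (P : ConicProgram n p m) (φ : BregmanPair n p m) (B : ENNReal)
    (a : StepParams) (z : PDSpace n p m) (k : ℕ) : ℝ :=
  lossFactor P.mu (fun k => (state P φ B a .yx z k).γ) (fun k => (state P φ B a .yx z k).τPrev) k

/-- The products of the loss factors along a run. -/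
noncomputable def runLoss (P : ConicProgram n p m) (φ : BregmanPair n p m) (B : ENNReal)
    (a : StepParams) (z : PDSpace n p m) (k : ℕ) : ℝ :=
  lossProd P.mu (fun k => (state P φ B a .yx z k).γ) (fun k => (state P φ B a .yx z k).τPrev) k

include h ha hz hΨ hacc

theorem step_state_yx_le {w : PDSpace n p m} (hw : w ∈ P.domain B) (k : ℕ) :
    sigma P φ B a .yx z k * (P.coupling (state P φ B a .yx z (k + 1)).x w.snd
        - P.coupling w.fst (state P φ B a .yx z (k + 1)).y)
      + (state P φ B a .yx z k).γ * bregman φ.phiP w.fst (state P φ B a .yx z (k + 1)).x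
      + dualEnergy P φ a (state P φ B a .yx z (k + 1)) w.snd ≤
    (state P φ B a .yx z k).γ * (1 - P.mu * (state P φ B a .yx z (k + 1)).τPrev) *
      bregman φ.phiP w.fst (state P φ B a .yx z k).x
      + dualEnergy P φ a (state P φ B a .yx z k) w.snd := by
  have hv := valid_state h ha hz k
  have h1 := step_yx_le h ha hv (accepts_acceptedStep ha hv hΨ (hacc k))
    hw.1 hw.2 (state_succ (P := P) (φ := φ) (B := B) (a := a) .yx z k)
  have e := sigma_eq (P := P) (φ := φ) (B := B) (a := a) .yx z k
  have e' : (state P φ B a .yx z (k + 1)).σPrev = sigma P φ B a .yx z k := rfl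
  have h2 := mu_mul_half_norm_sq h w.fst (state P φ B a .yx z k).x
  rw [e'] at h1
  have h3 : sigma P φ B a .yx z k * (P.mu / 2 * ‖w.fst - (state P φ B a .yx z k).x‖ ^ 2)
      = (state P φ B a .yx z k).γ * (P.mu * (state P φ B a .yx z (k + 1)).τPrev) *
        bregman φ.phiP w.fst (state P φ B a .yx z k).x := by
    rw [e]
    linear_combination (state P φ B a .yx z k).γ * (state P φ B a .yx z (k + 1)).τPrev * h2
  linarith

/-- Step k leaves D_p(w, x^{k+1}) with weight γ_k, whereas step k + 1 asks for γ_{k+1}(1 - μ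
τ_{k+1}) ≤ e_k γ_k. The deficits are collected; they sit between steps, so K + 1 steps have K of
them. -/
theorem sum_gap_add_energy_yx_le {w : PDSpace n p m} (hw : w ∈ P.domain B) (K : ℕ) :
    ∑ k ∈ Finset.range (K + 1), sigma P φ B a .yx z k *
      (P.coupling (state P φ B a .yx z (k + 1)).x w.snd
        - P.coupling w.fst (state P φ B a .yx z (k + 1)).y)
      + (state P φ B a .yx z K).γ * bregman φ.phiP w.fst (state P φ B a .yx z (K + 1)).x
      + dualEnergy P φ a (state P φ B a .yx z (K + 1)) w.snd ≤
    initialEnergy φ a w z + ∑ k ∈ Finset.range K, (state P φ B a .yx z k).γ *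
      (runLossFactor P φ B a z k - 1) * bregman φ.phiP w.fst (state P φ B a .yx z (k + 1)).x := by
  have hseq := stepSequence h ha hz hΨ hacc
  induction K with
  | zero =>
    have h1 := step_state_yx_le h ha hz hΨ hacc hw 0
    have h2 : dualEnergy P φ a (state P φ B a .yx z 0) w.snd = bregman φ.phiD w.snd z.snd := by
      change dualEnergy P φ a (init a z) w.snd = _
      simp [dualEnergy, init]
    have h3 : (state P φ B a .yx z 0).γ = a.γ0 := rfl
    have h4 : (state P φ B a .yx z 0).x = z.fst := rfl
    have h5 := h.phiP.bregman_nonneg w.fst hz.1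
    have h6 : 0 ≤ a.γ0 * (P.mu * (state P φ B a .yx z 1).τPrev) * bregman φ.phiP w.fst z.fst :=
      mul_nonneg (mul_nonneg ha.common.2.2.2.2.2.1.le (mul_nonneg h.mu_nonneg
        (valid_state h ha hz 1).τPrev.le)) h5
    rw [h2, h3, h4] at h1
    simp only [zero_add, Finset.range_one, Finset.sum_singleton, Finset.range_zero,
      Finset.sum_empty, add_zero, initialEnergy]
    rw [h3]
    simp only [zero_add] at h1
    linarith
  | succ K ih =>
    have h1 := step_state_yx_le h ha hz hΨ hacc hw (K + 1)
    have h2 := mul_le_mul_of_nonneg_right (hseq.le_lossFactor_mul K)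
      (h.phiP.bregman_nonneg w.fst (valid_state h ha hz (K + 1)).x)
    change (state P φ B a .yx z (K + 1)).γ * (1 - P.mu * (state P φ B a .yx z (K + 1 + 1)).τPrev) *
      bregman φ.phiP w.fst (state P φ B a .yx z (K + 1)).x ≤ runLossFactor P φ B a z K *
        (state P φ B a .yx z K).γ * bregman φ.phiP w.fst (state P φ B a .yx z (K + 1)).x at h2
    rw [Finset.sum_range_succ _ (K + 1), Finset.sum_range_succ
      (fun k => (state P φ B a .yx z k).γ * (runLossFactor P φ B a z k - 1) *
        bregman φ.phiP w.fst (state P φ B a .yx z (k + 1)).x) K]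
    linarith

omit hz hΨ hacc in
theorem le_add_dualEnergy {s : ApdbState n p m} (hs : Valid P B a s) {γ : ℝ} (hγ : a.γ0 ≤ γ)
    (w : PDSpace n p m) :
    min a.γ0 (1 - a.cα) / 2 * ‖mkPD s.x s.y - w‖ ^ 2
      ≤ γ * bregman φ.phiP w.fst s.x + dualEnergy P φ a s w.snd := by
  have h1 := le_dualEnergy h ha hs w.snd
  have h2 := h.phiP.half_norm_sq_le_bregman w.fst hs.x
  have h3 := (h.phiD_dualDomain B).half_norm_sq_le_bregman w.snd hs.y
  have h4 := mul_le_mul_of_nonneg_right hγ (h.phiP.bregman_nonneg w.fst hs.x)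
  obtain ⟨hcα, hcα1, hcβ, hδ, hsum, hη, hη1, hτbar, hγ0, hcnm⟩ := ha
  rw [norm_sub_rev, norm_sq_sub]
  change _ * (‖w.fst - s.x‖ ^ 2 + ‖w.snd - s.y‖ ^ 2) ≤ _
  have h6 := mul_le_mul_of_nonneg_right (min_le_left a.γ0 (1 - a.cα)) (sq_nonneg ‖w.fst - s.x‖)
  have h7 := mul_le_mul_of_nonneg_right (min_le_right a.γ0 (1 - a.cα)) (sq_nonneg ‖w.snd - s.y‖)
  have h8 := mul_le_mul_of_nonneg_left h2 hγ0.le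
  have h9 := mul_le_mul_of_nonneg_left h3 (by linarith : 0 ≤ 1 - a.cα)
  linarith

/-- At a saddle point the gaps can be dropped. Since the dual energy is nonnegative, the whole
energy may be multiplied by the loss factor rather than its primal part alone. -/
theorem energy_yx_le {zs : PDSpace n p m} (hzs : zs ∈ P.saddleSet B) (k : ℕ) :
    (state P φ B a .yx z k).γ * bregman φ.phiP zs.fst (state P φ B a .yx z (k + 1)).x
      + dualEnergy P φ a (state P φ B a .yx z (k + 1)) zs.snd
      ≤ runLoss P φ B a z k * initialEnergy φ a zs z := by
  have hseq := stepSequence h ha hz hΨ hacc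
  have hgap : ∀ k, 0 ≤ sigma P φ B a .yx z k * (P.coupling (state P φ B a .yx z (k + 1)).x zs.snd
      - P.coupling zs.fst (state P φ B a .yx z (k + 1)).y) := fun k =>
    mul_nonneg (sigma_pos h ha hz k).le (gap_nonneg_of_saddle hzs (iterate_mem h ha hz (k + 1)))
  induction k with
  | zero =>
    have h1 := sum_gap_add_energy_yx_le h ha hz hΨ hacc hzs.1 0
    have h2 := hgap 0
    simp only [zero_add, Finset.range_one, Finset.sum_singleton, Finset.range_zero,
      Finset.sum_empty, add_zero] at h1 h2 ⊢
    simp only [runLoss, lossProd, Finset.range_zero, Finset.prod_empty, one_mul]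
    linarith
  | succ k ih =>
    have h1 := step_state_yx_le h ha hz hΨ hacc hzs.1 (k + 1)
    have h2 := mul_le_mul_of_nonneg_right (hseq.le_lossFactor_mul k)
      (h.phiP.bregman_nonneg zs.fst (valid_state h ha hz (k + 1)).x)
    change (state P φ B a .yx z (k + 1)).γ * (1 - P.mu * (state P φ B a .yx z (k + 1 + 1)).τPrev) *
      bregman φ.phiP zs.fst (state P φ B a .yx z (k + 1)).x ≤ runLossFactor P φ B a z k *
        (state P φ B a .yx z k).γ * bregman φ.phiP zs.fst (state P φ B a .yx z (k + 1)).x at h2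
    have hv := valid_state h ha hz (k + 1)
    have h3 := le_dualEnergy h ha hv zs.snd
    have h4 : 0 ≤ dualEnergy P φ a (state P φ B a .yx z (k + 1)) zs.snd :=
      (mul_nonneg (by linarith [ha.2.1] : 0 ≤ 1 - a.cα)
        ((h.phiD_dualDomain B).bregman_nonneg zs.snd hv.y)).trans h3
    have h5 : 1 ≤ runLossFactor P φ B a z k := one_le_lossFactor k
    have h6 := mul_le_mul_of_nonneg_left ih (zero_le_one.trans h5)
    have e : runLoss P φ B a z (k + 1) = runLoss P φ B a z k * runLossFactor P φ B a z k :=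
      lossProd_succ k
    rw [e]
    have h7 := le_mul_of_one_le_left h4 h5
    have h8 := hgap (k + 1)
    linarith

theorem norm_iterate_sub_sq_le_yx {zs : PDSpace n p m} (hzs : zs ∈ P.saddleSet B) (k : ℕ) :
    ‖iterate P φ B a .yx z (k + 1) - zs‖ ^ 2
      ≤ constTwo a Lφ .yx ^ 2 * runLoss P φ B a z k * ‖zs - z‖ ^ 2 := by
  have hγ0 := ha.common.2.2.2.2.2.1
  have h1 := energy_yx_le h ha hz hΨ hacc hzs k
  have h2 := le_add_dualEnergy h ha (valid_state h ha hz (k + 1))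
    ((valid_state h ha hz k).γ0_le) zs
  have hU : 1 ≤ runLoss P φ B a z k := one_le_lossProd k
  have h3 := mul_le_mul_of_nonneg_left (initialEnergy_le h hγ0 hzs.1 hz) (zero_le_one.trans hU)
  have hmin : 0 < min a.γ0 (1 - a.cα) := lt_min hγ0 (by linarith [ha.2.1])
  have hmax : 0 < max a.γ0 1 := lt_max_of_lt_left hγ0
  have hL := h.pos
  rw [constTwo, Real.sq_sqrt (by positivity), div_mul_eq_mul_div, div_mul_eq_mul_div,
    le_div_iff₀ hmin]
  change min a.γ0 (1 - a.cα) / 2 * ‖iterate P φ B a .yx z (k + 1) - zs‖ ^ 2 ≤ _ at h2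
  linarith

theorem norm_average_sub_sq_le_yx {K : ℕ} {zs : PDSpace n p m} (hzs : zs ∈ P.saddleSet B) :
    ‖average P φ B a .yx z (K + 1) - zs‖ ^ 2
      ≤ constTwo a Lφ .yx ^ 2 * runLoss P φ B a z K * ‖zs - z‖ ^ 2 := by
  refine average_norm_sub_sq_le h ha hz (by omega) fun k hk => ?_
  refine (norm_iterate_sub_sq_le_yx h ha hz hΨ hacc hzs k).trans ?_
  have : runLoss P φ B a z k ≤ runLoss P φ B a z K := lossProd_mono (by omega)
  gcongr

theorem sum_sigma_mul_gap_average_le_yx {K : ℕ} {w : PDSpace n p m} (hw : w ∈ P.domain B) :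
    (∑ k ∈ Finset.range (K + 1), sigma P φ B a .yx z k) *
      (P.coupling (average P φ B a .yx z (K + 1)).fst w.snd
        - P.coupling w.fst (average P φ B a .yx z (K + 1)).snd) ≤
    initialEnergy φ a w z + ∑ k ∈ Finset.range K, (state P φ B a .yx z k).γ *
      (runLossFactor P φ B a z k - 1) * bregman φ.phiP w.fst (state P φ B a .yx z (k + 1)).x := by
  have h1 := sum_gap_add_energy_yx_le h ha hz hΨ hacc hw K
  have h2 := sum_sigma_mul_gap_average_le h ha hz (by omega : 1 ≤ K + 1) hw
  have h3 := le_add_dualEnergy h ha (valid_state h ha hz (K + 1))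
    ((valid_state h ha hz K).γ0_le) w
  have hmin : 0 < min a.γ0 (1 - a.cα) :=
    lt_min ha.common.2.2.2.2.2.1 (by linarith [ha.2.1])
  have h4 := mul_nonneg (half_pos hmin).le
    (sq_nonneg ‖mkPD (state P φ B a .yx z (K + 1)).x (state P φ B a .yx z (K + 1)).y - w‖)
  linarith

theorem runLossFactor_eq_one (hmu : P.mu = 0) (k : ℕ) : runLossFactor P φ B a z k = 1 := by
  have hseq := stepSequence h ha hz hΨ hacc
  have h1 := hseq.γ_succ k
  have h2 := (hseq.γ_pos k).ne'
  simp only [runLossFactor, lossFactor, hmu, zero_mul, sub_zero, mul_one, add_zero] at h1 h2 ⊢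
  rw [h1, div_self h2, max_self]

theorem runLoss_eq_one (hmu : P.mu = 0) (k : ℕ) : runLoss P φ B a z k = 1 := by
  unfold runLoss lossProd
  exact Finset.prod_eq_one fun j _ => runLossFactor_eq_one h ha hz hΨ hacc hmu j

end DualFirst

end Apdb

namespace Apdb

open ConicProgram StepSequence

variable {n p m : ℕ} {P : ConicProgram n p m} {φ : BregmanPair n p m} {B : ENNReal}
  {a : StepParams} {Lφ : ℝ}

/-! ### The dual-first order under strong convexity -/

section StronglyConvex

variable (h : P.Regular φ Lφ) (ha : a.Admissible .yx) {z : PDSpace n p m} (hz : z ∈ P.domain B)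
  {Ψ : ℝ} (hΨ : 0 < Ψ) (hacc : ∀ k, AcceptsBelow P φ B a .yx (state P φ B a .yx z k) Ψ)
  (hmu : 0 < P.mu)
include h ha hz hΨ hacc hmu

/-- Split the distance at `zs.fst`. For the first part, γ_k (e_k - 1) ≤ γ_{k+1} - γ_k = μ σ_k. For
the second, γ_k D_p(zs.fst, x^{k+1}) ≤ U_k V with V the initial energy, and (e_k - 1) U_k = U_{k+1}
- U_k telescopes. -/
theorem sum_lossFactor_mul_bregman_le {zs : PDSpace n p m} (hzs : zs ∈ P.saddleSet B)
    (x : PrimalSpace n) (K : ℕ) :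
    ∑ k ∈ Finset.range K, (state P φ B a .yx z k).γ * (runLossFactor P φ B a z k - 1) *
        bregman φ.phiP x (state P φ B a .yx z (k + 1)).x ≤
      P.mu * (∑ k ∈ Finset.range K, sigma P φ B a .yx z k) * ‖x - zs.fst‖ ^ 2
        + 2 * (runLoss P φ B a z K - 1) * initialEnergy φ a zs z := by
  have hseq := stepSequence h ha hz hΨ hacc
  induction K with
  | zero => simp [runLoss, lossProd]
  | succ K ih =>
    rw [Finset.sum_range_succ, Finset.sum_range_succ]
    have hγ : 0 < (state P φ B a .yx z K).γ := hseq.γ_pos K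
    have hv := valid_state h ha hz (K + 1)
    have h1 : bregman φ.phiP x (state P φ B a .yx z (K + 1)).x ≤
        ‖x - zs.fst‖ ^ 2 + 2 * bregman φ.phiP zs.fst (state P φ B a .yx z (K + 1)).x := by
      rw [h.phiP_eq hmu, bregman_half_norm_sq, bregman_half_norm_sq]
      linarith [sq_norm_sub_le_two_mul x zs.fst (state P φ B a .yx z (K + 1)).x]
    have he : 1 ≤ runLossFactor P φ B a z K := one_le_lossFactor K
    have h2 : (state P φ B a .yx z K).γ * (runLossFactor P φ B a z K - 1)
        ≤ P.mu * sigma P φ B a .yx z K := by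
      have h3 : runLossFactor P φ B a z K * (state P φ B a .yx z K).γ
          ≤ (state P φ B a .yx z (K + 1)).γ := by
        rw [← le_div_iff₀ hγ]
        refine max_le ?_ ?_
        · rw [le_div_iff₀ hγ, one_mul]; exact hseq.γ_le_succ K
        · refine div_le_div_of_nonneg_right ?_ hγ.le
          have h4 := mul_nonneg hmu.le (hseq.t_pos (K + 2)).le
          have h5 := hseq.γ_pos (K + 1)
          exact mul_le_of_le_one_right h5.le (by linarith)
      have h6 := hseq.γ_succ K
      rw [sigma_eq]
      linarith
    have h7 : (state P φ B a .yx z K).γ * bregman φ.phiP zs.fst (state P φ B a .yx z (K + 1)).x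
        ≤ runLoss P φ B a z K * initialEnergy φ a zs z := by
      have h8 := energy_yx_le h ha hz hΨ hacc hzs K
      have h9 := le_dualEnergy h ha hv zs.snd
      have h10 := mul_nonneg (by linarith [ha.2.1] : 0 ≤ 1 - a.cα)
        ((h.phiD_dualDomain B).bregman_nonneg zs.snd hv.y)
      linarith
    have e : runLoss P φ B a z (K + 1) = runLoss P φ B a z K * runLossFactor P φ B a z K :=
      lossProd_succ K
    rw [e]
    have h11 := mul_le_mul_of_nonneg_left h1 (mul_nonneg hγ.le (sub_nonneg.2 he))
    have h12 := mul_le_mul_of_nonneg_right h2 (sq_nonneg ‖x - zs.fst‖)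
    have h13 := mul_le_mul_of_nonneg_left h7 (sub_nonneg.2 he)
    linarith

theorem sum_sigma_mul_gap_average_le_of_mu_pos {zs : PDSpace n p m} (hzs : zs ∈ P.saddleSet B)
    {w : PDSpace n p m} (hw : w ∈ P.domain B) (K : ℕ) :
    (∑ k ∈ Finset.range (K + 1), sigma P φ B a .yx z k) *
      (P.coupling (average P φ B a .yx z (K + 1)).fst w.snd
        - P.coupling w.fst (average P φ B a .yx z (K + 1)).snd) ≤
    initialEnergy φ a w z
      + P.mu * (∑ k ∈ Finset.range (K + 1), sigma P φ B a .yx z k) * ‖w.fst - zs.fst‖ ^ 2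
      + 2 * (runLoss P φ B a z K - 1) * initialEnergy φ a zs z := by
  have h1 := sum_sigma_mul_gap_average_le_yx h ha hz hΨ hacc (K := K) hw
  have h2 := sum_lossFactor_mul_bregman_le h ha hz hΨ hacc hmu hzs w.fst K
  have h3 : P.mu * (∑ k ∈ Finset.range K, sigma P φ B a .yx z k) * ‖w.fst - zs.fst‖ ^ 2
      ≤ P.mu * (∑ k ∈ Finset.range (K + 1), sigma P φ B a .yx z k) * ‖w.fst - zs.fst‖ ^ 2 := by
    refine mul_le_mul_of_nonneg_right (mul_le_mul_of_nonneg_left ?_ hmu.le) (sq_nonneg _)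
    rw [Finset.sum_range_succ]
    linarith [sigma_pos (P := P) (φ := φ) (B := B) (a := a) h ha hz K]
  linarith

omit ha hz hΨ hacc hmu in
theorem coupling_sub_le_scaled {zs w zb : PDSpace n p m} (hzs : zs ∈ P.saddleSet B)
    (hw : w ∈ P.domain B) (hzb : zb ∈ P.domain B) {s : ℝ} (hs0 : 0 < s) (hs1 : s ≤ 1) :
    s * (P.coupling zs.fst zb.snd - P.coupling w.fst zb.snd) ≤
      P.coupling zb.fst zs.snd - P.coupling ((1 - s) • zs.fst + s • w.fst) zb.snd := by
  obtain ⟨-, h1, h2⟩ := mem_saddleSet_iff.1 hzs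
  have h3 := h1 zb.snd hzb.2
  have h4 := h2 zb.fst hzb.1
  have h5 := (convexOn_coupling h.smooth h.convex_X (Regular.mem_top hzb.2)).2 hzs.1.1 hw.1
    (by linarith : 0 ≤ 1 - s) hs0.le (by ring)
  simp only [smul_eq_mul] at h5
  linarith

/-- The gap is split at Φ(zs.fst, zb.snd) with `zb` the average. In the dual part the comparison
point has primal component `zs.fst`, so the error μ S ‖·‖² vanishes. The primal part is tested on
the segment from `zs.fst` to `w.fst`. -/
theorem gapTerm_average_le_of_mu_pos {ξ s : ℝ} (hξ : 0 < ξ) {zs : PDSpace n p m}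
    (hzs : zs ∈ P.saddleSet B) {K : ℕ} (hs0 : 0 < s) (hs1 : s ≤ 1)
    (hsS : 2 * s * (a.γ0 + P.mu * ∑ k ∈ Finset.range (K + 1), sigma P φ B a .yx z k)
      ≤ ξ * ∑ k ∈ Finset.range (K + 1), sigma P φ B a .yx z k)
    (hSξ : Lφ ≤ ξ * ∑ k ∈ Finset.range (K + 1), sigma P φ B a .yx z k)
    {w : PDSpace n p m} (hw : w ∈ P.domain B) :
    (∑ k ∈ Finset.range (K + 1), sigma P φ B a .yx z k) *
      P.gapTerm φ ξ (average P φ B a .yx z (K + 1)) w ≤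
    (2 + Lφ * (4 / (1 - a.cα) + 4) + 3 / s + 4 * ξ / P.mu) *
      (runLoss P φ B a z K * initialEnergy φ a zs z) := by
  have hzb := average_mem h ha hz (by omega : 1 ≤ K + 1)
  have hS := sum_sigma_pos h ha hz (by omega : 1 ≤ K + 1)
  have hJ := fun w hw =>
    sum_sigma_mul_gap_average_le_of_mu_pos h ha hz hΨ hacc hmu hzs (w := w) hw K
  have hγ0 := ha.common.2.2.2.2.2.1
  have hcα : 0 < 1 - a.cα := by linarith [ha.2.1]
  have hU : 1 ≤ runLoss P φ B a z K := one_le_lossProd K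
  have hV := initialEnergy_nonneg h hγ0 zs hz
  have hLφ := h.pos
  have hyavg : ‖(average P φ B a .yx z (K + 1)).snd - zs.snd‖ ^ 2
      ≤ 2 / (1 - a.cα) * (runLoss P φ B a z K * initialEnergy φ a zs z) := by
    refine average_snd_norm_sub_sq_le h ha hz (by omega) fun k hk => ?_
    have hv := valid_state h ha hz (k + 1)
    have h1 := energy_yx_le h ha hz hΨ hacc hzs k
    have h2 := le_dualEnergy h ha hv zs.snd
    have h3 := mul_nonneg (hγ0.le.trans (valid_state h ha hz k).γ0_le)
      (h.phiP.bregman_nonneg zs.fst hv.x)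
    have h4 := (h.phiD_dualDomain B).half_norm_sq_le_bregman zs.snd hv.y
    have h5 : runLoss P φ B a z k ≤ runLoss P φ B a z K := lossProd_mono (by omega)
    have h6 := mul_le_mul_of_nonneg_right h5 hV
    have h7 := mul_le_mul_of_nonneg_left h4 hcα.le
    rw [norm_sub_rev, div_mul_eq_mul_div, le_div_iff₀ hcα]
    linarith
  set S := ∑ k ∈ Finset.range (K + 1), sigma P φ B a .yx z k
  set U := runLoss P φ B a z K
  set V := initialEnergy φ a zs z with hVdef
  set zb := average P φ B a .yx z (K + 1)
  have hUV : V ≤ U * V := le_mul_of_one_le_left hV hU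
  -- the primal average is close to the primal solution
  have hxavg : S * ‖zb.fst - zs.fst‖ ^ 2 ≤ 4 / P.mu * (U * V) := by
    have h1 := hJ zs hzs.1
    have h2 := coupling_add_inner_le h.smooth h.convex_X (Regular.mem_top hzs.1.2) hzs.1.1 hzb.1
    obtain ⟨-, h3, h4⟩ := mem_saddleSet_iff.1 hzs
    have h5 := inner_nonneg_of_isMinOn h.convex_X hzs.1.1
      (isMinOn_iff.2 fun x hx => h4 x hx) (hasGradientAt_coupling h.smooth hzs.1.1 zs.snd) hzb.1
    have h6 := h3 zb.snd hzb.2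
    rw [sub_self, norm_zero] at h1
    have h7 : S * (P.mu / 2 * ‖zb.fst - zs.fst‖ ^ 2) ≤
        S * (P.coupling zb.fst zs.snd - P.coupling zs.fst zb.snd) :=
      mul_le_mul_of_nonneg_left (by linarith) hS.le
    rw [div_mul_eq_mul_div, le_div_iff₀ hmu]
    linarith
  -- the part of the gap in which the dual variable varies
  have hT1 : S * (P.coupling zb.fst w.snd - P.coupling zs.fst zb.snd) ≤
      ξ * S * ‖w.snd - zb.snd‖ ^ 2 + (2 + Lφ * (4 / (1 - a.cα) + 4)) * (U * V) := by
    have h1 := hJ (mkPD zs.fst w.snd) ⟨hzs.1.1, hw.2⟩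
    change S * (P.coupling zb.fst w.snd - P.coupling zs.fst zb.snd) ≤
      (a.γ0 * bregman φ.phiP zs.fst z.fst + bregman φ.phiD w.snd z.snd)
        + P.mu * S * ‖zs.fst - zs.fst‖ ^ 2 + 2 * (U - 1) * V at h1
    rw [sub_self, norm_zero] at h1
    have h2 := (h.phiD_dualDomain B).bregman_le (P.convex_dualDomain B) hw.2 hz.2
    have h3 := sq_norm_sub_le_two_mul w.snd zb.snd z.snd
    have h4 := sq_norm_sub_le_two_mul zb.snd zs.snd z.snd
    have h5 := (h.phiD_dualDomain B).half_norm_sq_le_bregman zs.snd hz.2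
    have h6 := mul_nonneg hγ0.le (h.phiP.bregman_nonneg zs.fst hz.1)
    have h7 := (h.phiD_dualDomain B).bregman_nonneg zs.snd hz.2
    have hV' : V = a.γ0 * bregman φ.phiP zs.fst z.fst + bregman φ.phiD zs.snd z.snd := rfl
    have h8 : ‖zb.snd - z.snd‖ ^ 2 ≤ (4 / (1 - a.cα) + 4) * (U * V) := by
      have : 4 / (1 - a.cα) * (U * V) = 2 * (2 / (1 - a.cα) * (U * V)) := by ring
      linarith
    have h9 := mul_le_mul_of_nonneg_left h8 hLφ.le
    have h10 := mul_le_mul_of_nonneg_left h3 (half_pos hLφ).le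
    have h11 := mul_le_mul_of_nonneg_right hSξ (sq_nonneg ‖w.snd - zb.snd‖)
    linarith
  -- the part of the gap in which the primal variable varies
  have hT2 : S * (P.coupling zs.fst zb.snd - P.coupling w.fst zb.snd) ≤
      ξ * S * ‖w.fst - zb.fst‖ ^ 2 + (3 / s + 4 * ξ / P.mu) * (U * V) := by
    have hxs : (1 - s) • zs.fst + s • w.fst ∈ P.X :=
      h.convex_X hzs.1.1 hw.1 (by linarith) hs0.le (by ring)
    have h1 := hJ (mkPD ((1 - s) • zs.fst + s • w.fst) zs.snd) ⟨hxs, hzs.1.2⟩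
    have hd : (1 - s) • zs.fst + s • w.fst - zs.fst = s • (w.fst - zs.fst) := by module
    change S * (P.coupling zb.fst zs.snd - P.coupling ((1 - s) • zs.fst + s • w.fst) zb.snd) ≤
      (a.γ0 * bregman φ.phiP ((1 - s) • zs.fst + s • w.fst) z.fst + bregman φ.phiD zs.snd z.snd)
        + P.mu * S * ‖(1 - s) • zs.fst + s • w.fst - zs.fst‖ ^ 2 + 2 * (U - 1) * V at h1
    have h2 : bregman φ.phiP ((1 - s) • zs.fst + s • w.fst) z.fst ≤
        s ^ 2 * ‖w.fst - zs.fst‖ ^ 2 + 2 * bregman φ.phiP zs.fst z.fst := by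
      have := sq_norm_sub_le_two_mul ((1 - s) • zs.fst + s • w.fst) zs.fst z.fst
      rw [hd, norm_smul, mul_pow, Real.norm_eq_abs, sq_abs] at this
      rw [h.phiP_eq hmu, bregman_half_norm_sq, bregman_half_norm_sq]
      linarith
    rw [hd, norm_smul, mul_pow, Real.norm_eq_abs, sq_abs] at h1
    have h3 := mul_le_mul_of_nonneg_left (coupling_sub_le_scaled h hzs hw hzb hs0 hs1) hS.le
    have h4 := mul_le_mul_of_nonneg_left h2 hγ0.le
    have hV' : V = a.γ0 * bregman φ.phiP zs.fst z.fst + bregman φ.phiD zs.snd z.snd := rfl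
    have h5 := mul_nonneg hγ0.le (h.phiP.bregman_nonneg zs.fst hz.1)
    have h6 := (h.phiD_dualDomain B).bregman_nonneg zs.snd hz.2
    -- After division by s the error is still proportional to s, so the choice of s makes it small
    -- against ξ S; the price is 3/s in front of the initial energy.
    have h7 : s * (S * (P.coupling zs.fst zb.snd - P.coupling w.fst zb.snd)) ≤
        s * ((a.γ0 + P.mu * S) * s * ‖w.fst - zs.fst‖ ^ 2 + 3 / s * (U * V)) := by
      have e : s * ((a.γ0 + P.mu * S) * s * ‖w.fst - zs.fst‖ ^ 2 + 3 / s * (U * V))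
          = (a.γ0 + P.mu * S) * s ^ 2 * ‖w.fst - zs.fst‖ ^ 2 + 3 * (U * V) := by field_simp
      rw [e]
      linarith
    have h8 := le_of_mul_le_mul_left h7 hs0
    have h9 := sq_norm_sub_le_two_mul w.fst zb.fst zs.fst
    have hc : 0 ≤ (a.γ0 + P.mu * S) * s := by positivity
    have h10 := mul_le_mul_of_nonneg_left h9 hc
    have h11 := mul_le_mul_of_nonneg_right hsS (sq_nonneg ‖w.fst - zb.fst‖)
    have h12 := mul_le_mul_of_nonneg_right hsS (sq_nonneg ‖zb.fst - zs.fst‖)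
    have h13 := mul_le_mul_of_nonneg_left hxavg hξ.le
    have e : ξ * (4 / P.mu * (U * V)) = 4 * ξ / P.mu * (U * V) := by ring
    linarith
  have hB1 := h.phiP.half_norm_sq_le_bregman w.fst hzb.1
  have hB2 := (h.phiD_dualDomain B).half_norm_sq_le_bregman w.snd hzb.2
  have hB := mul_le_mul_of_nonneg_left (add_le_add hB1 hB2) (mul_pos hξ hS).le
  rw [gapTerm]
  linarith

end StronglyConvex

end Apdb

namespace Apdb

open ConicProgram StepSequence

variable {n p m : ℕ} {P : ConicProgram n p m} {φ : BregmanPair n p m} {B : ENNReal}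
  {a : StepParams} {Lφ : ℝ} {o : UpdateOrder}

/-! ### Growth of the sum of the step sizes -/

theorem sum_sigma_eq (o : UpdateOrder) (z : PDSpace n p m) (K : ℕ) :
    ∑ k ∈ Finset.range K, sigma P φ B a o z k =
      ∑ k ∈ Finset.range K, (state P φ B a o z k).γ * (state P φ B a o z (k + 1)).τPrev :=
  Finset.sum_congr rfl fun k _ => sigma_eq o z k

theorem linear_le_sum_sigma (h : P.Regular φ Lφ) (ha : a.Admissible o) {z : PDSpace n p m}
    (hz : z ∈ P.domain B) {Ψ : ℝ} (hΨ : 0 < Ψ)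
    (hacc : ∀ k, AcceptsBelow P φ B a o (state P φ B a o z k) Ψ) (K : ℕ) :
    (K : ℝ) * (a.γ0 * tauHat a Ψ) ≤ ∑ k ∈ Finset.range K, sigma P φ B a o z k := by
  have h1 := (stepSequence h ha hz hΨ hacc).linear_le_sum K
  have hγ0 := ha.common.2.2.2.2.2.1
  have hτ := tauHat_pos ha hΨ
  have e : Real.sqrt (a.γ0 * tauHat a Ψ ^ 2) * Real.sqrt a.γ0 = a.γ0 * tauHat a Ψ := by
    rw [Real.sqrt_mul hγ0.le, Real.sqrt_sq hτ.le, mul_right_comm, Real.mul_self_sqrt hγ0.le]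
  rw [e] at h1
  rwa [sum_sigma_eq]

theorem exists_quadratic_le_sum_sigma (h : P.Regular φ Lφ) (ha : a.Admissible o) (hmu : 0 < P.mu)
    {Ψ : ℝ} (hΨ : 0 < Ψ) :
    ∃ c > 0, ∀ z ∈ P.domain B, (∀ k, AcceptsBelow P φ B a o (state P φ B a o z k) Ψ) →
      ∀ K : ℕ, c * (K : ℝ) ^ 2 ≤ ∑ k ∈ Finset.range K, sigma P φ B a o z k := by
  have hγ0 := ha.common.2.2.2.2.2.1
  have hκ : 0 < Real.sqrt (a.γ0 * tauHat a Ψ ^ 2) :=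
    Real.sqrt_pos.2 (mul_pos hγ0 (pow_pos (tauHat_pos ha hΨ) 2))
  have hmin : 0 < min (Real.sqrt a.γ0) (P.mu * Real.sqrt (a.γ0 * tauHat a Ψ ^ 2) / 3) :=
    lt_min (Real.sqrt_pos.2 hγ0) (by positivity)
  refine ⟨_, half_pos (mul_pos hκ hmin), fun z hz hacc K => ?_⟩
  rw [sum_sigma_eq]
  exact (stepSequence h ha hz hΨ hacc).quadratic_le_sum K

theorem exists_le_mul_sq_of_ceil_le {c : ℝ} (hc : 0 < c) (v : ℝ) :
    ∃ C > 0, ∀ q : ℝ, 0 < q → ∀ K : ℕ, ⌈C / Real.sqrt q⌉₊ ≤ K → v ≤ q * (c * (K : ℝ) ^ 2) := by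
  -- Solves v ≤ q c K² for K; the added 1 keeps the constant positive.
  refine ⟨Real.sqrt (|v| / c) + 1, by positivity, fun q hq K hK => ?_⟩
  have h1 := (Nat.ceil_le.1 hK)
  rw [div_le_iff₀ (Real.sqrt_pos.2 hq)] at h1
  have h2 : Real.sqrt (|v| / c) ≤ K * Real.sqrt q := by linarith
  have h3 := pow_le_pow_left₀ (Real.sqrt_nonneg _) h2 2
  rw [Real.sq_sqrt (by positivity), mul_pow, Real.sq_sqrt hq.le, div_le_iff₀ hc] at h3
  linarith [le_abs_self v]

/-! ### The restart test for the nonaccelerated bounds -/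

/-- Uses min{τ̄, γ0 τ̄} · max{γ0, 1} = γ0 τ̄. In this form S_K ≥ K γ0 τ̂ turns the two entries of
`innerBound` into the two conditions of `AverageBounds.restartTest`. -/
theorem constOne_eq (ha : a.Admissible o) {Ψ : ℝ} (hΨ : 0 < Ψ) :
    constOne a Lφ Ψ = Lφ * max a.γ0 1 / (2 * (a.γ0 * tauHat a Ψ)) := by
  obtain ⟨-, -, -, -, hτ, hγ0, -⟩ := ha.common
  have hτhat := tauHat_pos ha hΨ
  have e : min a.τbar (a.γ0 * a.τbar) * max a.γ0 1 = a.γ0 * a.τbar := by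
    rcases le_total a.γ0 1 with hle | hle
    · rw [max_eq_right hle, min_eq_right (mul_le_of_le_one_left hτ.le hle), mul_one]
    · rw [max_eq_left hle, min_eq_left (le_mul_of_one_le_left hτ.le hle), mul_comm]
  have hmin : 0 < min a.τbar (a.γ0 * a.τbar) := lt_min hτ (mul_pos hγ0 hτ)
  rw [constOne]
  generalize min a.τbar (a.γ0 * a.τbar) = u at *
  generalize max a.γ0 1 = v at *
  field_simp
  linear_combination (-Lφ) * e

theorem one_le_innerBound (h : P.Regular φ Lφ) (ha : a.Admissible o) {Ψ ξ : ℝ} (hΨ : 0 < Ψ)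
    (hξ : 0 < ξ) (c ρ q : ℝ) : 1 ≤ innerBound (constOne a Lφ Ψ) c ρ q ξ := by
  have hγ0 := ha.common.2.2.2.2.2.1
  have h1 : 0 < constOne a Lφ Ψ := by
    rw [constOne_eq ha hΨ]
    have := h.pos
    have := tauHat_pos ha hΨ
    have : 0 < max a.γ0 1 := lt_max_of_lt_left hγ0
    positivity
  exact Nat.one_le_iff_ne_zero.2 (Nat.ceil_pos.2 (lt_max_of_lt_right (by positivity))).ne'

/-- The estimates on the average that do not need any correction for strong convexity. -/
structure AverageBounds (P : ConicProgram n p m) (φ : BregmanPair n p m) (B : ENNReal)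
    (a : StepParams) (o : UpdateOrder) (Lφ : ℝ) (z : PDSpace n p m) (K : ℕ) : Prop where
  gap_le : ∀ w ∈ P.domain B, (∑ k ∈ Finset.range K, sigma P φ B a o z k) *
    (P.coupling (average P φ B a o z K).fst w.snd - P.coupling w.fst (average P φ B a o z K).snd)
      ≤ initialEnergy φ a w z
  dist_le : ∀ zs ∈ P.saddleSet B,
    ‖average P φ B a o z K - zs‖ ^ 2 ≤ constTwo a Lφ o ^ 2 * ‖zs - z‖ ^ 2

theorem AverageBounds.restartTest (h : P.Regular φ Lφ) (ha : a.Admissible o)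
    (hne : (P.saddleSet B).Nonempty) {ξ q ρ : ℝ} (hξ : 0 < ξ) (hq : 0 < q) {z : PDSpace n p m}
    (hz : z ∈ P.domain B) (hgrowth : ((Metric.infDist z (P.saddleSet B) ^ 2 : ℝ) : EReal) ≤
      (ρ : EReal) * smoothedGap P φ B ξ z) {K : ℕ} (hK : 1 ≤ K)
    (hb : AverageBounds P φ B a o Lφ z K)
    (hS1 : Lφ * max a.γ0 1 ≤ ξ * ∑ k ∈ Finset.range K, sigma P φ B a o z k)
    (hS2 : 2 * (Lφ * max a.γ0 1) * (1 + constTwo a Lφ o ^ 2) * ρ ≤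
      q * ∑ k ∈ Finset.range K, sigma P φ B a o z k) :
    RestartTest P φ B a ξ q o z K := by
  have hS := sum_sigma_pos h ha hz hK
  refine restartTest_of_gapTerm_le h ha hξ hq hz hK hgrowth
    (fun w hw => gapTerm_le_of_sum_gap_le h ha.common.2.2.2.2.2.1 hne hz (average_mem h ha hz hK)
      hS hb.gap_le hξ hS1 hb.dist_le hw) ?_
  have e : 2 * (Lφ * max a.γ0 1 / ∑ k ∈ Finset.range K, sigma P φ B a o z k) *
      (1 + constTwo a Lφ o ^ 2) * ρ = 2 * (Lφ * max a.γ0 1) * (1 + constTwo a Lφ o ^ 2) * ρ /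
        ∑ k ∈ Finset.range K, sigma P φ B a o z k := by ring
  rwa [e, div_le_iff₀ hS]

theorem AverageBounds.restartTest_of_innerBound_le (h : P.Regular φ Lφ) (ha : a.Admissible o)
    (hne : (P.saddleSet B).Nonempty) {ξ q ρ : ℝ} (hξ : 0 < ξ) (hq : 0 < q) {z : PDSpace n p m}
    (hz : z ∈ P.domain B) (hgrowth : ((Metric.infDist z (P.saddleSet B) ^ 2 : ℝ) : EReal) ≤
      (ρ : EReal) * smoothedGap P φ B ξ z) {Ψ : ℝ} (hΨ : 0 < Ψ)
    (hacc : ∀ k, AcceptsBelow P φ B a o (state P φ B a o z k) Ψ) {K : ℕ}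
    (hK : innerBound (constOne a Lφ Ψ) (constTwo a Lφ o) ρ q ξ ≤ K)
    (hb : AverageBounds P φ B a o Lφ z K) : RestartTest P φ B a ξ q o z K := by
  have hK1 := (one_le_innerBound h ha hΨ hξ (constTwo a Lφ o) ρ q).trans hK
  have hlin := linear_le_sum_sigma h ha hz hΨ hacc K
  have hK' := max_le_iff.1 (Nat.ceil_le.1 hK)
  have hd : 0 < a.γ0 * tauHat a Ψ := mul_pos ha.common.2.2.2.2.2.1 (tauHat_pos ha hΨ)
  rw [constOne_eq ha hΨ] at hK'
  obtain ⟨h1, h2⟩ := hK'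
  rw [div_le_iff₀ hq] at h1
  rw [div_le_iff₀ hξ] at h2
  have e1 : 4 * (Lφ * max a.γ0 1 / (2 * (a.γ0 * tauHat a Ψ))) * (1 + constTwo a Lφ o ^ 2) * ρ
      = 2 * (Lφ * max a.γ0 1) * (1 + constTwo a Lφ o ^ 2) * ρ / (a.γ0 * tauHat a Ψ) := by
    field_simp; ring
  have e2 : 2 * (Lφ * max a.γ0 1 / (2 * (a.γ0 * tauHat a Ψ)))
      = Lφ * max a.γ0 1 / (a.γ0 * tauHat a Ψ) := by
    field_simp
  rw [e1, div_le_iff₀ hd] at h1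
  rw [e2, div_le_iff₀ hd] at h2
  have h3 := mul_le_mul_of_nonneg_left hlin hξ.le
  have h4 := mul_le_mul_of_nonneg_left hlin hq.le
  exact hb.restartTest h ha hne hξ hq hz hgrowth hK1 (by linarith) (by linarith)

theorem AverageBounds.exists_restartTest_of_ceil_le (h : P.Regular φ Lφ) (ha : a.Admissible o)
    (hne : (P.saddleSet B).Nonempty) {ξ : ℝ} (ρ : ℝ) (hξ : 0 < ξ) {Ψ : ℝ} (hΨ : 0 < Ψ)
    (hmu : 0 < P.mu) :
    ∃ C > 0, ∀ q : ℝ, 0 < q → q < 1 → ∀ z ∈ P.domain B,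
      ((Metric.infDist z (P.saddleSet B) ^ 2 : ℝ) : EReal) ≤
        (ρ : EReal) * smoothedGap P φ B ξ z →
      (∀ k, AcceptsBelow P φ B a o (state P φ B a o z k) Ψ) →
      (∀ K, 1 ≤ K → AverageBounds P φ B a o Lφ z K) →
      ∀ K : ℕ, ⌈C / Real.sqrt q⌉₊ ≤ K → RestartTest P φ B a ξ q o z K := by
  obtain ⟨c, hc, hsum⟩ := exists_quadratic_le_sum_sigma (B := B) h ha hmu hΨ
  obtain ⟨C, hC, hK⟩ := exists_le_mul_sq_of_ceil_le hc (max (Lφ * max a.γ0 1 / ξ)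
    (2 * (Lφ * max a.γ0 1) * (1 + constTwo a Lφ o ^ 2) * ρ))
  refine ⟨C, hC, fun q hq hq1 z hz hgrowth hacc hb K hKC => ?_⟩
  have hK1 : 1 ≤ K := (Nat.ceil_pos.2 (by positivity)).trans_le hKC
  have h1 := max_le_iff.1 (hK q hq K hKC)
  have h2 := hsum z hz hacc K
  have hS := sum_sigma_pos h ha hz hK1
  have h3 := mul_le_mul_of_nonneg_left h2 hq.le
  refine (hb K hK1).restartTest h ha hne hξ hq hz hgrowth hK1 ?_ (h1.2.trans h3)
  have h4 := (h1.1.trans h3).trans (mul_le_of_le_one_left hS.le hq1.le)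
  rwa [div_le_iff₀' hξ] at h4

theorem averageBounds_xy (h : P.Regular φ Lφ) (ha : a.Admissible .xy) {z : PDSpace n p m}
    (hz : z ∈ P.domain B) {Ψ : ℝ} (hΨ : 0 < Ψ)
    (hacc : ∀ k, AcceptsBelow P φ B a .xy (state P φ B a .xy z k) Ψ) {K : ℕ} (hK : 1 ≤ K) :
    AverageBounds P φ B a .xy Lφ z K :=
  ⟨fun _ hw => sum_sigma_mul_gap_average_le_xy h ha hz hΨ hacc hK hw,
    fun _ hzs => norm_average_sub_sq_le_xy h ha hz hΨ hacc hK hzs⟩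

theorem averageBounds_yx (h : P.Regular φ Lφ) (ha : a.Admissible .yx) {z : PDSpace n p m}
    (hz : z ∈ P.domain B) {Ψ : ℝ} (hΨ : 0 < Ψ)
    (hacc : ∀ k, AcceptsBelow P φ B a .yx (state P φ B a .yx z k) Ψ) (hmu : P.mu = 0) {K : ℕ}
    (hK : 1 ≤ K) : AverageBounds P φ B a .yx Lφ z K := by
  obtain ⟨K, rfl⟩ := Nat.exists_eq_add_of_le' hK
  refine ⟨fun w hw => ?_, fun zs hzs => ?_⟩
  · refine (sum_sigma_mul_gap_average_le_yx h ha hz hΨ hacc hw).trans (le_of_eq ?_)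
    simp [runLossFactor_eq_one h ha hz hΨ hacc hmu]
  · simpa [runLoss_eq_one h ha hz hΨ hacc hmu] using
      norm_average_sub_sq_le_yx h ha hz hΨ hacc (K := K) hzs

/-! ### The restart test for the dual-first order with strong convexity -/

theorem exists_gapTerm_average_le (h : P.Regular φ Lφ) (ha : a.Admissible .yx)
    (hne : (P.saddleSet B).Nonempty) {ξ : ℝ} (hξ : 0 < ξ) {Ψ : ℝ} (hΨ : 0 < Ψ) (hmu : 0 < P.mu) :
    ∃ C > 0, ∀ z ∈ P.domain B, (∀ k, AcceptsBelow P φ B a .yx (state P φ B a .yx z k) Ψ) →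
      ∀ K : ℕ, Lφ ≤ ξ * ∑ k ∈ Finset.range (K + 1), sigma P φ B a .yx z k →
      ∀ w ∈ P.domain B, (∑ k ∈ Finset.range (K + 1), sigma P φ B a .yx z k) *
        P.gapTerm φ ξ (average P φ B a .yx z (K + 1)) w ≤
        C * runLoss P φ B a z K * Metric.infDist z (P.saddleSet B) ^ 2 := by
  have hγ0 := ha.common.2.2.2.2.2.1
  have hτ := tauHat_pos ha hΨ
  have hcα : 0 < 1 - a.cα := by linarith [ha.2.1]
  have hLφ := h.pos
  have hmax : 0 < max a.γ0 1 := lt_max_of_lt_left hγ0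
  -- One step already gives S ≥ γ0 τ̂, so γ0 ≤ S/τ̂, and this s satisfies 2s(γ0 + μ S) ≤ ξ S
  -- whatever K is.
  set s := min 1 (ξ / (2 * (P.mu + 1 / tauHat a Ψ))) with hs
  have hs0 : 0 < s := lt_min one_pos (by positivity)
  have hC3 : 0 < 2 + Lφ * (4 / (1 - a.cα) + 4) + 3 / s + 4 * ξ / P.mu := by positivity
  refine ⟨(2 + Lφ * (4 / (1 - a.cα) + 4) + 3 / s + 4 * ξ / P.mu) * (Lφ / 2 * max a.γ0 1),
    by positivity, fun z hz hacc K hSξ w hw => ?_⟩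
  obtain ⟨zs, hzs, e⟩ := exists_saddle_norm_eq h hne z
  have hU : 1 ≤ runLoss P φ B a z K := one_le_lossProd K
  have hS := sum_sigma_pos h ha hz (by omega : 1 ≤ K + 1)
  have hlin := linear_le_sum_sigma h ha hz hΨ hacc (K + 1)
  have h1 : a.γ0 ≤ 1 / tauHat a Ψ * ∑ k ∈ Finset.range (K + 1), sigma P φ B a .yx z k := by
    rw [one_div_mul_eq_div, le_div_iff₀ hτ]
    refine le_trans (le_mul_of_one_le_left (by positivity) ?_) hlin
    exact_mod_cast Nat.le_add_left 1 K
  have h2 : s * (2 * (P.mu + 1 / tauHat a Ψ)) ≤ ξ := by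
    rw [← le_div_iff₀ (by positivity)]
    exact min_le_right _ _
  have h3 := gapTerm_average_le_of_mu_pos h ha hz hΨ hacc hmu hξ hzs hs0 (min_le_left _ _)
    (K := K) (by nlinarith [mul_le_mul_of_nonneg_left h1 hs0.le, mul_le_mul_of_nonneg_right h2 hS.le])
    hSξ hw
  have h4 := initialEnergy_le h hγ0 hzs.1 hz
  rw [e] at h4
  have h5 := mul_le_mul_of_nonneg_left (mul_le_mul_of_nonneg_left h4 (zero_le_one.trans hU)) hC3.le
  linarith

theorem restartTest_of_gapTerm_average_le (h : P.Regular φ Lφ) (ha : a.Admissible .yx)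
    {ξ q ρ : ℝ} (hξ : 0 < ξ) (hq : 0 < q) {z : PDSpace n p m}
    (hz : z ∈ P.domain B) (hgrowth : ((Metric.infDist z (P.saddleSet B) ^ 2 : ℝ) : EReal) ≤
      (ρ : EReal) * smoothedGap P φ B ξ z) {K : ℕ} {C : ℝ}
    (hgap : ∀ w ∈ P.domain B, (∑ k ∈ Finset.range (K + 1), sigma P φ B a .yx z k) *
        P.gapTerm φ ξ (average P φ B a .yx z (K + 1)) w ≤
        C * Metric.infDist z (P.saddleSet B) ^ 2)
    (hCS : C * ρ ≤ q * ∑ k ∈ Finset.range (K + 1), sigma P φ B a .yx z k) :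
    RestartTest P φ B a ξ q .yx z (K + 1) := by
  have hS := sum_sigma_pos h ha hz (by omega : 1 ≤ K + 1)
  refine restartTest_of_gapTerm_le h ha hξ hq hz (by omega) hgrowth
    (D := C / ∑ k ∈ Finset.range (K + 1), sigma P φ B a .yx z k) (fun w hw => ?_) ?_
  · rw [div_mul_eq_mul_div, le_div_iff₀' hS]
    exact hgap w hw
  · rwa [div_mul_eq_mul_div, div_le_iff₀ hS]

/-- The loss is O(√γ_K), while γ_K = γ0 + μ S_K and γ0 is at most S_{K+1}/τ̂. Hence U = O(√S), so
the loss divided by S tends to 0 as S grows. -/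
theorem runLoss_sq_le (h : P.Regular φ Lφ) (ha : a.Admissible .yx) {z : PDSpace n p m}
    (hz : z ∈ P.domain B) {Ψ : ℝ} (hΨ : 0 < Ψ)
    (hacc : ∀ k, AcceptsBelow P φ B a .yx (state P φ B a .yx z k) Ψ) (K : ℕ) :
    runLoss P φ B a z K ^ 2 * a.γ0 ≤ (1 + P.mu * a.τbar / 2) ^ 2 *
      ((1 / tauHat a Ψ + P.mu) * ∑ k ∈ Finset.range (K + 1), sigma P φ B a .yx z k) := by
  have hseq := stepSequence h ha hz hΨ hacc
  refine (hseq.lossProd_sq_le K).trans (mul_le_mul_of_nonneg_left ?_ (sq_nonneg _))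
  have hτ := tauHat_pos ha hΨ
  have hγ0 := ha.common.2.2.2.2.2.1
  have h1 := hseq.sum_eq K
  have hlin := linear_le_sum_sigma h ha hz hΨ hacc (K + 1)
  have h2 : a.γ0 ≤ 1 / tauHat a Ψ * ∑ k ∈ Finset.range (K + 1), sigma P φ B a .yx z k := by
    rw [one_div_mul_eq_div, le_div_iff₀ hτ]
    refine le_trans (le_mul_of_one_le_left (by positivity) ?_) hlin
    exact_mod_cast Nat.le_add_left 1 K
  have h3 : P.mu * ∑ k ∈ Finset.range K, sigma P φ B a .yx z k
      ≤ P.mu * ∑ k ∈ Finset.range (K + 1), sigma P φ B a .yx z k := by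
    refine mul_le_mul_of_nonneg_left ?_ h.mu_nonneg
    rw [Finset.sum_range_succ]
    linarith [sigma_pos (P := P) (φ := φ) (B := B) (a := a) h ha hz K]
  rw [sum_sigma_eq .yx z K] at h3
  rw [h1] at h3
  linarith

/-- With U² ≤ A S, the requirement C U ρ ≤ q S follows from S ≥ (C ρ)² A / q², and linear growth of
S reaches this threshold. -/
theorem exists_restartTest_yx_of_mu_pos (h : P.Regular φ Lφ) (ha : a.Admissible .yx)
    (hne : (P.saddleSet B).Nonempty) {ξ q ρ : ℝ} (hξ : 0 < ξ) (hq : 0 < q) {Ψ : ℝ}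
    (hΨ : 0 < Ψ) (hmu : 0 < P.mu) :
    ∃ N : ℕ, 1 ≤ N ∧ ∀ z ∈ P.domain B, ((Metric.infDist z (P.saddleSet B) ^ 2 : ℝ) : EReal) ≤
        (ρ : EReal) * smoothedGap P φ B ξ z →
      (∀ k, AcceptsBelow P φ B a .yx (state P φ B a .yx z k) Ψ) →
      ∀ K : ℕ, N ≤ K → RestartTest P φ B a ξ q .yx z K := by
  obtain ⟨C, hC, hgap⟩ := exists_gapTerm_average_le h ha hne hξ hΨ hmu
  have hγ0 := ha.common.2.2.2.2.2.1
  have hd : 0 < a.γ0 * tauHat a Ψ := mul_pos hγ0 (tauHat_pos ha hΨ)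
  set A := (1 + P.mu * a.τbar / 2) ^ 2 * (1 / tauHat a Ψ + P.mu) / a.γ0 with hA
  obtain ⟨N, hN⟩ := exists_nat_ge (max (Lφ / ξ) ((C * ρ) ^ 2 * A / q ^ 2) / (a.γ0 * tauHat a Ψ))
  refine ⟨N + 1, by omega, fun z hz hgrowth hacc K hK => ?_⟩
  obtain ⟨K, rfl⟩ := Nat.exists_eq_add_of_le' ((Nat.le_add_left 1 N).trans hK)
  have hS := sum_sigma_pos h ha hz (by omega : 1 ≤ K + 1)
  have hlin := linear_le_sum_sigma h ha hz hΨ hacc (K + 1)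
  have hNK : (N : ℝ) ≤ ((K + 1 : ℕ) : ℝ) := by exact_mod_cast (by omega : N ≤ K + 1)
  rw [div_le_iff₀ hd] at hN
  have h1 := max_le_iff.1 ((hN.trans (mul_le_mul_of_nonneg_right hNK hd.le)).trans hlin)
  rw [div_le_iff₀ (by positivity), div_le_iff₀ (by positivity)] at h1
  have hU := zero_le_one.trans (one_le_lossProd (μ := P.mu)
    (γ := fun k => (state P φ B a .yx z k).γ) (t := fun k => (state P φ B a .yx z k).τPrev) K)
  have hloss := runLoss_sq_le h ha hz hΨ hacc K
  refine restartTest_of_gapTerm_average_le h ha hξ hq hz hgrowth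
    (hgap z hz hacc K (by linarith [h1.1])) ?_
  set S := ∑ k ∈ Finset.range (K + 1), sigma P φ B a .yx z k
  have h2 : runLoss P φ B a z K ^ 2 ≤ A * S := by
    rw [hA, div_mul_eq_mul_div, le_div_iff₀ hγ0]
    linarith
  refine le_of_sq_le_sq ?_ (mul_pos hq hS).le
  calc (C * runLoss P φ B a z K * ρ) ^ 2 = (C * ρ) ^ 2 * runLoss P φ B a z K ^ 2 := by ring
    _ ≤ (C * ρ) ^ 2 * (A * S) := mul_le_mul_of_nonneg_left h2 (sq_nonneg _)
    _ = (C * ρ) ^ 2 * A * S := by ring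
    _ ≤ S * q ^ 2 * S := mul_le_mul_of_nonneg_right h1.2 hS.le
    _ = (q * S) ^ 2 := by ring

/-- The loss is now bounded by the constant `E`, so the quadratic growth of S acts in full and
yields the order 1/√q. -/
theorem exists_restartTest_yx_of_cnm_eq_zero (h : P.Regular φ Lφ) (ha : a.Admissible .yx)
    (hne : (P.saddleSet B).Nonempty) {ξ ρ : ℝ} (hξ : 0 < ξ) (hρ : 0 < ρ) {Ψ : ℝ}
    (hΨ : 0 < Ψ) (hmu : 0 < P.mu) (hcnm : a.cnm = 0) :
    ∃ C > 0, ∀ q : ℝ, 0 < q → q < 1 → ∀ z ∈ P.domain B,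
      ((Metric.infDist z (P.saddleSet B) ^ 2 : ℝ) : EReal) ≤
        (ρ : EReal) * smoothedGap P φ B ξ z →
      (∀ k, AcceptsBelow P φ B a .yx (state P φ B a .yx z k) Ψ) →
      ∀ K : ℕ, ⌈C / Real.sqrt q⌉₊ ≤ K → RestartTest P φ B a ξ q .yx z K := by
  obtain ⟨C₁, hC₁, hgap⟩ := exists_gapTerm_average_le h ha hne hξ hΨ hmu
  obtain ⟨c, hc, hsum⟩ := exists_quadratic_le_sum_sigma (B := B) h ha hmu hΨ
  set E := Real.exp (P.mu * a.τbar / 2 * (Real.log (a.γ0 * a.τbar ^ 2)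
    - Real.log (a.γ0 * tauHat a Ψ ^ 2)))
  obtain ⟨C, hC, hK⟩ := exists_le_mul_sq_of_ceil_le hc (max (Lφ / ξ) (C₁ * E * ρ))
  refine ⟨C, hC, fun q hq hq1 z hz hgrowth hacc K hKC => ?_⟩
  have hK1 : 1 ≤ K := (Nat.ceil_pos.2 (by positivity)).trans_le hKC
  have h1 := max_le_iff.1 (hK q hq K hKC)
  obtain ⟨K, rfl⟩ := Nat.exists_eq_add_of_le' hK1
  have h3 := mul_le_mul_of_nonneg_left (hsum z hz hacc (K + 1)) hq.le
  have hS := sum_sigma_pos h ha hz hK1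
  have h4 := (h1.1.trans h3).trans (mul_le_of_le_one_left hS.le hq1.le)
  rw [div_le_iff₀' hξ] at h4
  have hU : runLoss P φ B a z K ≤ E :=
    (stepSequence h ha hz hΨ hacc).lossProd_le_of_cnm_eq_zero hcnm K
  refine restartTest_of_gapTerm_average_le h ha hξ hq hz hgrowth (hgap z hz hacc K h4) ?_
  refine le_trans ?_ (h1.2.trans h3)
  gcongr

end Apdb

namespace Apdb

open ConicProgram StepSequence

variable {n p m : ℕ} {P : ConicProgram n p m} {φ : BregmanPair n p m} {B : ENNReal}
  {a : StepParams} {Lφ : ℝ} {o : UpdateOrder}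

/-! ### The restarted method -/

/-- Taking the least uniform length lets a single `Kbar` obey all upper bounds at once, including
those for Lipschitz constants quantified after it. -/
theorem exists_minimal_uniform_length {ξ q : ℝ} {T : Set (PDSpace n p m)} (o : UpdateOrder)
    (hN : ∃ N, 1 ≤ N ∧ ∀ z ∈ T, ∀ K, N ≤ K → RestartTest P φ B a ξ q o z K) :
    ∃ Kbar, 1 ≤ Kbar ∧ (∀ z ∈ T, ∀ K, Kbar ≤ K → RestartTest P φ B a ξ q o z K) ∧
      ∀ N, 1 ≤ N → (∀ z ∈ T, ∀ K, N ≤ K → RestartTest P φ B a ξ q o z K) → Kbar ≤ N := by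
  classical
  exact ⟨Nat.find hN, (Nat.find_spec hN).1, (Nat.find_spec hN).2,
    fun N h1 h2 => Nat.find_min' hN ⟨h1, h2⟩⟩

section Restart

variable {ξ q : ℝ} {T : Set (PDSpace n p m)} {Kbar : ℕ}
  (htest : ∀ z ∈ T, ∀ K, Kbar ≤ K → RestartTest P φ B a ξ q o z K) (hKbar : 1 ≤ Kbar)
include htest hKbar

theorem innerLength_spec {z : PDSpace n p m} (hz : z ∈ T) :
    (1 ≤ innerLength P φ B a ξ q o z ∧
      RestartTest P φ B a ξ q o z (innerLength P φ B a ξ q o z)) ∧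
      innerLength P φ B a ξ q o z ≤ Kbar := by
  have hmem : Kbar ∈ {K : ℕ | 1 ≤ K ∧ RestartTest P φ B a ξ q o z K} :=
    ⟨hKbar, htest z hz Kbar le_rfl⟩
  exact ⟨Nat.sInf_mem ⟨Kbar, hmem⟩, Nat.sInf_le hmem⟩

theorem restartPoint_mem (h : P.Regular φ Lφ) (ha : a.Admissible o) {z₀ : PDSpace n p m}
    (hz₀ : z₀ ∈ P.domain B)
    (hT : ∀ t, restartPoint P φ B a ξ q o z₀ t ∈ P.domain B →
      restartPoint P φ B a ξ q o z₀ t ∈ T) (t : ℕ) :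
    restartPoint P φ B a ξ q o z₀ t ∈ P.domain B := by
  induction t with
  | zero => exact hz₀
  | succ t ih => exact average_mem h ha ih (innerLength_spec htest hKbar (hT t ih)).1.1

theorem restart_converges (h : P.Regular φ Lφ) (ha : a.Admissible o)
    (hne : (P.saddleSet B).Nonempty) {ρ C Ψ : ℝ} (hξ : 0 < ξ) (hρ : 0 < ρ) (hq : 0 < q) (hq1 : q < 1)
    (hΨ : 0 < Ψ) (hTB : T ⊆ P.domain B)
    (hacc : ∀ z ∈ T, ∀ k, AcceptsBelow P φ B a o (state P φ B a o z k) Ψ)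
    (hgrowth : ∀ z ∈ T, ((Metric.infDist z (P.saddleSet B) ^ 2 : ℝ) : EReal) ≤
      (ρ : EReal) * smoothedGap P φ B ξ z)
    (hC : ∀ z ∈ T, ∀ K, 1 ≤ K → K ≤ Kbar → ∀ zs ∈ P.saddleSet B,
      ‖average P φ B a o z K - zs‖ ^ 2 ≤ C * ‖zs - z‖ ^ 2)
    {z₀ : PDSpace n p m} (hz₀ : z₀ ∈ P.domain B) {z : ℕ → PDSpace n p m}
    (hz : z = restartPoint P φ B a ξ q o z₀) (hzT : ∀ t, z t ∈ P.domain B → z t ∈ T) :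
    (∀ t k : ℕ, ∃ j : ℕ, Accepts P φ B a o (state P φ B a o (z t) k)
      (a.η ^ j * (state P φ B a o (z t) k).τtrial)) ∧
    (∀ t : ℕ, ∀ K : ℕ, Kbar ≤ K → RestartTest P φ B a ξ q o (z t) K) ∧
    (∀ t : ℕ, 1 ≤ innerLength P φ B a ξ q o (z t) ∧
      innerLength P φ B a ξ q o (z t) ≤ Kbar) ∧
    smoothedGap P φ B ξ z₀ ≠ ⊤ ∧
    (∀ t : ℕ, z t ∈ P.domain B ∧
      smoothedGap P φ B ξ (z t) ≤ ((q ^ t : ℝ) : EReal) * smoothedGap P φ B ξ z₀ ∧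
      ((Metric.infDist (z t) (P.saddleSet B) ^ 2 : ℝ) : EReal) ≤
        ((q ^ t * ρ : ℝ) : EReal) * smoothedGap P φ B ξ z₀) ∧
    ∃ zlim ∈ P.saddleSet B, Filter.Tendsto z Filter.atTop (nhds zlim) ∧
      ∃ c : ℝ, ∀ t : ℕ, ‖z t - zlim‖ ≤ c * Real.sqrt q ^ t := by
  have hmem : ∀ t, z t ∈ T := fun t => by
    subst hz
    exact hzT t (restartPoint_mem htest hKbar h ha hz₀ hzT t)
  have hlen := fun t => innerLength_spec htest hKbar (hmem t)
  have hsucc : ∀ t, z (t + 1) = average P φ B a o (z t) (innerLength P φ B a ξ q o (z t)) :=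
    fun t => by rw [hz]; rfl
  have hzero : z 0 = z₀ := by rw [hz]; rfl
  choose G hG0 hG using fun t => h.exists_smoothedGap_eq hξ (hTB (hmem t))
  have hstep : ∀ t, G (t + 1) ≤ q * G t := fun t => by
    have h1 := (hlen t).1.2
    rwa [RestartTest, ← hsucc, hG, hG, ← EReal.coe_mul, EReal.coe_le_coe_iff] at h1
  have hgeom : ∀ t, G t ≤ q ^ t * G 0 := fun t => by
    induction t with
    | zero => simp
    | succ t ih =>
      calc _ ≤ q * G t := hstep t
        _ ≤ q * (q ^ t * G 0) := mul_le_mul_of_nonneg_left ih hq.le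
        _ = _ := by ring
  have hdist : ∀ t, Metric.infDist (z t) (P.saddleSet B) ^ 2 ≤ q ^ t * ρ * G 0 := fun t => by
    have h1 := hgrowth (z t) (hmem t)
    rw [hG, ← EReal.coe_mul, EReal.coe_le_coe_iff] at h1
    linarith [mul_le_mul_of_nonneg_left (hgeom t) hρ.le]
  have hgap₀ : smoothedGap P φ B ξ z₀ = (G 0 : EReal) := by rw [← hzero, hG]
  have hr0 : 0 < Real.sqrt q := Real.sqrt_pos.2 hq
  have hr1 : Real.sqrt q < 1 := (Real.sqrt_lt' one_pos).2 (by simpa using hq1)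
  have hsqrt : ∀ t, Real.sqrt (q ^ t) = Real.sqrt q ^ t := fun t => by
    rw [Real.sqrt_eq_iff_eq_sq (by positivity) (by positivity), ← pow_mul, mul_comm, pow_mul,
      Real.sq_sqrt hq.le]
  have hdist' : ∀ t, Metric.infDist (z t) (P.saddleSet B) ≤ Real.sqrt (ρ * G 0) * Real.sqrt q ^ t :=
    fun t => by
      have h1 := Real.sqrt_le_sqrt (hdist t)
      rwa [Real.sqrt_sq Metric.infDist_nonneg, mul_assoc, Real.sqrt_mul (by positivity), hsqrt,
        mul_comm] at h1
  -- Both endpoints are within a multiple of dist(z t) of the saddle point nearest to z t, so the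
  -- moves are summable like √q ^ t.
  have hmove : ∀ t, dist (z t) (z (t + 1)) ≤
      (Real.sqrt C + 1) * Real.sqrt (ρ * G 0) * Real.sqrt q ^ t := fun t => by
    obtain ⟨zs, hzs, e⟩ := exists_saddle_norm_eq h hne (z t)
    have h1 := Real.sqrt_le_sqrt (hC (z t) (hmem t) _ (hlen t).1.1 (hlen t).2 zs hzs)
    rw [Real.sqrt_sq (norm_nonneg _), Real.sqrt_mul' _ (sq_nonneg _), Real.sqrt_sq (norm_nonneg _),
      ← hsucc] at h1
    have h2 := norm_sub_le_norm_sub_add_norm_sub (z (t + 1)) zs (z t)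
    rw [e] at h2
    rw [dist_comm, dist_eq_norm]
    rw [e] at h1
    have h3 := mul_le_mul_of_nonneg_left (hdist' t) (by positivity : 0 ≤ Real.sqrt C + 1)
    linarith
  obtain ⟨zlim, hlim⟩ := cauchySeq_tendsto_of_complete (cauchySeq_of_le_geometric _ _ hr1 hmove)
  refine ⟨fun t k => ?_, fun t => htest (z t) (hmem t), fun t => ⟨(hlen t).1.1, (hlen t).2⟩,
    by rw [hgap₀]; exact EReal.coe_ne_top _, fun t => ⟨hTB (hmem t), ?_, ?_⟩, zlim, ?_, hlim,
    (Real.sqrt C + 1) * Real.sqrt (ρ * G 0) / (1 - Real.sqrt q), fun t => ?_⟩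
  · exact exists_accepts ha (valid_state h ha (hTB (hmem t)) k) hΨ (hacc (z t) (hmem t) k)
  · rw [hG, hgap₀, ← EReal.coe_mul, EReal.coe_le_coe_iff]
    exact hgeom t
  · rw [hgap₀, ← EReal.coe_mul, EReal.coe_le_coe_iff]
    exact hdist t
  · rw [(h.isClosed_saddleSet B).mem_iff_infDist_zero hne]
    have h1 := ((Metric.continuous_infDist_pt (P.saddleSet B)).tendsto zlim).comp hlim
    have h2 : Filter.Tendsto (fun t : ℕ => Real.sqrt (ρ * G 0) * Real.sqrt q ^ t) Filter.atTop
        (nhds (Real.sqrt (ρ * G 0) * 0)) :=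
      (tendsto_pow_atTop_nhds_zero_of_lt_one hr0.le hr1).const_mul _
    rw [mul_zero] at h2
    exact le_antisymm (le_of_tendsto_of_tendsto' h1 h2 hdist') Metric.infDist_nonneg
  · have h1 := dist_le_of_le_geometric_of_tendsto _ _ hr1 hmove hlim t
    rw [dist_eq_norm] at h1
    rwa [div_mul_eq_mul_div]

end Restart

/-! ### Step sizes that pass the backtracking test -/

theorem exists_lipschitz_yx (h : P.Regular φ Lφ) {R : ℝ} (hR : 0 ≤ R) :
    ∃ Lxx Lyx : ℝ, 0 < Lxx ∧ 0 < Lyx ∧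
      ∀ x ∈ P.X, ∀ x' ∈ P.X, ∀ y ∈ P.dualDomain (ENNReal.ofReal R),
        ‖P.gradX x' y - P.gradX x y‖ ≤ Lxx * ‖x' - x‖ ∧
        ‖P.gradY x' y - P.gradY x y‖ ≤ Lyx * ‖x' - x‖ := by
  obtain ⟨Lf, Lg, hLf, hLg, H⟩ := exists_lipschitz_gradX h.smooth
  obtain ⟨L, hL, H'⟩ := exists_lipschitz_constr h.smooth h.isCompact_X h.convex_X
  refine ⟨Lf + Lg * R + 1, L, by positivity, hL, fun x hx x' hx' y hy => ⟨?_, ?_⟩⟩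
  · refine (H x hx x' hx' y).trans (mul_le_mul_of_nonneg_right ?_ (norm_nonneg _))
    have := mul_le_mul_of_nonneg_left ((P.mem_dualDomain_ofReal hR).1 hy).2 hLg
    linarith
  · rw [gradY_eq, gradY_eq]
    exact H' x hx x' hx'

theorem exists_acceptsBelow_xy (h : P.Regular φ Lφ) (ha : a.Admissible .xy)
    (hne : (P.saddleSet B).Nonempty) (M : ℝ) :
    ∃ Ψ > 0, ∀ z ∈ P.domain B, ‖z‖ ≤ M →
      ∀ k, AcceptsBelow P φ B a .xy (state P φ B a .xy z k) Ψ := by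
  obtain ⟨zs, hzs⟩ := hne
  obtain ⟨Lf, Lg, hLf, hLg, H⟩ := exists_lipschitz_gradX h.smooth
  obtain ⟨L, hL, H'⟩ := exists_lipschitz_gradX_dual h.smooth h.isCompact_X
  -- One fixed saddle point serves all starting points of norm at most M: its initial energy is
  -- bounded through ‖zs - z‖ ≤ ‖zs‖ + M.
  set R := ‖zs.snd‖ + Real.sqrt (2 * (Lφ / 2 * max a.γ0 1 * (‖zs‖ + M) ^ 2)) + 1 with hR
  have hR0 : 0 < R := by positivity
  have hLxx : 0 < Lf + Lg * R + 1 := by positivity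
  refine ⟨_, psiXY_pos ha hLxx hL, fun z hz hzM k =>
    (energy_xy_le_and_acceptsBelow h ha hz hR0 hLxx hL (fun x hx x' hx' y hy => ?_)
      (fun x hx y _ y' _ => H' x hx y y') hzs ?_ k).2⟩
  · refine (H x hx x' hx' y).trans (mul_le_mul_of_nonneg_right ?_ (norm_nonneg _))
    have := mul_le_mul_of_nonneg_left ((P.mem_dualDomain_ofReal hR0.le).1 hy).2 hLg
    linarith
  · have h1 := initialEnergy_le h ha.common.2.2.2.2.2.1 hzs.1 hz
    have h2 : ‖zs - z‖ ≤ ‖zs‖ + M := (norm_sub_le _ _).trans (by linarith)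
    have hmax : 0 < max a.γ0 1 := lt_max_of_lt_right one_pos
    have hLφ := h.pos
    have h3 := h1.trans (mul_le_mul_of_nonneg_left (pow_le_pow_left₀ (norm_nonneg _) h2 2)
      (by positivity : 0 ≤ Lφ / 2 * max a.γ0 1))
    rw [initialEnergy] at h3
    have h4 : Real.sqrt (2 * a.γ0 * bregman φ.phiP zs.fst z.fst + 2 * bregman φ.phiD zs.snd z.snd)
        ≤ Real.sqrt (2 * (Lφ / 2 * max a.γ0 1 * (‖zs‖ + M) ^ 2)) :=
      Real.sqrt_le_sqrt (by linarith)
    linarith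

/-- A crude bound for each fixed K. It enters only the constant of the Cauchy argument, where inner
loops have length at most `Kbar`. -/
theorem exists_runLoss_le (h : P.Regular φ Lφ) (ha : a.Admissible .yx) {Ψ : ℝ} (hΨ : 0 < Ψ)
    (K : ℕ) :
    ∃ U : ℝ, ∀ z ∈ P.domain B, (∀ k, AcceptsBelow P φ B a .yx (state P φ B a .yx z k) Ψ) →
      runLoss P φ B a z K ≤ U := by
  have hγ0 := ha.common.2.2.2.2.2.1
  refine ⟨(1 + P.mu * a.τbar / 2) ^ 2 *
    (a.γ0 * ∏ j ∈ Finset.range K, (1 + P.mu * (2 ^ (j + 1) * a.τbar))) / a.γ0,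
    fun z hz hacc => ?_⟩
  have hseq := stepSequence h ha hz hΨ hacc
  rw [le_div_iff₀ hγ0]
  have hU : 1 ≤ runLoss P φ B a z K := one_le_lossProd K
  have h1 : runLoss P φ B a z K ≤ runLoss P φ B a z K ^ 2 := le_self_pow₀ hU two_ne_zero
  exact (mul_le_mul_of_nonneg_right h1 hγ0.le).trans ((hseq.lossProd_sq_le K).trans
    (mul_le_mul_of_nonneg_left (hseq.γ_le K) (sq_nonneg _)))

end Apdb

/-! ### The main theorem -/

theorem mainTheorem5 {n p m : ℕ} (P : ConicProgram n p m) (φ : BregmanPair n p m) (Lφ ξ : ℝ)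
    (hsets : P.SetsAssumption) (hsmooth : P.SmoothnessAssumption)
    (hsaddle : (P.saddleSet ⊤).Nonempty)
    (hLφ : 0 < Lφ)
    (hphiP : IsDistanceGenerating φ.phiP P.X Lφ)
    (hphiD : IsDistanceGenerating φ.phiD (P.dualDomain ⊤) Lφ)
    (hmu : 0 < P.mu → φ.phiP = fun x => (1 / 2 : ℝ) * ‖x‖ ^ 2)
    (hξ : 0 < ξ) :
    -- dual-first order, restricted dual domain with a finite radius `B`
    (∀ (Bbar Bval : ℝ) (B : ENNReal), 0 < Bbar →
      (P.dualSolutions ∩ {y | ‖y‖ ≤ Bbar}).Nonempty → Bbar < Bval → B = ENNReal.ofReal Bval →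
      P.MetricSubregularity B →
      ∃ ρ : ℝ, 0 < ρ ∧
        (∀ z ∈ P.domain B, ((Metric.infDist z (P.saddleSet B) ^ 2 : ℝ) : EReal) ≤
          (ρ : EReal) * smoothedGap P φ B ξ z) ∧
        ∀ a : StepParams, a.Admissible .yx →
        ∃ C : ℝ, 0 < C ∧ ∀ q : ℝ, 0 < q → q < 1 →
        ∃ Kbar : ℕ, 1 ≤ Kbar ∧
          (P.mu = 0 → ∀ Lxx Lyx : ℝ, 0 < Lxx → 0 < Lyx →
            (∀ x ∈ P.X, ∀ x' ∈ P.X, ∀ y ∈ P.dualDomain B,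
              ‖P.gradX x' y - P.gradX x y‖ ≤ Lxx * ‖x' - x‖ ∧
              ‖P.gradY x' y - P.gradY x y‖ ≤ Lyx * ‖x' - x‖) →
            Kbar ≤ innerBound (constOne a Lφ (psiYX a Lxx Lyx)) (constTwo a Lφ .yx) ρ q ξ) ∧
          (0 < P.mu → a.cnm = 0 → Kbar ≤ ⌈C / Real.sqrt q⌉₊) ∧
          ∀ z₀ ∈ P.domain B, ∀ z : ℕ → PDSpace n p m,
            z = Apdb.restartPoint P φ B a ξ q .yx z₀ →
            (∀ t k : ℕ, ∃ j : ℕ, Apdb.Accepts P φ B a .yx (Apdb.state P φ B a .yx (z t) k)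
              (a.η ^ j * (Apdb.state P φ B a .yx (z t) k).τtrial)) ∧
            (∀ t : ℕ, ∀ K : ℕ, Kbar ≤ K → Apdb.RestartTest P φ B a ξ q .yx (z t) K) ∧
            (∀ t : ℕ, 1 ≤ Apdb.innerLength P φ B a ξ q .yx (z t) ∧
              Apdb.innerLength P φ B a ξ q .yx (z t) ≤ Kbar) ∧
            smoothedGap P φ B ξ z₀ ≠ ⊤ ∧
            (∀ t : ℕ, z t ∈ P.domain B ∧
              smoothedGap P φ B ξ (z t) ≤ ((q ^ t : ℝ) : EReal) * smoothedGap P φ B ξ z₀ ∧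
              ((Metric.infDist (z t) (P.saddleSet B) ^ 2 : ℝ) : EReal) ≤
                ((q ^ t * ρ : ℝ) : EReal) * smoothedGap P φ B ξ z₀) ∧
            ∃ zlim ∈ P.saddleSet B, Filter.Tendsto z Filter.atTop (nhds zlim) ∧
              ∃ c : ℝ, ∀ t : ℕ, ‖z t - zlim‖ ≤ c * Real.sqrt q ^ t) ∧
    -- primal-first order, unrestricted dual domain, bounded restart points
    (P.MetricSubregularity ⊤ → ∀ M : ℝ,
      ∃ ρ : ℝ, 0 < ρ ∧
        (∀ z ∈ P.domain ⊤, ‖z‖ ≤ M → ((Metric.infDist z (P.saddleSet ⊤) ^ 2 : ℝ) : EReal) ≤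
          (ρ : EReal) * smoothedGap P φ ⊤ ξ z) ∧
        ∀ a : StepParams, a.Admissible .xy →
        ∃ C : ℝ, 0 < C ∧ ∀ q : ℝ, 0 < q → q < 1 →
        ∃ Kbar : ℕ, 1 ≤ Kbar ∧
          (P.mu = 0 → ∀ R Lxx Lxy : ℝ, 0 < R → 0 < Lxx → 0 < Lxy →
            (∀ z ∈ P.domain ⊤, ‖z‖ ≤ M → ∃ zs ∈ P.saddleSet ⊤,
              ‖zs.snd‖ + Real.sqrt (2 * a.γ0 * bregman φ.phiP zs.fst z.fst +
                2 * bregman φ.phiD zs.snd z.snd) ≤ R) →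
            (∀ x ∈ P.X, ∀ x' ∈ P.X, ∀ y ∈ P.dualDomain (ENNReal.ofReal R),
              ‖P.gradX x' y - P.gradX x y‖ ≤ Lxx * ‖x' - x‖) →
            (∀ x ∈ P.X, ∀ y ∈ P.dualDomain (ENNReal.ofReal R),
              ∀ y' ∈ P.dualDomain (ENNReal.ofReal R),
              ‖P.gradX x y' - P.gradX x y‖ ≤ Lxy * ‖y' - y‖) →
            Kbar ≤ innerBound (constOne a Lφ (psiXY a Lxx Lxy)) (constTwo a Lφ .xy) ρ q ξ) ∧
          (0 < P.mu → Kbar ≤ ⌈C / Real.sqrt q⌉₊) ∧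
          ∀ z₀ ∈ P.domain ⊤, ∀ z : ℕ → PDSpace n p m,
            z = Apdb.restartPoint P φ ⊤ a ξ q .xy z₀ →
            (∀ t : ℕ, ‖z t‖ ≤ M) →
            (∀ t k : ℕ, ∃ j : ℕ, Apdb.Accepts P φ ⊤ a .xy (Apdb.state P φ ⊤ a .xy (z t) k)
              (a.η ^ j * (Apdb.state P φ ⊤ a .xy (z t) k).τtrial)) ∧
            (∀ t : ℕ, ∀ K : ℕ, Kbar ≤ K → Apdb.RestartTest P φ ⊤ a ξ q .xy (z t) K) ∧
            (∀ t : ℕ, 1 ≤ Apdb.innerLength P φ ⊤ a ξ q .xy (z t) ∧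
              Apdb.innerLength P φ ⊤ a ξ q .xy (z t) ≤ Kbar) ∧
            smoothedGap P φ ⊤ ξ z₀ ≠ ⊤ ∧
            (∀ t : ℕ, z t ∈ P.domain ⊤ ∧
              smoothedGap P φ ⊤ ξ (z t) ≤ ((q ^ t : ℝ) : EReal) * smoothedGap P φ ⊤ ξ z₀ ∧
              ((Metric.infDist (z t) (P.saddleSet ⊤) ^ 2 : ℝ) : EReal) ≤
                ((q ^ t * ρ : ℝ) : EReal) * smoothedGap P φ ⊤ ξ z₀) ∧
            ∃ zlim ∈ P.saddleSet ⊤, Filter.Tendsto z Filter.atTop (nhds zlim) ∧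
              ∃ c : ℝ, ∀ t : ℕ, ‖z t - zlim‖ ≤ c * Real.sqrt q ^ t) := by
  have h : P.Regular φ Lφ := ⟨hsets, hsmooth, hLφ, hphiP, hphiD, hmu⟩
  refine ⟨fun Bbar Bval B hBbar hdual hBval hB hsub => ?_, fun hsub M => ?_⟩
  · have hBval0 : 0 ≤ Bval := (hBbar.trans hBval).le
    have hne : (P.saddleSet B).Nonempty := by
      rw [hB]
      exact ConicProgram.saddleSet_nonempty_of_dualSolution hBbar hBval hsaddle hdual
    -- For finite B the whole domain is bounded, so the growth estimate on a ball is global.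
    obtain ⟨M, hM⟩ : ∃ M : ℝ, ∀ z ∈ P.domain B, ‖z‖ ≤ M := by
      obtain ⟨r, hr⟩ := hsets.2.1.isBounded.exists_norm_le
      refine ⟨r + Bval, fun z hz => ?_⟩
      have h1 := WithLp.prod_norm_eq_of_L2 z
      have h2 := hr z.fst hz.1
      have h3 := ((P.mem_dualDomain_ofReal hBval0).1 (hB ▸ hz.2)).2
      have h4 := norm_nonneg z.fst
      have h5 := norm_nonneg z.snd
      rw [h1]
      exact Real.sqrt_le_iff.2 ⟨by linarith, by nlinarith⟩
    obtain ⟨ρ, hρ, hgrowth'⟩ := h.exists_quadratic_growth hξ hsub M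
    have hgrowth := fun z hz => hgrowth' z hz (hM z hz)
    refine ⟨ρ, hρ, hgrowth, fun a ha => ?_⟩
    have hacc : ∀ Lxx Lyx : ℝ, 0 < Lxx → 0 < Lyx →
        (∀ x ∈ P.X, ∀ x' ∈ P.X, ∀ y ∈ P.dualDomain B,
          ‖P.gradX x' y - P.gradX x y‖ ≤ Lxx * ‖x' - x‖ ∧
          ‖P.gradY x' y - P.gradY x y‖ ≤ Lyx * ‖x' - x‖) →
        ∀ z ∈ P.domain B, ∀ k, Apdb.AcceptsBelow P φ B a .yx (Apdb.state P φ B a .yx z k)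
          (psiYX a Lxx Lyx) := fun Lxx Lyx hxx hyx hL z hz k =>
      Apdb.acceptsBelow_yx h ha (Apdb.valid_state h ha hz k) hxx hyx hL
    obtain ⟨Lxx, Lyx, hxx, hyx, hL⟩ := Apdb.exists_lipschitz_yx h hBval0
    rw [← hB] at hL
    have hΨ := psiYX_pos ha hxx hyx
    have hacc₀ := hacc Lxx Lyx hxx hyx hL
    have hmu0 : P.mu = 0 → ∀ q : ℝ, 0 < q → ∀ Lxx Lyx : ℝ, 0 < Lxx → 0 < Lyx →
        (∀ x ∈ P.X, ∀ x' ∈ P.X, ∀ y ∈ P.dualDomain B,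
          ‖P.gradX x' y - P.gradX x y‖ ≤ Lxx * ‖x' - x‖ ∧
          ‖P.gradY x' y - P.gradY x y‖ ≤ Lyx * ‖x' - x‖) →
        ∀ z ∈ P.domain B, ∀ K,
          innerBound (constOne a Lφ (psiYX a Lxx Lyx)) (constTwo a Lφ .yx) ρ q ξ ≤ K →
          Apdb.RestartTest P φ B a ξ q .yx z K := fun hmu0 q hq Lxx Lyx hxx hyx hL z hz K hK =>
      have hΨ := psiYX_pos ha hxx hyx
      have hacc := hacc Lxx Lyx hxx hyx hL z hz
      Apdb.AverageBounds.restartTest_of_innerBound_le h ha hne hξ hq hz (hgrowth z hz) hΨ hacc hK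
        (Apdb.averageBounds_yx h ha hz hΨ hacc hmu0
          ((Apdb.one_le_innerBound h ha hΨ hξ _ _ _).trans hK))
    have hmupos : ∃ C : ℝ, 0 < C ∧ (0 < P.mu → a.cnm = 0 → ∀ q : ℝ, 0 < q → q < 1 →
        ∀ z ∈ P.domain B, ∀ K : ℕ, ⌈C / Real.sqrt q⌉₊ ≤ K →
          Apdb.RestartTest P φ B a ξ q .yx z K) := by
      by_cases hc : 0 < P.mu ∧ a.cnm = 0
      · obtain ⟨C, hC, H⟩ := Apdb.exists_restartTest_yx_of_cnm_eq_zero h ha hne hξ hρ hΨ hc.1 hc.2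
        exact ⟨C, hC, fun _ _ q hq hq1 z hz => H q hq hq1 z hz (hgrowth z hz) (hacc₀ z hz)⟩
      · exact ⟨1, one_pos, fun h1 h2 => absurd ⟨h1, h2⟩ hc⟩
    obtain ⟨C, hC, hmupos⟩ := hmupos
    refine ⟨C, hC, fun q hq hq1 => ?_⟩
    obtain ⟨Kbar, hKbar, htest, hmin⟩ := Apdb.exists_minimal_uniform_length
      (P := P) (φ := φ) (B := B) (a := a) (ξ := ξ) (q := q) (T := P.domain B) .yx (by
        rcases hsmooth.1.eq_or_lt with h0 | h0
        · exact ⟨_, Apdb.one_le_innerBound h ha hΨ hξ _ _ _, hmu0 h0.symm q hq Lxx Lyx hxx hyx hL⟩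
        · obtain ⟨N, hN, H⟩ := Apdb.exists_restartTest_yx_of_mu_pos h ha hne (q := q) hξ hq hΨ h0
          exact ⟨N, hN, fun z hz => H z hz (hgrowth z hz) (hacc₀ z hz)⟩)
    -- The loss is monotone in K, so its bound at `Kbar` covers every inner loop.
    obtain ⟨U, hU⟩ := Apdb.exists_runLoss_le (B := B) h ha hΨ Kbar
    refine ⟨Kbar, hKbar, fun h0 Lxx Lyx hxx hyx hL => hmin _
      (Apdb.one_le_innerBound h ha (psiYX_pos ha hxx hyx) hξ _ _ _)
      (hmu0 h0 q hq Lxx Lyx hxx hyx hL), fun h0 hcnm => hmin _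
      (Nat.one_le_iff_ne_zero.2 (Nat.ceil_pos.2 (by positivity)).ne')
      (hmupos h0 hcnm q hq hq1), fun z₀ hz₀ z hz => ?_⟩
    refine Apdb.restart_converges htest hKbar h ha hne (C := constTwo a Lφ .yx ^ 2 * U) hξ hρ hq
      hq1 hΨ subset_rfl hacc₀ hgrowth (fun z hz K hK1 hK zs hzs => ?_) hz₀ hz fun t ht => ht
    obtain ⟨K, rfl⟩ := Nat.exists_eq_add_of_le' hK1
    refine (Apdb.norm_average_sub_sq_le_yx h ha hz hΨ (hacc₀ z hz) hzs).trans ?_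
    have h1 : Apdb.runLoss P φ B a z K ≤ Apdb.runLoss P φ B a z Kbar :=
      StepSequence.lossProd_mono (by omega)
    have h2 := h1.trans (hU z hz (hacc₀ z hz))
    gcongr
  · obtain ⟨ρ, hρ, hgrowth⟩ := h.exists_quadratic_growth hξ hsub M
    refine ⟨ρ, hρ, hgrowth, fun a ha => ?_⟩
    set T : Set (PDSpace n p m) := {z | z ∈ P.domain ⊤ ∧ ‖z‖ ≤ M} with hT
    obtain ⟨Ψ, hΨ, hacc⟩ := Apdb.exists_acceptsBelow_xy h ha hsaddle M
    have hbounds : ∀ z ∈ T, ∀ K, 1 ≤ K → Apdb.AverageBounds P φ ⊤ a .xy Lφ z K :=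
      fun z hz K hK => Apdb.averageBounds_xy h ha hz.1 hΨ (hacc z hz.1 hz.2) hK
    have hinner : ∀ q : ℝ, 0 < q → ∀ Ψ : ℝ, 0 < Ψ → (∀ z ∈ T, ∀ k,
        Apdb.AcceptsBelow P φ ⊤ a .xy (Apdb.state P φ ⊤ a .xy z k) Ψ) → ∀ z ∈ T, ∀ K,
          innerBound (constOne a Lφ Ψ) (constTwo a Lφ .xy) ρ q ξ ≤ K →
          Apdb.RestartTest P φ ⊤ a ξ q .xy z K := fun q hq Ψ hΨ hacc z hz K hK =>
      Apdb.AverageBounds.restartTest_of_innerBound_le h ha hsaddle hξ hq hz.1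
        (hgrowth z hz.1 hz.2) hΨ (hacc z hz) hK
        (hbounds z hz K ((Apdb.one_le_innerBound h ha hΨ hξ _ _ _).trans hK))
    have hmupos : ∃ C : ℝ, 0 < C ∧ (0 < P.mu → ∀ q : ℝ, 0 < q → q < 1 →
        ∀ z ∈ T, ∀ K : ℕ, ⌈C / Real.sqrt q⌉₊ ≤ K →
          Apdb.RestartTest P φ ⊤ a ξ q .xy z K) := by
      by_cases hc : 0 < P.mu
      · obtain ⟨C, hC, H⟩ :=
          Apdb.AverageBounds.exists_restartTest_of_ceil_le h ha hsaddle ρ hξ hΨ hc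
        exact ⟨C, hC, fun _ q hq hq1 z hz => H q hq hq1 z hz.1 (hgrowth z hz.1 hz.2)
          (hacc z hz.1 hz.2) (hbounds z hz)⟩
      · exact ⟨1, one_pos, fun h1 => absurd h1 hc⟩
    obtain ⟨C, hC, hmupos⟩ := hmupos
    refine ⟨C, hC, fun q hq hq1 => ?_⟩
    obtain ⟨Kbar, hKbar, htest, hmin⟩ := Apdb.exists_minimal_uniform_length
      (P := P) (φ := φ) (B := ⊤) (a := a) (ξ := ξ) (q := q) (T := T) .xy
        ⟨_, Apdb.one_le_innerBound h ha hΨ hξ _ _ _, hinner q hq Ψ hΨ fun z hz => hacc z hz.1 hz.2⟩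
    refine ⟨Kbar, hKbar, fun _ R Lxx Lxy hR hxx hxy hRM hLxx hLxy => hmin _
      (Apdb.one_le_innerBound h ha (psiXY_pos ha hxx hxy) hξ _ _ _)
      (hinner q hq _ (psiXY_pos ha hxx hxy) fun z hz k => ?_), fun h0 => hmin _
      (Nat.one_le_iff_ne_zero.2 (Nat.ceil_pos.2 (by positivity)).ne')
      (hmupos h0 q hq hq1), fun z₀ hz₀ z hz hzM => ?_⟩
    · obtain ⟨zs, hzs, hzsR⟩ := hRM z hz.1 hz.2
      exact (Apdb.energy_xy_le_and_acceptsBelow h ha hz.1 hR hxx hxy hLxx hLxy hzs hzsR k).2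
    · exact Apdb.restart_converges htest hKbar h ha hsaddle (C := constTwo a Lφ .xy ^ 2) hξ hρ hq
        hq1 hΨ (fun z hz => hz.1) (fun z hz => hacc z hz.1 hz.2)
        (fun z hz => hgrowth z hz.1 hz.2)
        (fun z hz K hK1 _ zs hzs => (hbounds z hz K hK1).dist_le zs hzs) hz₀ hz
        fun t ht => ⟨ht, hzM t⟩
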